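/- Throughout, $d\ge 1$, $\mathbb R^d$ carries the supremum distance, $|S|$ is the diameter of $S$, $B(x,r)$ is the closed ball, $\dim$ is Hausdorff dimension, and $c\ge 2$ is a fixed integer. For $j\ge 0$ and $\mathbf k\in\{0,\dots,c^j-1\}^d$ let $I_{j,\mathbf k}=\prod_i[k_ic^{-j},(k_i+1)c^{-j})$ (the $c$-adic boxes); for $y\in[0,1)^d$ let $\mathbf k_{j,y}$ be the index with $y\in I_{j,\mathbf k_{j,y}}$. The neighbours of $y$ at generation $j$ are the boxes $I_{j,\mathbf k}$, $\mathbf k\in\{0,\dots,c^j-1\}^d$, with $\|\mathbf k-\mathbf k_{j,y}\|_\infty\le1$. Let $\mu$ be a finite Borel measure with support $[0,1]^d$ and $\mu([0,1]^d\setminus[0,1)^d)=0$, let $(x_n)$ be a sequence in $[0,1]^d$, $(\lambda_n)$ a non-increasing sequence of positive reals tending to $0$, $\rho\in(0,1]$ and $\alpha>0$. Put $$\tau_\mu(q)=\liminf_{j\to\infty}-\tfrac1j\log_c\sum_{\mathbf k}\mu(I_{j,\mathbf k})^q,\qquad \tau_\mu^*(\alpha)=\inf_{q\in\mathbb R}(\alpha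 q-\tau_\mu(q)),$$ and suppose that $\beta:=\tau_\mu^*(\alpha)$ is a positive real number. *Weak redundancy.* There are integers $N_j$ with $\log N_j/j\to0$ such that for every $j\ge1$ the set $T_j=\{n:2^{-(j+1)}<\lambda_n\le2^{-j}\}$ is a union of $N_j$ pairwise disjoint sets $T_{j,1},\dots,T_{j,N_j}$, where for each $i$ the balls $B(x_n,\lambda_n)$, $n\in T_{j,i}$, are pairwise disjoint. *$\rho$-heterogeneous ubiquity with respect to $(\mu,\alpha,\beta)$*, with functions $\varphi,\psi,\chi$ and exponent set $\mathcal D$: (1) $\varphi,\psi$ are non-decreasing and continuous on $[0,\infty)$, $\varphi(0)=\psi(0)=0$; $r\mapsto r^{-\varphi(r)}$ and $r\mapsto r^{-\psi(r)}$ are non-increasing near $0^+$; $r^{-\varphi(r)}\to\infty$ as $r\to0^+$; for every $\eta>0$, $r\mapsto r^{\eta-\varphi(r)}$ is non-decreasing near $0^+$. (2) There is a finite measure $m$ with support $[0,1]^d$ such that, for $m$-almost every $y\in[0,1)^d$ and all sufficiently large $j$, every neighbour $I$ of $y$ at generation $j$ satisfies $|I|^{\alpha+\psi(|I|)}\le\mu(I)\le|I|^{\alpha-\psi(|I|)}$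 and $m(I)\le|I|^{\beta-\varphi(|I|)}$. (3) For every $c$-adic box $L$ there is a finite measure $m^L$ equivalent to $m|_L$ such that, if $f_L$ is the canonical affine map of $L$ onto $[0,1)^d$, then for $m^L\circ f_L^{-1}$-almost every $y$ and all large $j$ every neighbour $I$ of $y$ at generation $j$ satisfies $m^L\circ f_L^{-1}(I)\le|I|^{\beta-\varphi(|I|)}$. Let $E^L_n$ be the set of $y\in L$ such that, for all $j\ge n+\log_c(|L|^{-1})$, every neighbour $I$ of $y$ at generation $j$ satisfies $m^L(I)\le(|I|/|L|)^{\beta-\varphi(|I|/|L|)}$; let $n_L=\inf\{n\ge1:m^L(E^L_n)\ge\|m^L\|/2\}$. Call $L$ good if $n_L\le\log_c(|L|^{-1})\varphi(|L|)$ and $|L|^{\varphi(|L|)}\le\|m^L\|$. (4) If $\rho=1$: $\chi=0$; $m$-almost every $y$ lies in $\limsup_nB(x_n,\lambda_n/2)$; $\mathcal D\subset(1,\infty)$; and for every $\delta\in\mathcal D$ and $m$-almost every $y\in\limsup_nB(x_n,\lambda_n/2)$ there are infinitely many $j$ for which there is $n$ with $y\in B(x_n,\lambda_n/2)$ and $c^{-(j+1)}<\lambda_n\le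 c^{-j}$ such that one of the $c$-adic boxes of maximal diameter among those contained in the open ball of centre $x_n$ and radius $\lambda_n^\delta$ is good. (4') If $\rho<1$: $\mathcal D=(1,\infty)$; all $c$-adic boxes of sufficiently large generation are good; $\chi$ is non-decreasing and continuous on $[0,\infty)$, $\chi(0)=0$, $r\mapsto r^{-\chi(r)}$ is non-increasing near $0^+$ and tends to $\infty$ as $r\to0^+$, for all $\eta,\theta,\gamma>0$ the map $r\mapsto r^{\eta-\theta\varphi(r)-\gamma\chi(r)}$ is non-decreasing near $0^+$; and for $m$-almost every $y$ there are infinitely many $j$ such that $B(y,c^{-\rho j})$ contains at least $c^{j(d(1-\rho)-\chi(c^{-j}))}$ points $x_n$ whose couples satisfy $\lambda_n\in[c^{-j+1},c^{-j(1-\chi(c^{-j}))}]$ and whose balls $B(x_n,\lambda_n)$ are pairwise disjoint. *Conditioned limsup sets.* For real sequences $\widehat\delta=(\delta_n)$ and $\varepsilon=(\varepsilon_n)$ let $$\widehat S_\mu(\rho,\widehat\delta,\alpha,\varepsilon)=\bigcap_{N}\ \bigcup_{n\ge N:\ \lambda_n^{\rho(\alpha+\varepsilon_n)}\le\mu(B(x_n,\lambda_n^\rho))\le\lambda_n^{\rho(\alpha-\varepsilon_n)}}B(x_n,\lambda_n^{\delta_n}),$$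 written $S_\mu(\rho,\delta,\alpha,\varepsilon)$ if $\widehat\delta$ is constant equal to $\delta$. For $M\ge1$ let $\varepsilon_M^\rho=(\max(\varepsilon_n^-,\varepsilon_n^+))_n$ where, with $r_n=\lambda_n^\rho$, $r_n^{\alpha\pm\varepsilon^{\pm}_n}=M^{\mp1}(2r_n)^{\alpha\pm\psi(2r_n)\pm2\alpha\chi(2r_n)}$ (whenever $\lambda_n\neq 1$). Let $\widehat{\mathcal D}$ be the set of limits of non-decreasing sequences of elements of $\{1\}\cup\mathcal D$, and $D(\beta,\rho,\delta)=\min\big(\frac{d(1-\rho)+\rho\beta}{\delta},\beta\big)$. **Statement.** Let $\widetilde\varepsilon$ be a real sequence converging to $0$. If $\{(x_n,\lambda_n)\}$ is weakly redundant and forms a $\rho$-heterogeneous ubiquitous system with respect to $(\mu,\alpha,\tau_\mu^*(\alpha))$ (with $\varphi,\psi,\chi,\mathcal D$), then there is $M\ge1$ such that for every $\delta\in\widehat{\mathcal D}$ with $\delta\ge\frac{d(1-\rho)+\rho\tau_\mu^*(\alpha)}{\tau_\mu^*(\alpha)}$ there is a non-decreasing sequence $\widehat\delta$ in $[1,\infty)$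 converging to $\delta$ such that $$\dim\widehat S_\mu(\rho,\widehat\delta,\alpha,\varepsilon^\rho_M)=\dim\Big(\widehat S_\mu(\rho,\widehat\delta,\alpha,\varepsilon^\rho_M)\setminus\bigcup_{\delta'>\delta}S_\mu(\rho,\delta',\alpha,\widetilde\varepsilon)\Big)=D(\tau_\mu^*(\alpha),\rho,\delta).$$ Moreover, $\widehat\delta$ can be taken constant equal to $\delta$ if $\delta\in\{1\}\cup\mathcal D$. -/

import Mathlib

open Set Filter Topology MeasureTheory

namespace CondUbiquity

variable {d : ℕ}

/-! Points live in `Fin d → ℝ` with its supremum distance; `Metric.closedBall` is the closed ball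
`B(x,r)` of that distance, and `Metric.diam` is the diameter `|S|`. -/

/-- The closed unit cube `[0,1]^d`. -/
def cube (d : ℕ) : Set (Fin d → ℝ) := Set.Icc 0 1

/-- The half-open unit cube `[0,1)^d`. -/
def hoCube (d : ℕ) : Set (Fin d → ℝ) := {y | ∀ i, 0 ≤ y i ∧ y i < 1}

/-- The indices `{0, …, c^j - 1}^d` of the `c`-adic boxes of generation `j`. -/
def grid (d c j : ℕ) : Set (Fin d → ℕ) := {k | ∀ i, k i < c ^ j}

/-- The half-open `c`-adic box `∏ᵢ [kᵢ c⁻ʲ, (kᵢ + 1) c⁻ʲ)`. -/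
def box (c j : ℕ) (k : Fin d → ℕ) : Set (Fin d → ℝ) :=
  {y | ∀ i, (k i : ℝ) / (c : ℝ) ^ j ≤ y i ∧ y i < ((k i : ℝ) + 1) / (c : ℝ) ^ j}

/-- The index of the `c`-adic box of generation `j` containing `y ∈ [0,1)^d`. -/
noncomputable def boxIdx (c j : ℕ) (y : Fin d → ℝ) : Fin d → ℕ :=
  fun i => ⌊(c : ℝ) ^ j * y i⌋₊

/-- The indices in the grid at supremum distance at most one from the index of the box
of generation `j` containing `y`. -/
def nbrs (c j : ℕ) (y : Fin d → ℝ) : Set (Fin d → ℕ) :=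
  {k | k ∈ grid d c j ∧ ∀ i, k i ≤ boxIdx c j y i + 1 ∧ boxIdx c j y i ≤ k i + 1}

/-- The affine map `x ↦ c^j x - k` sending the box of index `(j,k)` onto `[0,1)^d`. -/
def rescale (c j : ℕ) (k : Fin d → ℕ) (y : Fin d → ℝ) : Fin d → ℝ :=
  fun i => (c : ℝ) ^ j * y i - (k i : ℝ)

/-! ### Weakly redundant systems -/

/-- `T_j = {n : 2^{-(j+1)} < λ_n ≤ 2^{-j}}`. -/
def scaleSet (lam : ℕ → ℝ) (j : ℕ) : Set ℕ :=
  {n | ((2 : ℝ) ^ (j + 1))⁻¹ < lam n ∧ lam n ≤ ((2 : ℝ) ^ j)⁻¹}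

/-- Weak redundancy of the family `(x_n, λ_n)`. -/
def WeaklyRedundant (x : ℕ → Fin d → ℝ) (lam : ℕ → ℝ) : Prop :=
  ∃ N : ℕ → ℕ,
    Tendsto (fun j : ℕ => Real.log (N j) / (j : ℝ)) atTop (𝓝 0) ∧
    ∀ j : ℕ, 1 ≤ j → ∃ T : Fin (N j) → Set ℕ,
      (⋃ i, T i) = scaleSet lam j ∧
      (∀ i i', i ≠ i' → Disjoint (T i) (T i')) ∧
      ∀ i, (T i).PairwiseDisjoint (fun n => Metric.closedBall (x n) (lam n))

/-! ### The function `τ_μ` and its Legendre transform -/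

/-- `τ_μ(q) = liminf_j -j⁻¹ log_c ∑_k μ(I_{j,k})^q`, with values in `[-∞, ∞]`. -/
noncomputable def tau (c : ℕ) (μ : Measure (Fin d → ℝ)) (q : ℝ) : EReal :=
  liminf (fun j : ℕ =>
    ((-(j : ℝ)⁻¹ * Real.logb c
      (∑ k : Fin d → Fin (c ^ j), μ.real (box c j (fun i => (k i : ℕ))) ^ q) : ℝ) : EReal)) atTop

/-- `τ_μ^*(α) = inf_q (α q - τ_μ(q))`. -/
noncomputable def tauStar (c : ℕ) (μ : Measure (Fin d → ℝ)) (α : ℝ) : EReal :=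
  ⨅ q : ℝ, ((α * q : ℝ) : EReal) - tau c μ q

/-! ### Heterogeneous ubiquitous systems -/

/-- `|I|^{α+ψ(|I|)} ≤ μ(I) ≤ |I|^{α-ψ(|I|)}`. -/
def PBound (μ : Measure (Fin d → ℝ)) (α : ℝ) (ψ : ℝ → ℝ) (I : Set (Fin d → ℝ)) : Prop :=
  Metric.diam I ^ (α + ψ (Metric.diam I)) ≤ μ.real I ∧
    μ.real I ≤ Metric.diam I ^ (α - ψ (Metric.diam I))

/-- `m(I) ≤ |I|^{β-φ(|I|)}`. -/
def DBound (m : Measure (Fin d → ℝ)) (β : ℝ) (φ : ℝ → ℝ) (I : Set (Fin d → ℝ)) : Prop :=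
  m.real I ≤ Metric.diam I ^ (β - φ (Metric.diam I))

/-- For `m`-almost every `y ∈ [0,1)^d`, at all large generations the box containing `y` and its
neighbours in the grid satisfy `PBound μ α ψ`. -/
def LocalScaling (c : ℕ) (m μ : Measure (Fin d → ℝ)) (α : ℝ) (ψ : ℝ → ℝ) : Prop :=
  ∀ᵐ y ∂m, y ∈ hoCube d → ∃ j₀ : ℕ, ∀ j : ℕ, j₀ ≤ j →
    ∀ k ∈ nbrs c j y, PBound μ α ψ (box c j k)

/-- For `m`-almost every `y ∈ [0,1)^d`, at all large generations the box containing `y` and its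
neighbours in the grid satisfy `DBound m β φ`. -/
def LocalUpper (c : ℕ) (m : Measure (Fin d → ℝ)) (β : ℝ) (φ : ℝ → ℝ) : Prop :=
  ∀ᵐ y ∂m, y ∈ hoCube d → ∃ j₀ : ℕ, ∀ j : ℕ, j₀ ≤ j →
    ∀ k ∈ nbrs c j y, DBound m β φ (box c j k)

/-- A function on `[0, ∞)` that is non-decreasing, continuous, vanishes at `0`, and for which
`r ↦ r^{-f(r)}` is non-increasing near `0⁺`. -/
structure IsGaugeExponent (f : ℝ → ℝ) : Prop where
  mono : MonotoneOn f (Ici 0)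
  cont : ContinuousOn f (Ici 0)
  zero : f 0 = 0
  anti : ∃ r₀ : ℝ, 0 < r₀ ∧ AntitoneOn (fun r : ℝ => r ^ (-f r)) (Ioo 0 r₀)

/-- The requirements on `φ` and `ψ` alone. -/
structure GaugeCond (φ ψ : ℝ → ℝ) : Prop where
  phi : IsGaugeExponent φ
  psi : IsGaugeExponent ψ
  lim : Tendsto (fun r : ℝ => r ^ (-φ r)) (𝓝[>] 0) atTop
  mono : ∀ ε : ℝ, 0 < ε →
    ∃ r₀ : ℝ, 0 < r₀ ∧ MonotoneOn (fun r : ℝ => r ^ (ε - φ r)) (Ioo 0 r₀)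

/-- The additional requirements on `χ` when `ρ < 1`. -/
structure ChiCond (φ χ : ℝ → ℝ) : Prop where
  chi : IsGaugeExponent χ
  lim : Tendsto (fun r : ℝ => r ^ (-χ r)) (𝓝[>] 0) atTop
  mono : ∀ ε θ γ : ℝ, 0 < ε → 0 < θ → 0 < γ →
    ∃ r₀ : ℝ, 0 < r₀ ∧ MonotoneOn (fun r : ℝ => r ^ (ε - θ * φ r - γ * χ r)) (Ioo 0 r₀)

/-- The self-similarity condition: `mL i k` is the measure `m^L` attached to the box `L` of
index `(i,k)`; it is finite, equivalent to the restriction of `m` to `L`, and its image under the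
affine map from `L` onto `[0,1)^d` satisfies `LocalUpper`. -/
def SelfSimilar (c : ℕ) (m : Measure (Fin d → ℝ)) (mL : ℕ → (Fin d → ℕ) → Measure (Fin d → ℝ))
    (β : ℝ) (φ : ℝ → ℝ) : Prop :=
  ∀ (i : ℕ), ∀ k ∈ grid d c i,
    IsFiniteMeasure (mL i k) ∧
    mL i k ≪ m.restrict (box c i k) ∧ m.restrict (box c i k) ≪ mL i k ∧
    LocalUpper c ((mL i k).map (rescale c i k)) β φ

/-- The set `E_n^L` for the box `L` of index `(i,k)`; note that `log_c (|L|⁻¹) = i`. -/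
def levelSet (c : ℕ) (ν : Measure (Fin d → ℝ)) (β : ℝ) (φ : ℝ → ℝ) (i : ℕ) (k : Fin d → ℕ)
    (n : ℕ) : Set (Fin d → ℝ) :=
  {y | y ∈ box c i k ∧ ∀ j : ℕ, n + i ≤ j → ∀ k' ∈ nbrs c j y,
    ν.real (box c j k') ≤ (Metric.diam (box c j k') / Metric.diam (box c i k)) ^
      (β - φ (Metric.diam (box c j k') / Metric.diam (box c i k)))}

/-- `n_L = inf {n ≥ 1 : m^L(E_n^L) ≥ ‖m^L‖ / 2}`. -/
noncomputable def growth (c : ℕ) (ν : Measure (Fin d → ℝ)) (β : ℝ) (φ : ℝ → ℝ) (i : ℕ)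
    (k : Fin d → ℕ) : ℕ :=
  sInf {n : ℕ | 1 ≤ n ∧ ν.real univ / 2 ≤ ν.real (levelSet c ν β φ i k n)}

/-- `n_L ≤ log_c(|L|⁻¹) φ(|L|)` and `|L|^{φ(|L|)} ≤ ‖m^L‖` for the box `L` of index `(i,k)`. -/
def GoodBox (c : ℕ) (mL : ℕ → (Fin d → ℕ) → Measure (Fin d → ℝ)) (β : ℝ) (φ : ℝ → ℝ)
    (i : ℕ) (k : Fin d → ℕ) : Prop :=
  (growth c (mL i k) β φ i k : ℝ) ≤ (i : ℝ) * φ (Metric.diam (box c i k)) ∧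
    Metric.diam (box c i k) ^ φ (Metric.diam (box c i k)) ≤ (mL i k).real univ

/-- The box of index `(i,k)` is a `c`-adic box of `[0,1)^d` of maximal diameter among those
contained in `U`. -/
def IsMaxBox (c : ℕ) (U : Set (Fin d → ℝ)) (i : ℕ) (k : Fin d → ℕ) : Prop :=
  k ∈ grid d c i ∧ box c i k ⊆ U ∧
    ∀ (i' : ℕ), ∀ k' ∈ grid d c i', box c i' k' ⊆ U →
      Metric.diam (box c i' k') ≤ Metric.diam (box c i k)

/-- `limsup_n B(x_n, λ_n / 2)`. -/
def halfLimsup (x : ℕ → Fin d → ℝ) (lam : ℕ → ℝ) : Set (Fin d → ℝ) :=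
  ⋂ N : ℕ, ⋃ n : ℕ, ⋃ _ : N ≤ n, Metric.closedBall (x n) (lam n / 2)

/-- The growth-control condition for `ρ = 1` with the set `D` of exponents. -/
def GrowthControl (c : ℕ) (m : Measure (Fin d → ℝ))
    (mL : ℕ → (Fin d → ℕ) → Measure (Fin d → ℝ)) (β : ℝ) (φ : ℝ → ℝ)
    (x : ℕ → Fin d → ℝ) (lam : ℕ → ℝ) (D : Set ℝ) : Prop :=
  D ⊆ Ioi 1 ∧ ∀ δ ∈ D, ∀ᵐ y ∂m, y ∈ halfLimsup x lam →
    {j : ℕ | ∃ n : ℕ, y ∈ Metric.closedBall (x n) (lam n / 2) ∧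
      ((c : ℝ) ^ (j + 1))⁻¹ < lam n ∧ lam n ≤ ((c : ℝ) ^ j)⁻¹ ∧
      ∃ (i : ℕ) (k : Fin d → ℕ),
        IsMaxBox c (Metric.ball (x n) (lam n ^ δ)) i k ∧ GoodBox c mL β φ i k}.Infinite

/-- The uniform growth-control condition used for `ρ < 1`. -/
def UniformGrowthControl (c : ℕ) (mL : ℕ → (Fin d → ℕ) → Measure (Fin d → ℝ)) (β : ℝ)
    (φ : ℝ → ℝ) : Prop :=
  ∃ J : ℕ, ∀ j : ℕ, J ≤ j → ∀ k ∈ grid d c j, GoodBox c mL β φ j k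

/-- The covering condition for `ρ < 1`: for `m`-almost every `y`, for infinitely many `j`, the ball
`B(y, c^{-ρj})` contains at least `c^{j(d(1-ρ)-χ(c^{-j}))}` points `x_n` with
`λ_n ∈ [c^{-j+1}, c^{-j(1-χ(c^{-j}))}]` and with pairwise disjoint balls `B(x_n, λ_n)`. -/
def ManyPoints (c : ℕ) (ρ : ℝ) (m : Measure (Fin d → ℝ)) (χ : ℝ → ℝ)
    (x : ℕ → Fin d → ℝ) (lam : ℕ → ℝ) : Prop :=
  ∀ᵐ y ∂m, {j : ℕ | ∃ s : Finset ℕ,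
    (c : ℝ) ^ ((j : ℝ) * ((d : ℝ) * (1 - ρ) - χ ((c : ℝ) ^ (-(j : ℝ))))) ≤ (s.card : ℝ) ∧
    (∀ n ∈ s, x n ∈ Metric.closedBall y ((c : ℝ) ^ (-(ρ * (j : ℝ)))) ∧
      (c : ℝ) ^ (-(j : ℝ) + 1) ≤ lam n ∧
      lam n ≤ (c : ℝ) ^ (-((j : ℝ) * (1 - χ ((c : ℝ) ^ (-(j : ℝ))))))) ∧
    (s : Set ℕ).PairwiseDisjoint (fun n => Metric.closedBall (x n) (lam n))}.Infinite

/-- The family `(x_n, λ_n)` forms a `ρ`-heterogeneous ubiquitous system with respect to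
`(μ, α, β)`, with associated functions `φ, ψ, χ` and set of exponents `D`, relatively to the
`c`-adic grid. By convention `χ = 0` if `ρ = 1` and `D = (1, ∞)` if `ρ < 1`. -/
def HeterogeneousUbiquitous (c : ℕ) (ρ : ℝ) (μ : Measure (Fin d → ℝ)) (α β : ℝ)
    (x : ℕ → Fin d → ℝ) (lam : ℕ → ℝ) (φ ψ χ : ℝ → ℝ) (D : Set ℝ) : Prop :=
  GaugeCond φ ψ ∧
  ∃ (m : Measure (Fin d → ℝ)) (mL : ℕ → (Fin d → ℕ) → Measure (Fin d → ℝ)),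
    IsFiniteMeasure m ∧ m.support = cube d ∧
    LocalScaling c m μ α ψ ∧ LocalUpper c m β φ ∧ SelfSimilar c m mL β φ ∧
    ((ρ = 1 ∧ (∀ r, χ r = 0) ∧
        (∀ᵐ y ∂m, y ∈ halfLimsup x lam) ∧ GrowthControl c m mL β φ x lam D) ∨
      (ρ < 1 ∧ D = Ioi 1 ∧ ChiCond φ χ ∧
        ManyPoints c ρ m χ x lam ∧ UniformGrowthControl c mL β φ))

/-! ### Conditioned limsup sets -/

/-- The set `Ŝ_μ(ρ, δ̂, α, ε)`. -/
def condLimsup (μ : Measure (Fin d → ℝ)) (x : ℕ → Fin d → ℝ) (lam : ℕ → ℝ) (ρ : ℝ)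
    (δ : ℕ → ℝ) (α : ℝ) (ε : ℕ → ℝ) : Set (Fin d → ℝ) :=
  ⋂ N : ℕ, ⋃ n : ℕ, ⋃ _ : N ≤ n ∧
      lam n ^ (ρ * (α + ε n)) ≤ μ.real (Metric.closedBall (x n) (lam n ^ ρ)) ∧
      μ.real (Metric.closedBall (x n) (lam n ^ ρ)) ≤ lam n ^ (ρ * (α - ε n)),
    Metric.closedBall (x n) (lam n ^ δ n)

/-- The sequence `ε_M^ρ = max(ε⁻, ε⁺)`, where, with `r = λ_n^ρ`,
`r^{α+ε⁺} = M⁻¹ (2r)^{α+ψ(2r)+2αχ(2r)}` and `r^{α-ε⁻} = M (2r)^{α-ψ(2r)-2αχ(2r)}`. -/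
noncomputable def epsSeq (lam : ℕ → ℝ) (ρ α : ℝ) (ψ χ : ℝ → ℝ) (M : ℝ) (n : ℕ) : ℝ :=
  max
    (α - Real.logb (lam n ^ ρ)
      (M * (2 * lam n ^ ρ) ^ (α - ψ (2 * lam n ^ ρ) - 2 * α * χ (2 * lam n ^ ρ))))
    (Real.logb (lam n ^ ρ)
      (M⁻¹ * (2 * lam n ^ ρ) ^ (α + ψ (2 * lam n ^ ρ) + 2 * α * χ (2 * lam n ^ ρ))) - α)

/-- Limits of non-decreasing sequences of elements of `{1} ∪ D`. -/
def exponentLimits (D : Set ℝ) : Set ℝ :=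
  {δ | ∃ u : ℕ → ℝ, Monotone u ∧ (∀ n, u n ∈ {1} ∪ D) ∧ Tendsto u atTop (𝓝 δ)}

/-- `D(β, ρ, δ) = min((d(1-ρ)+ρβ)/δ, β)`. -/
noncomputable def dimFormula (d : ℕ) (β ρ δ : ℝ) : ℝ :=
  min (((d : ℝ) * (1 - ρ) + ρ * β) / δ) β

end CondUbiquity

open scoped ENNReal

namespace CondUbiquity

variable {d : ℕ}

/-! ### Geometry of the `c`-adic grid -/

/-! Write E = d(1-ρ) + ρβ. Since δ ≥ E/β, the expected dimension is E/δ. Call an index n admissible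
if B(x_n, λ_n^ρ) satisfies the mass condition with exponent α.

Upper bound. Consider the admissible n with λ_n of order 2^{-J}. The ball B(x_n, λ_n^ρ) has mass
about λ_n^{ρα}, so near it there is a box I of side about 2^{-Jρ} for which μ(I)^q is at least about
|I|^{αq}; here q nearly attains the infimum defining τ_μ^*(α). The moment sum then allows about
2^{Jρβ} such boxes. A comparison of volumes allows about 2^{Jd(1-ρ)} pairwise disjoint balls per
box, and weak redundancy only costs 2^{o(J)} disjoint classes. Hence there are at most 2^{J(E+o(1))}
admissible indices (`exists_card_scale_le`), and covering by the balls of radius λ_n^{δ_n} gives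
dimension at most E/δ (`dimH_condLimsup_le`).

Lower bound. No measure is built on a Cantor set. The stronger fact proved is that the conditioned
limsup set is not covered by countably many sets of dimension less than E/δ. The sets with exponent
δ' > δ lie in countably many sets whose dimension is less than E/δ by the upper bound, so removing
them changes nothing (`le_dimH_diff`).

Non-covering is a descent (`exists_mem_limsup_notMem`). A state consists of a box L, an open set
around it, and a family of sets to be avoided whose total s-cost near L lies below a threshold
attached to m^L. Small covers of further sets are added to the family at each stage. An averaging
argument over a Besicovitch covering (`exists_small_cost_of_blocks`) then finds an admissible ball
near L on which the family is again cheap. That ball contains a good box, and goodness means that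
its threshold is at least |L|^t with t barely above s, so the invariant is restored. The limit point
lies in all chosen balls. It avoids every set of the family, since a set of fixed positive size
containing it would eventually exceed the thresholds.

The averaging runs over blocks: finite groups of balls near a typical point, no small set of which
can be hit too often. For ρ = 1 a block is a single ball; for ρ < 1 it is the group of disjoint
balls given by the covering condition. Admissibility of these balls comes from the local scaling of
μ at m-typical points (`exists_mass_bounds`).

Two cases need more. For ρ = δ = 1 no growth control is available, but m itself does not charge sets
of dimension less than β. For ρ = 1 and δ only a limit of exponents of the system, a Borel–Cantelli
argument lets the exponent increase slowly with n (`exists_monotone_stage`). -/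

lemma box_eq_pi (c j : ℕ) (k : Fin d → ℕ) :
    box c j k = Set.pi univ (fun i => Ico ((k i : ℝ) / (c : ℝ) ^ j)
      (((k i : ℝ) + 1) / (c : ℝ) ^ j)) := by
  ext y; simp [box]

lemma measurableSet_box (c j : ℕ) (k : Fin d → ℕ) : MeasurableSet (box c j k) := by
  rw [box_eq_pi]
  exact MeasurableSet.univ_pi fun i => measurableSet_Ico

lemma dist_le_of_mem_box {c : ℕ} (hc : 0 < c) {j : ℕ} {k : Fin d → ℕ} {y z : Fin d → ℝ}
    (hy : y ∈ box c j k) (hz : z ∈ box c j k) : dist y z ≤ ((c : ℝ) ^ j)⁻¹ := by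
  have hc' : (0 : ℝ) < (c : ℝ) ^ j := by positivity
  refine (dist_pi_le_iff (by positivity)).2 fun i => ?_
  have h1 := hy i
  have h2 := hz i
  have : ((k i : ℝ) + 1) / (c : ℝ) ^ j = (k i : ℝ) / (c : ℝ) ^ j + ((c : ℝ) ^ j)⁻¹ := by
    field_simp
  rw [this] at h1 h2
  rw [Real.dist_eq, abs_le]
  constructor <;> linarith [h1.1, h1.2, h2.1, h2.2]

lemma isBounded_box {c : ℕ} (hc : 0 < c) (j : ℕ) (k : Fin d → ℕ) :
    Bornology.IsBounded (box c j k) :=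
  Metric.isBounded_iff.2 ⟨_, fun _ hy _ hz => dist_le_of_mem_box hc hy hz⟩

lemma corner_add_mem_box {c : ℕ} (hc : 0 < c) (j : ℕ) (k : Fin d → ℕ) {t : ℝ} (ht : 0 ≤ t)
    (ht' : t < ((c : ℝ) ^ j)⁻¹) : (fun i => (k i : ℝ) / (c : ℝ) ^ j + t) ∈ box c j k := by
  have hc' : (0 : ℝ) < (c : ℝ) ^ j := by positivity
  intro i
  have : ((k i : ℝ) + 1) / (c : ℝ) ^ j = (k i : ℝ) / (c : ℝ) ^ j + ((c : ℝ) ^ j)⁻¹ := by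
    field_simp
  rw [this]
  constructor <;> simp <;> linarith

/-- The upper endpoints are missing, so the supremum is only approached: translates of the corner
along the diagonal by `t < c⁻ʲ` give the lower bound. A coordinate exists because `1 ≤ d`. -/
lemma diam_box (hd : 1 ≤ d) {c : ℕ} (hc : 0 < c) (j : ℕ) (k : Fin d → ℕ) :
    Metric.diam (box c j k) = ((c : ℝ) ^ j)⁻¹ := by
  have hc' : (0 : ℝ) < (c : ℝ) ^ j := by positivity
  have hc'' : (0 : ℝ) < ((c : ℝ) ^ j)⁻¹ := by positivity
  apply le_antisymm
  · exact Metric.diam_le_of_forall_dist_le hc''.le fun _ hy _ hz => dist_le_of_mem_box hc hy hz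
  · refine le_of_forall_lt_imp_le_of_dense fun t ht => ?_
    rcases le_or_gt t 0 with h0 | h0
    · exact h0.trans Metric.diam_nonneg
    have := Metric.dist_le_diam_of_mem (isBounded_box hc j k)
      (corner_add_mem_box hc j k h0.le ht) (corner_add_mem_box hc j k le_rfl hc'')
    refine le_trans ?_ this
    have h := dist_le_pi_dist (fun i => (k i : ℝ) / (c : ℝ) ^ j + t)
      (fun i => (k i : ℝ) / (c : ℝ) ^ j + 0) ⟨0, hd⟩
    refine le_trans ?_ h
    rw [Real.dist_eq]
    simpa using le_abs_self t

lemma box_subset_hoCube {c : ℕ} (hc : 0 < c) {j : ℕ} {k : Fin d → ℕ} (hk : k ∈ grid d c j) :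
    box c j k ⊆ hoCube d := by
  have hc' : (0 : ℝ) < (c : ℝ) ^ j := by positivity
  intro y hy i
  refine ⟨le_trans (by positivity) (hy i).1, lt_of_lt_of_le (hy i).2 ?_⟩
  rw [div_le_one hc']
  exact_mod_cast hk i

lemma boxIdx_mem_grid {c : ℕ} (hc : 0 < c) (j : ℕ) {y : Fin d → ℝ} (hy : y ∈ hoCube d) :
    boxIdx c j y ∈ grid d c j := by
  have hc' : (0 : ℝ) < (c : ℝ) ^ j := by positivity
  intro i
  refine (Nat.floor_lt (mul_nonneg hc'.le (hy i).1)).2 ?_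
  push_cast
  nlinarith [(hy i).2]

lemma mem_box_boxIdx {c : ℕ} (hc : 0 < c) (j : ℕ) {y : Fin d → ℝ} (hy : ∀ i, 0 ≤ y i) :
    y ∈ box c j (boxIdx c j y) := by
  have hc' : (0 : ℝ) < (c : ℝ) ^ j := by positivity
  intro i
  rw [div_le_iff₀ hc', lt_div_iff₀ hc', mul_comm]
  exact ⟨Nat.floor_le (mul_nonneg hc'.le (hy i)), Nat.lt_floor_add_one _⟩

lemma mem_box_iff {c : ℕ} (hc : 0 < c) {j : ℕ} {k : Fin d → ℕ} {y : Fin d → ℝ}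
    (hy : ∀ i, 0 ≤ y i) : y ∈ box c j k ↔ boxIdx c j y = k := by
  have hc' : (0 : ℝ) < (c : ℝ) ^ j := by positivity
  constructor
  · intro h
    funext i
    have := h i
    rw [div_le_iff₀ hc', lt_div_iff₀ hc'] at this
    rw [boxIdx, Nat.floor_eq_iff (mul_nonneg hc'.le (hy i)), mul_comm]
    exact this
  · rintro rfl
    exact mem_box_boxIdx hc j hy

lemma boxIdx_mem_nbrs {c : ℕ} (hc : 0 < c) {j : ℕ} {y z : Fin d → ℝ} (hy : y ∈ hoCube d)
    (hz : z ∈ hoCube d) (h : dist z y ≤ ((c : ℝ) ^ j)⁻¹) : boxIdx c j z ∈ nbrs c j y := by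
  have hc' : (0 : ℝ) < (c : ℝ) ^ j := by positivity
  refine ⟨boxIdx_mem_grid hc j hz, fun i => ?_⟩
  have h1 := (dist_pi_le_iff (by positivity)).1 h i
  rw [Real.dist_eq, abs_le] at h1
  have e : (c : ℝ) ^ j * ((c : ℝ) ^ j)⁻¹ = 1 := mul_inv_cancel₀ hc'.ne'
  have hyz : (c : ℝ) ^ j * z i ≤ (c : ℝ) ^ j * y i + 1 := by nlinarith
  have hzy : (c : ℝ) ^ j * y i ≤ (c : ℝ) ^ j * z i + 1 := by nlinarith
  constructor
  · unfold boxIdx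
    rw [← Nat.floor_add_one (mul_nonneg hc'.le (hy i).1)]
    exact Nat.floor_mono hyz
  · unfold boxIdx
    rw [← Nat.floor_add_one (mul_nonneg hc'.le (hz i).1)]
    exact Nat.floor_mono hzy

/-- The neighbours of the box of generation `j` containing `y`, as a finite set. -/
noncomputable def nbrsFinset (c j : ℕ) (y : Fin d → ℝ) : Finset (Fin d → ℕ) :=
  Fintype.piFinset fun i => Finset.Icc (boxIdx c j y i - 1) (boxIdx c j y i + 1)

lemma nbrs_subset_nbrsFinset (c j : ℕ) (y : Fin d → ℝ) :
    nbrs c j y ⊆ (nbrsFinset c j y : Set (Fin d → ℕ)) := by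
  intro k hk
  simp only [nbrsFinset, Finset.mem_coe, Fintype.mem_piFinset, Finset.mem_Icc]
  intro i
  have := hk.2 i
  omega

lemma card_nbrsFinset_le (c j : ℕ) (y : Fin d → ℝ) : (nbrsFinset c j y).card ≤ 3 ^ d := by
  rw [nbrsFinset, Fintype.card_piFinset]
  calc _ ≤ ∏ _i : Fin d, 3 := Finset.prod_le_prod' fun i _ => by
        rw [Nat.card_Icc]; omega
    _ = 3 ^ d := by simp

/-- A bound for the masses of the neighbours gives a bound for the mass of a ball. -/
lemma measureReal_closedBall_le_of_nbrs {c : ℕ} (hc : 0 < c) (ν : Measure (Fin d → ℝ))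
    [IsFiniteMeasure ν] (hν : ν (hoCube d)ᶜ = 0) {j : ℕ} {y : Fin d → ℝ} (hy : y ∈ hoCube d)
    {r A : ℝ} (hr : r ≤ ((c : ℝ) ^ j)⁻¹) (hA : 0 ≤ A)
    (h : ∀ k ∈ nbrs c j y, ν.real (box c j k) ≤ A) :
    ν.real (Metric.closedBall y r) ≤ 3 ^ d * A := by
  classical
  set S := (nbrsFinset c j y).filter (fun k => k ∈ nbrs c j y) with hS
  have hsub : Metric.closedBall y r ⊆ (⋃ k ∈ S, box c j k) ∪ (hoCube d)ᶜ := by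
    intro z hz
    by_cases hz' : z ∈ hoCube d
    · left
      have hm := boxIdx_mem_nbrs hc hy hz' ((Metric.mem_closedBall.1 hz).trans hr)
      refine mem_iUnion₂.2 ⟨boxIdx c j z, ?_, mem_box_boxIdx hc j fun i => (hz' i).1⟩
      exact Finset.mem_filter.2 ⟨nbrs_subset_nbrsFinset c j y hm, hm⟩
    · exact Or.inr hz'
  calc ν.real (Metric.closedBall y r)
      ≤ ν.real ((⋃ k ∈ S, box c j k) ∪ (hoCube d)ᶜ) := measureReal_mono hsub
    _ ≤ ν.real (⋃ k ∈ S, box c j k) + ν.real (hoCube d)ᶜ := measureReal_union_le _ _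
    _ = ν.real (⋃ k ∈ S, box c j k) := by rw [measureReal_def ν (hoCube d)ᶜ, hν]; simp
    _ ≤ ∑ k ∈ S, ν.real (box c j k) := measureReal_biUnion_finset_le _ _
    _ ≤ ∑ _k ∈ S, A := Finset.sum_le_sum fun k hk => h k (Finset.mem_filter.1 hk).2
    _ = S.card * A := by simp
    _ ≤ 3 ^ d * A := by
        gcongr
        exact_mod_cast (Finset.card_filter_le _ _).trans (card_nbrsFinset_le c j y)

/-- Every point of the closed cube is close to a box of each generation. -/
lemma exists_box_subset_closedBall {c : ℕ} (hc : 0 < c) (j : ℕ) {x : Fin d → ℝ}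
    (hx : x ∈ cube d) :
    ∃ k ∈ grid d c j, box c j k ⊆ Metric.closedBall x ((c : ℝ) ^ j)⁻¹ := by
  have hc' : (0 : ℝ) < (c : ℝ) ^ j := by positivity
  have hcj : 1 ≤ c ^ j := Nat.one_le_pow _ _ hc
  -- A coordinate equal to `1` would give the index `c ^ j`, outside the grid; the minimum replaces
  -- it by the last box, whose closure contains that face.
  refine ⟨fun i => min ⌊(c : ℝ) ^ j * x i⌋₊ (c ^ j - 1), fun i => ?_, fun z hz => ?_⟩
  · have := min_le_right ⌊(c : ℝ) ^ j * x i⌋₊ (c ^ j - 1)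
    show min ⌊(c : ℝ) ^ j * x i⌋₊ (c ^ j - 1) < c ^ j
    omega
  · refine (dist_pi_le_iff (by positivity)).2 fun i => ?_
    have h1 := hz i
    have hx0 : 0 ≤ x i := hx.1 i
    have hx1 : x i ≤ 1 := hx.2 i
    set k := min ⌊(c : ℝ) ^ j * x i⌋₊ (c ^ j - 1) with hk
    have hfl := Nat.floor_le (mul_nonneg hc'.le hx0)
    have hlow : (k : ℝ) ≤ (c : ℝ) ^ j * x i :=
      le_trans (Nat.cast_le.2 (min_le_left _ _)) hfl
    have hup : (c : ℝ) ^ j * x i ≤ k + 1 := by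
      rcases le_total ⌊(c : ℝ) ^ j * x i⌋₊ (c ^ j - 1) with h | h
      · rw [hk, min_eq_left h]
        exact (Nat.lt_floor_add_one _).le
      · rw [hk, min_eq_right h]
        have : ((c ^ j - 1 : ℕ) : ℝ) + 1 = (c : ℝ) ^ j := by
          rw [Nat.cast_sub hcj]; push_cast; ring
        rw [this]
        nlinarith
    have e : (c : ℝ) ^ j * ((c : ℝ) ^ j)⁻¹ = 1 := mul_inv_cancel₀ hc'.ne'
    rw [div_le_iff₀ hc', lt_div_iff₀ hc'] at h1
    rw [Real.dist_eq, abs_le]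
    constructor <;> nlinarith [h1.1, h1.2]

/-- The generation of the largest boxes of size at most `r`. -/
lemma exists_generation {c : ℕ} (hc : 2 ≤ c) {r : ℝ} (hr : 0 < r) (hr1 : r ≤ 1) :
    ∃ j : ℕ, ((c : ℝ) ^ j)⁻¹ ≤ r ∧ r < c * ((c : ℝ) ^ j)⁻¹ := by
  have hc1 : (1 : ℝ) < c := by exact_mod_cast hc
  have hc0 : (0 : ℝ) < c := by linarith
  have hex : ∃ j : ℕ, ((c : ℝ) ^ j)⁻¹ ≤ r := by
    obtain ⟨n, hn⟩ := exists_pow_lt_of_lt_one hr (inv_lt_one_of_one_lt₀ hc1)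
    exact ⟨n, by rw [← inv_pow]; exact hn.le⟩
  classical
  refine ⟨Nat.find hex, Nat.find_spec hex, ?_⟩
  rcases Nat.eq_zero_or_pos (Nat.find hex) with h0 | h0
  · rw [h0]; simp; linarith
  · have := Nat.find_min hex (m := Nat.find hex - 1) (by omega)
    rw [not_le] at this
    refine this.trans_le (le_of_eq ?_)
    obtain ⟨m, hm⟩ := Nat.exists_eq_succ_of_ne_zero h0.ne'
    rw [hm, Nat.succ_sub_one, Nat.succ_eq_add_one, pow_succ]
    field_simp

/-- The generation of the smallest boxes of size at least `r`. -/
lemma exists_generation_ge {c : ℕ} (hc : 2 ≤ c) {r : ℝ} (hr : 0 < r) (hr1 : r ≤ 1) :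
    ∃ j : ℕ, r ≤ ((c : ℝ) ^ j)⁻¹ ∧ ((c : ℝ) ^ j)⁻¹ ≤ c * r := by
  have hc1 : (1 : ℝ) < c := by exact_mod_cast hc
  have hc0 : (0 : ℝ) < c := by linarith
  obtain ⟨j, h1, h2⟩ := exists_generation hc hr hr1
  rcases Nat.eq_zero_or_pos j with h0 | h0
  · subst h0
    refine ⟨0, by simpa using hr1, h1.trans ?_⟩
    nlinarith
  · obtain ⟨m, rfl⟩ := Nat.exists_eq_succ_of_ne_zero h0.ne'
    have e : (c : ℝ) * ((c : ℝ) ^ (m + 1))⁻¹ = ((c : ℝ) ^ m)⁻¹ := by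
      rw [pow_succ]; field_simp
    refine ⟨m, by rw [← e]; exact h2.le, ?_⟩
    rw [← e]
    gcongr

/-- A set of small diameter meets few pairwise disjoint balls of large radius. -/
lemma card_le_of_disjoint_balls (s : Finset ℕ) (x : ℕ → Fin d → ℝ) (lam : ℕ → ℝ)
    {a v : ℝ} (ha : 0 < a) (hv : 0 ≤ v) (hlam : ∀ n ∈ s, a ≤ lam n)
    (hdisj : (s : Set ℕ).PairwiseDisjoint fun n => Metric.closedBall (x n) (lam n))
    (p : Fin d → ℝ) (hp : ∀ n ∈ s, ∃ q ∈ Metric.closedBall (x n) (lam n), dist q p ≤ v) :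
    (s.card : ℝ) ≤ (2 + v / a) ^ d := by
  have hsub : ∀ n ∈ s, ∃ z, Metric.closedBall z a ⊆ Metric.closedBall (x n) (lam n) ∧
      Metric.closedBall z a ⊆ Metric.closedBall p (v + 2 * a) := by
    intro n hn
    obtain ⟨q, hq, hqp⟩ := hp n hn
    have hl : 0 < lam n := ha.trans_le (hlam n hn)
    rw [Metric.mem_closedBall] at hq
    -- Moving `q` towards the centre by the proportion `a / lam n` displaces it by at most `a` and
    -- makes room for a ball of radius `a` inside the given one. All balls are thus replaced by
    -- equal ones near `p`, and volumes can be compared.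
    refine ⟨q + (a / lam n) • (x n - q), ?_, ?_⟩
    · apply Metric.closedBall_subset_closedBall'
      have : dist (q + (a / lam n) • (x n - q)) (x n) = (1 - a / lam n) * dist q (x n) := by
        rw [dist_eq_norm, dist_eq_norm,
          show q + (a / lam n) • (x n - q) - x n = (1 - a / lam n) • (q - x n) by module,
          norm_smul, Real.norm_of_nonneg]
        rw [sub_nonneg, div_le_one hl]
        exact hlam n hn
      rw [this]
      have h0 : 0 ≤ 1 - a / lam n := by
        rw [sub_nonneg, div_le_one hl]
        exact hlam n hn
      have := mul_le_mul_of_nonneg_left hq h0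
      have e : (1 - a / lam n) * lam n = lam n - a := by field_simp
      linarith
    · apply Metric.closedBall_subset_closedBall'
      have h1 : dist (q + (a / lam n) • (x n - q)) q = a / lam n * dist q (x n) := by
        rw [dist_eq_norm, dist_comm, dist_eq_norm, add_sub_cancel_left, norm_smul,
          Real.norm_of_nonneg (by positivity)]
      have h2 : a / lam n * dist q (x n) ≤ a := by
        calc _ ≤ a / lam n * lam n := by gcongr
          _ = a := by field_simp
      have := dist_triangle (q + (a / lam n) • (x n - q)) q p
      linarith
  choose! z hz1 hz2 using hsub
  have hd' : (s : Set ℕ).PairwiseDisjoint fun n => Metric.closedBall (z n) a := by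
    intro n hn n' hn' hne
    exact (hdisj hn hn' hne).mono (hz1 n hn) (hz1 n' hn')
  have hvol : ∑ n ∈ s, volume (Metric.closedBall (z n) a) ≤
      volume (Metric.closedBall p (v + 2 * a)) := by
    rw [← measure_biUnion_finset hd' fun n _ => Metric.isClosed_closedBall.measurableSet]
    exact measure_mono (iUnion₂_subset fun n hn => hz2 n hn)
  simp only [Real.volume_pi_closedBall _ ha.le,
    Real.volume_pi_closedBall p (by positivity : 0 ≤ v + 2 * a), Finset.sum_const, nsmul_eq_mul,
    Fintype.card_fin] at hvol
  rw [← ENNReal.ofReal_natCast, ← ENNReal.ofReal_mul (by positivity),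
    ENNReal.ofReal_le_ofReal_iff (by positivity)] at hvol
  have e : (2 * (v + 2 * a)) ^ d = (2 + v / a) ^ d * (2 * a) ^ d := by
    rw [← mul_pow]; congr 1; field_simp; ring
  rw [e] at hvol
  exact le_of_mul_le_mul_right hvol (by positivity)

/-! ### Covers by small sets -/

/-- A set is null for a Hausdorff measure if and only if it has covers of small cost; the sets of
the cover come with positive bounds for their diameters. -/
lemma exists_cover_of_hausdorffMeasure_zero {X : Type*} [MetricSpace X] [MeasurableSpace X]
    [BorelSpace X] {s : ℝ} (hs : 0 < s) {A : Set X} (hA : μH[s] A = 0) {η : ℝ≥0∞} (hη : 0 < η) :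
    ∃ (V : ℕ → Set X) (v : ℕ → ℝ), A ⊆ ⋃ n, V n ∧ (∀ n, 0 < v n) ∧
      (∀ n, ∀ p ∈ V n, ∀ q ∈ V n, dist p q ≤ v n) ∧ ∑' n, ENNReal.ofReal (v n ^ s) < η := by
  obtain ⟨η', hη'0, hη'⟩ : ∃ η' : ℝ≥0∞, 0 < η' ∧ η' < η := exists_between hη
  have hη'2 : 0 < η' / 2 := ENNReal.half_pos hη'0.ne'
  rw [Measure.hausdorffMeasure_apply] at hA
  have h1 : (⨅ (t : ℕ → Set X) (_ : A ⊆ ⋃ n, t n) (_ : ∀ n, Metric.ediam (t n) ≤ 1),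
      ∑' n, ⨆ _ : (t n).Nonempty, Metric.ediam (t n) ^ s) < η' / 2 := by
    refine lt_of_le_of_lt ?_ hη'2
    rw [← hA]
    exact le_iSup₂ (f := fun (r : ℝ≥0∞) (_ : 0 < r) => ⨅ (t : ℕ → Set X) (_ : A ⊆ ⋃ n, t n)
      (_ : ∀ n, Metric.ediam (t n) ≤ r), ∑' n, ⨆ _ : (t n).Nonempty, Metric.ediam (t n) ^ s) 1
      one_pos
  simp only [iInf_lt_iff] at h1
  obtain ⟨t, htA, ht1, ht⟩ := h1
  obtain ⟨w, hw0, hw⟩ := ENNReal.exists_pos_sum_of_countable' hη'2.ne' ℕ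
  have hfin : ∀ n, Metric.ediam (t n) ≠ ⊤ := fun n => ((ht1 n).trans_lt ENNReal.one_lt_top).ne
  -- A set of the cover may have diameter zero. Continuity of `v ↦ v ^ s` allows a positive size at
  -- an extra cost of at most `w n`; this positivity is what ends the descent.
  have hv : ∀ n, ∃ v : ℝ, 0 < v ∧ (Metric.ediam (t n)).toReal ≤ v ∧
      ENNReal.ofReal (v ^ s) ≤ (⨆ _ : (t n).Nonempty, Metric.ediam (t n) ^ s) + w n := by
    intro n
    have hcont : Tendsto (fun v : ℝ => ENNReal.ofReal (v ^ s))
        (𝓝[>] (Metric.ediam (t n)).toReal)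
        (𝓝 (ENNReal.ofReal ((Metric.ediam (t n)).toReal ^ s))) := by
      refine (ENNReal.continuous_ofReal.tendsto _).comp ?_
      exact (Real.continuousAt_rpow_const _ _ (Or.inr hs.le)).tendsto.mono_left
        nhdsWithin_le_nhds
    have e : ENNReal.ofReal ((Metric.ediam (t n)).toReal ^ s) ≤
        ⨆ _ : (t n).Nonempty, Metric.ediam (t n) ^ s := by
      rcases (t n).eq_empty_or_nonempty with h | h
      · simp [h, Real.zero_rpow hs.ne']
      · rw [ciSup_pos h, ← ENNReal.ofReal_rpow_of_nonneg ENNReal.toReal_nonneg hs.le,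
          ENNReal.ofReal_toReal (hfin n)]
    have hne : ENNReal.ofReal ((Metric.ediam (t n)).toReal ^ s) <
        (⨆ _ : (t n).Nonempty, Metric.ediam (t n) ^ s) + w n :=
      (ENNReal.lt_add_right ENNReal.ofReal_ne_top (hw0 n).ne').trans_le (by gcongr)
    obtain ⟨v, hv1, hv2⟩ := ((hcont.eventually_lt_const hne).and self_mem_nhdsWithin).exists
    exact ⟨v, ENNReal.toReal_nonneg.trans_lt hv2, (le_of_lt hv2), hv1.le⟩
  choose v hv0 hvd hvs using hv
  refine ⟨t, v, htA, hv0, fun n p hp q hq => ?_, ?_⟩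
  · refine le_trans ?_ (hvd n)
    rw [dist_edist]
    exact ENNReal.toReal_mono (hfin n) (Metric.edist_le_ediam_of_mem hp hq)
  · calc _ ≤ ∑' n, ((⨆ _ : (t n).Nonempty, Metric.ediam (t n) ^ s) + w n) :=
          ENNReal.tsum_le_tsum hvs
      _ = _ + _ := ENNReal.tsum_add
      _ ≤ η' / 2 + η' / 2 := by gcongr
      _ = η' := ENNReal.add_halves _
      _ < η := hη'

/-! ### The averaging argument -/

section Averaging

variable {X ι J : Type*}

/-- A block of balls around `y` at scale `R`: a finite nonempty set `G` of indices with `P`, whose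
sets `Bc g` are close to `y`, are not too small, and are well distributed. -/
def IsBlock [MetricSpace X] (Bc : ι → Set X) (ell : ι → ℝ) (P : ι → Prop) (b s t K : ℝ) (y : X) (R : ℝ) : Prop :=
  ∃ G : Finset ι, G.Nonempty ∧
    (∀ g ∈ G, P g ∧ Bc g ⊆ Metric.closedBall y (2 * R) ∧ R ^ b ≤ G.card * ell g ^ t) ∧
    ∀ (V : Set X) (v : ℝ), 0 < v → v ≤ R → (∀ p ∈ V, ∀ q ∈ V, dist p q ≤ v) →
      ∀ G' ⊆ G, (∀ g ∈ G', (V ∩ Bc g).Nonempty) →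
        (G'.card : ℝ) ≤ K ∨ R ^ b * G'.card ≤ G.card * v ^ s

/-- Either one truncated term already equals `1`, or nothing is truncated and the sum is the
original one divided by `a`. -/
lemma one_le_tsum_min_of_le {f : J → ℝ≥0∞} {a : ℝ≥0∞} (ha : a ≠ 0) (ha' : a ≠ ⊤)
    (h : a ≤ ∑' j, f j) : 1 ≤ ∑' j, min 1 (f j / a) := by
  by_cases h1 : ∃ j, 1 ≤ f j / a
  · obtain ⟨j, hj⟩ := h1
    calc (1 : ℝ≥0∞) = min 1 (f j / a) := (min_eq_left hj).symm
      _ ≤ _ := ENNReal.le_tsum j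
  · push Not at h1
    have : ∀ j, min 1 (f j / a) = f j / a := fun j => min_eq_right (h1 j).le
    rw [tsum_congr this]
    simp only [div_eq_mul_inv]
    rw [ENNReal.tsum_mul_right, ← div_eq_mul_inv, ENNReal.le_div_iff_mul_le (Or.inl ha)
      (Or.inl ha'), one_mul]
    exact h

/-- The proportion of the block `G` that is charged by the set `V` of size `v`. -/
noncomputable def blockCharge (Bc : ι → Set X) (ell : ι → ℝ) (s t : ℝ) (G : Finset ι)
    (V : Set X) (v : ℝ) : ℝ≥0∞ :=
  open Classical in
  (∑ g ∈ G, if (V ∩ Bc g).Nonempty then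
    min 1 (ENNReal.ofReal (v ^ s) / ENNReal.ofReal (ell g ^ t)) else 0) / G.card

lemma blockCharge_le_card_div (Bc : ι → Set X) (ell : ι → ℝ) (s t : ℝ) (G G' : Finset ι)
    (V : Set X) (v : ℝ) (hG' : ∀ g ∈ G, (V ∩ Bc g).Nonempty → g ∈ G') :
    blockCharge Bc ell s t G V v ≤ G'.card / G.card := by
  classical
  unfold blockCharge
  gcongr
  calc _ ≤ ∑ g ∈ G, if g ∈ G' then (1 : ℝ≥0∞) else 0 := by
        refine Finset.sum_le_sum fun g hg => ?_
        by_cases h : (V ∩ Bc g).Nonempty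
        · rw [if_pos h, if_pos (hG' g hg h)]; exact min_le_left _ _
        · rw [if_neg h]; exact zero_le
    _ = ((G.filter (· ∈ G')).card : ℝ≥0∞) := by rw [Finset.sum_boole]
    _ ≤ G'.card := by
        gcongr
        intro g hg
        exact (Finset.mem_filter.1 hg).2

lemma blockCharge_le_one (Bc : ι → Set X) (ell : ι → ℝ) (s t : ℝ) (G : Finset ι)
    (V : Set X) (v : ℝ) : blockCharge Bc ell s t G V v ≤ 1 :=
  (blockCharge_le_card_div Bc ell s t G G V v fun _ h _ => h).trans ENNReal.div_self_le_one

lemma one_le_tsum_blockCharge {Bc : ι → Set X} {ell : ι → ℝ} {s t : ℝ} {G : Finset ι}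
    (hG : G.Nonempty) (V : J → Set X) (v : J → ℝ) (hell : ∀ g ∈ G, 0 < ell g)
    (h : ∀ g ∈ G, ENNReal.ofReal (ell g ^ t) ≤
      ∑' j, open Classical in if (V j ∩ Bc g).Nonempty then ENNReal.ofReal (v j ^ s) else 0) :
    1 ≤ ∑' j, blockCharge Bc ell s t G (V j) (v j) := by
  classical
  have hc : (G.card : ℝ≥0∞) ≠ 0 := by simpa using hG.ne_empty
  simp only [blockCharge, div_eq_mul_inv]
  rw [ENNReal.tsum_mul_right, ← div_eq_mul_inv, ENNReal.le_div_iff_mul_le (Or.inl hc)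
    (Or.inl (ENNReal.natCast_ne_top _)), one_mul, Summable.tsum_finsetSum
    (fun _ _ => ENNReal.summable)]
  calc (G.card : ℝ≥0∞) = ∑ _g ∈ G, 1 := by simp
    _ ≤ _ := Finset.sum_le_sum fun g hg => ?_
  have hp : (0 : ℝ) < ell g ^ t := Real.rpow_pos_of_pos (hell g hg) _
  refine (one_le_tsum_min_of_le (by simpa using hp) ENNReal.ofReal_ne_top (h g hg)).trans
    (le_of_eq (tsum_congr fun j => ?_))
  by_cases hm : (V j ∩ Bc g).Nonempty
  · simp [hm, div_eq_mul_inv]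
  · simp [hm]

/-- The charge of a single block by a set `V`, weighted by a mass at most `a R ^ b`. -/
lemma mul_blockCharge_le {Bc : ι → Set X} {ell : ι → ℝ} {b s t K a R v M : ℝ} {G : Finset ι}
    (hG : G.Nonempty) (hell : ∀ g ∈ G, 0 < ell g) (hR : 0 < R) (hv : 0 < v) (hv1 : v ≤ 1)
    (hs : 0 < s) (hsb : s ≤ b) (hK : 1 ≤ K) (ha : 0 ≤ a) (hM0 : 0 ≤ M)
    (hM : M ≤ a * R ^ b)
    (hsize : ∀ g ∈ G, R ^ b ≤ G.card * ell g ^ t) {V : Set X}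
    (hdistr : v ≤ R → ∀ G' ⊆ G, (∀ g ∈ G', (V ∩ Bc g).Nonempty) →
        (G'.card : ℝ) ≤ K ∨ R ^ b * G'.card ≤ G.card * v ^ s) :
    ENNReal.ofReal M * blockCharge Bc ell s t G V v ≤ ENNReal.ofReal (a * K * v ^ s) := by
  classical
  have hcard : (0 : ℝ) < G.card := by exact_mod_cast hG.card_pos
  have hvs : 0 < v ^ s := Real.rpow_pos_of_pos hv _
  have hRb : 0 < R ^ b := Real.rpow_pos_of_pos hR _
  rcases lt_or_ge R v with hRv | hRv
  -- A set larger than the scale of the block may charge all of it, but then `R ^ b ≤ v ^ s` and the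
  -- mass bound suffices.
  · calc _ ≤ ENNReal.ofReal M * 1 := by gcongr; exact blockCharge_le_one ..
      _ ≤ _ := by
        rw [mul_one]
        apply ENNReal.ofReal_le_ofReal
        have h1 : R ^ b ≤ v ^ s :=
          (Real.rpow_le_rpow hR.le hRv.le (by linarith)).trans
            (Real.rpow_le_rpow_of_exponent_ge hv hv1 hsb)
        calc M ≤ a * R ^ b := hM
          _ ≤ a * v ^ s := by gcongr
          _ ≤ a * K * v ^ s := by nlinarith [mul_nonneg ha hvs.le]
  · set G' := G.filter (fun g => (V ∩ Bc g).Nonempty) with hG'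
    rcases hdistr hRv G' (Finset.filter_subset _ _) (fun g hg => (Finset.mem_filter.1 hg).2)
      with h | h
    -- Few members are met: each contributes at most `v ^ s / ell g ^ t`, which is at most `G.card *
    -- v ^ s / R ^ b` by the size condition, and the average divides by `G.card`.
    · have hle : blockCharge Bc ell s t G V v ≤ ENNReal.ofReal (K * v ^ s / R ^ b) := by
        unfold blockCharge
        rw [← Finset.sum_filter, ← hG', ENNReal.div_le_iff (by simpa using hG.ne_empty)
          (ENNReal.natCast_ne_top _)]
        calc _ ≤ ∑ _g ∈ G', ENNReal.ofReal (v ^ s * G.card / R ^ b) := by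
              refine Finset.sum_le_sum fun g hg => (min_le_right _ _).trans ?_
              have hgG := (Finset.mem_filter.1 hg).1
              have hl : 0 < ell g ^ t := Real.rpow_pos_of_pos (hell g hgG) _
              rw [← ENNReal.ofReal_div_of_pos hl]
              apply ENNReal.ofReal_le_ofReal
              rw [div_le_div_iff₀ hl hRb]
              have := hsize g hgG
              nlinarith
          _ = ENNReal.ofReal (G'.card * (v ^ s * G.card / R ^ b)) := by
              rw [Finset.sum_const, nsmul_eq_mul, ENNReal.ofReal_mul (by positivity),
                ENNReal.ofReal_natCast]
          _ ≤ ENNReal.ofReal (K * v ^ s / R ^ b * G.card) := by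
              apply ENNReal.ofReal_le_ofReal
              have : 0 ≤ v ^ s * G.card / R ^ b := by positivity
              calc _ ≤ K * (v ^ s * G.card / R ^ b) := by gcongr
                _ = _ := by ring
          _ = _ := by
              rw [ENNReal.ofReal_mul (by positivity), ENNReal.ofReal_natCast]
      calc _ ≤ ENNReal.ofReal M * ENNReal.ofReal (K * v ^ s / R ^ b) := by gcongr
        _ = ENNReal.ofReal (M * (K * v ^ s / R ^ b)) := (ENNReal.ofReal_mul hM0).symm
        _ ≤ _ := by
          apply ENNReal.ofReal_le_ofReal
          calc _ ≤ a * R ^ b * (K * v ^ s / R ^ b) := by gcongr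
            _ = _ := by field_simp
    -- Many members are met: each term is bounded by `1`, and the distribution condition bounds the
    -- proportion of members met by `v ^ s / R ^ b`.
    · calc _ ≤ ENNReal.ofReal M * (G'.card / G.card) := by
            gcongr
            exact blockCharge_le_card_div _ _ _ _ _ _ _ _ fun g hg hm =>
              Finset.mem_filter.2 ⟨hg, hm⟩
        _ = ENNReal.ofReal (M * (G'.card / G.card)) := by
            rw [ENNReal.ofReal_mul hM0, ENNReal.ofReal_div_of_pos hcard, ENNReal.ofReal_natCast,
              ENNReal.ofReal_natCast]
        _ ≤ _ := by
          apply ENNReal.ofReal_le_ofReal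
          calc _ ≤ a * R ^ b * (G'.card / G.card) := by gcongr
            _ = a * (R ^ b * G'.card / G.card) := by ring
            _ ≤ a * (G.card * v ^ s / G.card) := by gcongr
            _ = a * v ^ s := by field_simp
            _ ≤ a * K * v ^ s := by nlinarith [mul_nonneg ha hvs.le]

/-- If the sets `V j` have a small total cost, then some set of the blocks has small cost too. -/
theorem exists_small_cost_of_blocks [MetricSpace X] [SecondCountableTopology X] [MeasurableSpace X]
    [OpensMeasurableSpace X] [HasBesicovitchCovering X] (ν : Measure X) [IsFiniteMeasure ν]
    (F : Set X) (hF : 0 < ν.real F) {K K₂ r₁ b b' s s' t : ℝ} (hK : 1 ≤ K) (hK₂ : 1 ≤ K₂)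
    (hr₁ : 0 < r₁) (hr₁' : r₁ ≤ 1) (hs : 0 < s) (hss' : s ≤ s') (hsb : s' ≤ b') (hbb : b' < b)
    (hgrow : ∀ y ∈ F, ∀ r, 0 < r → r ≤ r₁ → ν.real (Metric.closedBall y r) ≤ K * (r / r₁) ^ b)
    (Bc : ι → Set X) (ell : ι → ℝ) (P : ι → Prop) (hell : ∀ g, P g → 0 < ell g)
    (hblock : ∀ y ∈ F, ∀ R₀ > 0, ∃ R, 0 < R ∧ R < R₀ ∧ IsBlock Bc ell P b' s' t K₂ y R)
    (V : J → Set X) (v : J → ℝ) (hv : ∀ j, 0 < v j)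
    (hV : ∀ j, ∀ p ∈ V j, ∀ q ∈ V j, dist p q ≤ v j)
    (hsum : ∑' j, ENNReal.ofReal (v j ^ s) <
      ENNReal.ofReal ((4 * K * 8 ^ b)⁻¹ * r₁ ^ s * min 1 (ν.real F))) :
    ∃ g, P g ∧ ∑' j, (open Classical in if (V j ∩ Bc g).Nonempty then
      ENNReal.ofReal (v j ^ s') else 0) < ENNReal.ofReal (ell g ^ t) := by
  classical
  -- If every ball costs at least `ell g ^ t`, every block receives a total charge of at least `1`.
  -- Weighting by mass over a disjoint family that covers almost all of `F` bounds `ν F` by a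
  -- constant times `∑ v j ^ s`, which the hypothesis makes smaller than `ν F`.
  by_contra hcon
  push Not at hcon
  have hb : 0 < b := by linarith
  have h8 : (1 : ℝ) ≤ 8 ^ b := Real.one_le_rpow (by norm_num) hb.le
  have hrs : 0 < r₁ ^ s := Real.rpow_pos_of_pos hr₁ _
  have hrs1 : r₁ ^ s ≤ 1 := Real.rpow_le_one hr₁.le hr₁' hs.le
  have hmin : min 1 (ν.real F) ≤ 1 := min_le_left _ _
  have hmin0 : 0 < min 1 (ν.real F) := lt_min one_pos hF
  have hC0 : 0 < K * 8 ^ b / r₁ ^ s := by positivity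
  -- sizes of the sets `V j`
  have hvsmall : ∀ j, 8 * v j ≤ r₁ := by
    intro j
    have h1 : ENNReal.ofReal (v j ^ s) <
        ENNReal.ofReal ((4 * K * 8 ^ b)⁻¹ * r₁ ^ s * min 1 (ν.real F)) :=
      (ENNReal.le_tsum j).trans_lt hsum
    have h2 := (ENNReal.ofReal_lt_ofReal_iff (by positivity)).1 h1
    by_contra hlt
    push Not at hlt
    have h3 : r₁ ^ s ≤ (8 * v j) ^ s := Real.rpow_le_rpow hr₁.le hlt.le hs.le
    rw [Real.mul_rpow (by norm_num) (hv j).le] at h3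
    have h4 : (8 : ℝ) ^ s ≤ 8 ^ b :=
      Real.rpow_le_rpow_of_exponent_le (by norm_num) (by linarith)
    have h5 : r₁ ^ s ≤ 8 ^ b * v j ^ s :=
      h3.trans (mul_le_mul_of_nonneg_right h4 (Real.rpow_nonneg (hv j).le _))
    have h6 : (4 * K * 8 ^ b)⁻¹ * r₁ ^ s * min 1 (ν.real F) ≤ (4 * K * 8 ^ b)⁻¹ * r₁ ^ s :=
      mul_le_of_le_one_right (by positivity) hmin
    have h7 : (4 * K * 8 ^ b)⁻¹ ≤ (8 ^ b)⁻¹ := by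
      apply inv_anti₀ (by positivity)
      nlinarith
    have h8' : (4 * K * 8 ^ b)⁻¹ * r₁ ^ s ≤ (8 ^ b)⁻¹ * (8 ^ b * v j ^ s) := by gcongr
    rw [inv_mul_cancel_left₀ (by positivity)] at h8'
    linarith
  have hv1 : ∀ j, v j ≤ 1 := fun j => by linarith [hvsmall j, hv j]
  -- small radii
  obtain ⟨R₀, hR₀, hR₀r, hR₀m⟩ : ∃ R₀ : ℝ, 0 < R₀ ∧ 3 * R₀ ≤ r₁ ∧ ∀ R, 0 < R → R < R₀ →
      K * (3 * R / r₁) ^ b ≤ K * 8 ^ b / r₁ ^ s / K₂ * R ^ b' := by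
    -- The gap `b' < b` allows any prescribed constant at small radii; dividing by `K₂` anticipates
    -- the factor lost inside a block.
    have ht : Tendsto (fun R : ℝ => K * (3 / r₁) ^ b * R ^ (b - b')) (𝓝[>] 0) (𝓝 0) := by
      have : Tendsto (fun R : ℝ => R ^ (b - b')) (𝓝[>] 0) (𝓝 0) := by
        have h := (Real.continuousAt_rpow_const (0 : ℝ) (b - b') (Or.inr (by linarith))).tendsto
        rw [Real.zero_rpow (by linarith)] at h
        exact h.mono_left nhdsWithin_le_nhds
      simpa using this.const_mul (K * (3 / r₁) ^ b)
    have hev := ht.eventually_le_const (show 0 < K * 8 ^ b / r₁ ^ s / K₂ by positivity)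
    obtain ⟨u, hu0, hu⟩ := mem_nhdsGT_iff_exists_Ioo_subset.1 hev
    refine ⟨min u (r₁ / 3), lt_min hu0 (by positivity), ?_, fun R hR hRu => ?_⟩
    · have := min_le_right u (r₁ / 3); linarith
    · have h1 := hu ⟨hR, hRu.trans_le (min_le_left _ _)⟩
      simp only [mem_ofPred_eq] at h1
      calc K * (3 * R / r₁) ^ b = K * (3 / r₁) ^ b * R ^ (b - b') * R ^ b' := by
            rw [show 3 * R / r₁ = 3 / r₁ * R by ring, Real.mul_rpow (by positivity) hR.le,
              mul_assoc _ (R ^ (b - b')), ← Real.rpow_add hR]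
            ring_nf
        _ ≤ _ := by gcongr
  -- The covering balls have radius `3 * R`, whereas the members of a block stay within `2 * R` of
  -- its centre: the margin `R` separates the members of distinct blocks.
  obtain ⟨T, r, hTc, hTF, hTr, hTcov, hTd⟩ := Besicovitch.exists_disjoint_closedBall_covering_ae ν
    (fun y => {r | IsBlock Bc ell P b' s' t K₂ y (r / 3)}) F (fun y hy δ hδ => by
      obtain ⟨R, hR, hRδ, hblk⟩ := hblock y hy (δ / 3) (by positivity)
      refine ⟨3 * R, ?_, by positivity, by linarith⟩
      show IsBlock Bc ell P b' s' t K₂ y (3 * R / 3)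
      rwa [mul_div_cancel_left₀ _ (by norm_num : (3 : ℝ) ≠ 0)])
    (fun _ => 3 * R₀) (fun _ _ => by positivity)
  have hr0 : ∀ y ∈ T, 0 < r y := fun y hy => (hTr y hy).2.1
  have hrR : ∀ y ∈ T, r y < 3 * R₀ := fun y hy => (hTr y hy).2.2
  have hblk : ∀ y ∈ T, IsBlock Bc ell P b' s' t K₂ y (r y / 3) := fun y hy => (hTr y hy).1
  choose! G hGne hGP hGd using hblk
  set w : X → J → ℝ≥0∞ := fun y j => blockCharge Bc ell s' t (G y) (V j) (v j) with hw
  have hw1 : ∀ y ∈ T, 1 ≤ ∑' j, w y j := fun y hy =>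
    one_le_tsum_blockCharge (hGne y hy) V v (fun g hg => hell g (hGP y hy g hg).1)
      fun g hg => hcon g (hGP y hy g hg).1
  have hw0 : ∀ y j, (∀ g ∈ G y, ¬ (V j ∩ Bc g).Nonempty) → w y j = 0 := by
    intro y j h
    have := blockCharge_le_card_div Bc ell s' t (G y) ∅ (V j) (v j)
      (fun g hg hm => absurd hm (h g hg))
    simpa using this
  have hνF : ν F ≤ ∑' y : T, ν (Metric.closedBall (y : X) (r y)) := by
    calc ν F ≤ ν ((F \ ⋃ y ∈ T, Metric.closedBall y (r y)) ∪ ⋃ y ∈ T, Metric.closedBall y (r y)) :=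
          measure_mono fun z hz => by
            by_cases h : z ∈ ⋃ y ∈ T, Metric.closedBall y (r y)
            · exact Or.inr h
            · exact Or.inl ⟨hz, h⟩
      _ ≤ 0 + ν (⋃ y ∈ T, Metric.closedBall y (r y)) := by
          rw [← hTcov]; exact measure_union_le _ _
      _ ≤ _ := by rw [zero_add]; exact measure_biUnion_le _ hTc _
  have hmassT : ∀ y ∈ T, ν.real (Metric.closedBall y (r y)) ≤
      K * 8 ^ b / r₁ ^ s / K₂ * (r y / 3) ^ b' := by
    intro y hy
    have := hgrow y (hTF hy) (r y) (hr0 y hy) (by linarith [hrR y hy])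
    refine this.trans ?_
    have h2 := hR₀m (r y / 3) (by linarith [hr0 y hy]) (by linarith [hrR y hy])
    rwa [mul_div_cancel₀ (r y) (by norm_num : (3 : ℝ) ≠ 0)] at h2
  -- the charge of each `V j`
  have hcharge : ∀ j, ∑' y : T, ν (Metric.closedBall (y : X) (r y)) * w y j ≤
      ENNReal.ofReal (K * 8 ^ b / r₁ ^ s) * ENNReal.ofReal (v j ^ s) := by
    intro j
    have hvs : 0 < v j ^ s := Real.rpow_pos_of_pos (hv j) _
    rw [← ENNReal.ofReal_mul hC0.le]
    by_cases hY : ∃ y₁ ∈ T, ∃ y₂ ∈ T, y₁ ≠ y₂ ∧ (∃ g ∈ G y₁, (V j ∩ Bc g).Nonempty) ∧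
        ∃ g ∈ G y₂, (V j ∩ Bc g).Nonempty
    -- A set meeting two blocks has to cross the margin of every block it meets, so all these blocks
    -- have scale at most `v j`. Their covering balls lie within `(3 + 2 + 1 + 2) * v j` of `y₁`,
    -- and being disjoint they are bounded together by the growth of `ν`.
    · obtain ⟨y₁, hy₁, y₂, hy₂, hne, hm₁, hm₂⟩ := hY
      set Y : Set X := {y | y ∈ T ∧ ∃ g ∈ G y, (V j ∩ Bc g).Nonempty} with hYdef
      have hYT : Y ⊆ T := fun y hy => hy.1
      have hpt : ∀ y ∈ Y, ∃ p ∈ V j, dist p y ≤ 2 * (r y / 3) := by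
        rintro y ⟨hy, g, hg, p, hpV, hpB⟩
        exact ⟨p, hpV, Metric.mem_closedBall.1 ((hGP y hy g hg).2.1 hpB)⟩
      have hsep : ∀ y ∈ Y, r y / 3 ≤ v j := by
        intro y hy
        obtain ⟨z, hz, hzy⟩ : ∃ z ∈ Y, z ≠ y := by
          by_cases h : y₁ = y
          · exact ⟨y₂, ⟨hy₂, hm₂⟩, fun h' => hne (h.trans h'.symm)⟩
          · exact ⟨y₁, ⟨hy₁, hm₁⟩, h⟩
        obtain ⟨p, hp, hpy⟩ := hpt y hy
        obtain ⟨q, hq, hqz⟩ := hpt z hz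
        have hqB : q ∈ Metric.closedBall z (r z) := by
          rw [Metric.mem_closedBall]; linarith [hr0 z (hYT hz)]
        have hqy : q ∉ Metric.closedBall y (r y) := fun h =>
          (Set.disjoint_left.1 (hTd (hYT hz) (hYT hy) hzy)) hqB h
        rw [Metric.mem_closedBall, not_le] at hqy
        have := dist_triangle q p y
        have := hV j q hq p hp
        linarith
      have hy₁Y : y₁ ∈ Y := ⟨hy₁, hm₁⟩
      have hsub : (⋃ y ∈ Y, Metric.closedBall y (r y)) ⊆ Metric.closedBall y₁ (8 * v j) := by
        refine iUnion₂_subset fun y hy z hz => ?_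
        obtain ⟨p, hp, hpy⟩ := hpt y hy
        obtain ⟨q, hq, hqy⟩ := hpt y₁ hy₁Y
        have h1 := hsep y hy
        have h2 := hsep y₁ hy₁Y
        have h3 := hV j p hp q hq
        rw [Metric.mem_closedBall] at hz ⊢
        have := dist_triangle z y y₁
        have := dist_triangle y p y₁
        have := dist_triangle p q y₁
        rw [dist_comm] at hpy
        linarith
      have hle : ∀ y : T, ν (Metric.closedBall (y : X) (r y)) * w y j ≤
          Y.indicator (fun y => ν (Metric.closedBall y (r y))) y := by
        intro y
        by_cases hy : (y : X) ∈ Y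
        · rw [indicator_of_mem hy]
          exact mul_le_of_le_one_right' (blockCharge_le_one ..)
        · rw [hw0 y j fun g hg hm => hy ⟨y.2, g, hg, hm⟩, mul_zero]
          exact zero_le
      have hYc : Y.Countable := hTc.mono hYT
      calc _ ≤ ∑' y : T, Y.indicator (fun y => ν (Metric.closedBall y (r y))) y :=
            ENNReal.tsum_le_tsum hle
        _ ≤ ∑' y : X, Y.indicator (fun y => ν (Metric.closedBall y (r y))) y :=
            ENNReal.tsum_comp_le_tsum_of_injective Subtype.val_injective _
        _ = ∑' y : Y, ν (Metric.closedBall (y : X) (r y)) := (tsum_subtype Y _).symm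
        _ = ν (⋃ y ∈ Y, Metric.closedBall y (r y)) :=
            (measure_biUnion hYc (hTd.subset hYT)
              fun y _ => Metric.isClosed_closedBall.measurableSet).symm
        _ ≤ ν (Metric.closedBall y₁ (8 * v j)) := measure_mono hsub
        _ = ENNReal.ofReal (ν.real (Metric.closedBall y₁ (8 * v j))) :=
            (ofReal_measureReal).symm
        _ ≤ _ := by
          apply ENNReal.ofReal_le_ofReal
          have hv8 : 0 < 8 * v j := by linarith [hv j]
          have h81 : 8 * v j / r₁ ≤ 1 := (div_le_one hr₁).2 (hvsmall j)
          calc _ ≤ K * (8 * v j / r₁) ^ b := hgrow y₁ (hTF hy₁) _ hv8 (hvsmall j)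
            _ ≤ K * (8 * v j / r₁) ^ s := by
              refine mul_le_mul_of_nonneg_left ?_ (by linarith)
              exact Real.rpow_le_rpow_of_exponent_ge (by positivity) h81 (by linarith)
            _ = K * (8 ^ s * v j ^ s / r₁ ^ s) := by
              rw [Real.div_rpow hv8.le hr₁.le, Real.mul_rpow (by norm_num) (hv j).le]
            _ ≤ K * (8 ^ b * v j ^ s / r₁ ^ s) := by
              have : (8 : ℝ) ^ s ≤ 8 ^ b :=
                Real.rpow_le_rpow_of_exponent_le (by norm_num) (by linarith)
              gcongr
            _ = _ := by ring
    -- At most one block is met, so the size of the charge inside that block matters.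
    · by_cases hY' : ∃ y : T, ∃ g ∈ G y, (V j ∩ Bc g).Nonempty
      · obtain ⟨y, hy⟩ := hY'
        have hy' : ∀ z : T, z ≠ y → ν (Metric.closedBall (z : X) (r z)) * w z j = 0 := by
          intro z hz
          rw [hw0 z j, mul_zero]
          intro g hg hm
          exact hY ⟨z, z.2, y, y.2, fun h => hz (Subtype.ext h), ⟨g, hg, hm⟩, hy⟩
        rw [tsum_eq_single y hy', ← ofReal_measureReal]
        have hR3 : 0 < r y / 3 := by linarith [hr0 y y.2]
        refine (mul_blockCharge_le (hGne y y.2) (fun g hg => hell g (hGP y y.2 g hg).1) hR3 (hv j)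
          (hv1 j) (by linarith) hsb hK₂ (by positivity) measureReal_nonneg (hmassT y y.2)
          (fun g hg => (hGP y y.2 g hg).2.2)
          (fun hvR => hGd y y.2 (V j) (v j) (hv j) hvR (hV j))).trans ?_
        apply ENNReal.ofReal_le_ofReal
        rw [div_mul_cancel₀ _ (by positivity)]
        exact mul_le_mul_of_nonneg_left
          (Real.rpow_le_rpow_of_exponent_ge (hv j) (hv1 j) hss') hC0.le
      · push Not at hY'
        have : ∀ y : T, ν (Metric.closedBall (y : X) (r y)) * w y j = 0 := fun y => by
          rw [hw0 y j fun g hg => Set.not_nonempty_iff_eq_empty.2 (hY' y g hg), mul_zero]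
        simp [this]
  have hfinal : ν F ≤ ENNReal.ofReal (K * 8 ^ b / r₁ ^ s) * ∑' j, ENNReal.ofReal (v j ^ s) := by
    calc ν F ≤ ∑' y : T, ν (Metric.closedBall (y : X) (r y)) := hνF
      _ ≤ ∑' y : T, ∑' j, ν (Metric.closedBall (y : X) (r y)) * w y j := by
          refine ENNReal.tsum_le_tsum fun y => ?_
          rw [ENNReal.tsum_mul_left]
          exact le_mul_of_one_le_right' (hw1 y y.2)
      _ = ∑' j, ∑' y : T, ν (Metric.closedBall (y : X) (r y)) * w y j := ENNReal.tsum_comm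
      _ ≤ ∑' j, ENNReal.ofReal (K * 8 ^ b / r₁ ^ s) * ENNReal.ofReal (v j ^ s) :=
          ENNReal.tsum_le_tsum hcharge
      _ = _ := ENNReal.tsum_mul_left
  have hlast : ν F < ν F := by
    refine hfinal.trans_lt ?_
    calc _ ≤ ENNReal.ofReal (K * 8 ^ b / r₁ ^ s) *
          ENNReal.ofReal ((4 * K * 8 ^ b)⁻¹ * r₁ ^ s * min 1 (ν.real F)) := by gcongr
      _ = ENNReal.ofReal (min 1 (ν.real F) / 4) := by
          rw [← ENNReal.ofReal_mul hC0.le]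
          congr 1
          field_simp
      _ < ENNReal.ofReal (ν.real F) := by
          rw [ENNReal.ofReal_lt_ofReal_iff hF]
          have := min_le_right 1 (ν.real F)
          linarith
      _ = ν F := ofReal_measureReal
  exact lt_irrefl _ hlast

end Averaging

/-! ### Consequences of the self-similarity condition -/

lemma measurable_rescale (c j : ℕ) (k : Fin d → ℕ) : Measurable (rescale (d := d) c j k) := by
  unfold rescale
  fun_prop

lemma rescale_mem_hoCube {c : ℕ} (hc : 0 < c) {i : ℕ} {k : Fin d → ℕ} {y : Fin d → ℝ}
    (hy : y ∈ box c i k) : rescale c i k y ∈ hoCube d := by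
  have hc' : (0 : ℝ) < (c : ℝ) ^ i := by positivity
  intro a
  have := hy a
  rw [div_le_iff₀ hc', lt_div_iff₀ hc'] at this
  unfold rescale
  constructor <;> nlinarith [this.1, this.2]

/-- Subboxes of a box are boxes of the rescaled grid. -/
lemma rescale_preimage_box {c : ℕ} (hc : 0 < c) (i j : ℕ) (k k' : Fin d → ℕ) :
    rescale c i k ⁻¹' box c j k' = box c (i + j) (fun a => c ^ j * k a + k' a) := by
  ext y
  have hi : (0 : ℝ) < (c : ℝ) ^ i := by positivity
  have hj : (0 : ℝ) < (c : ℝ) ^ j := by positivity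
  simp only [mem_preimage, box, rescale, mem_ofPred_eq]
  refine forall_congr' fun a => ?_
  rw [div_le_iff₀ hj, lt_div_iff₀ hj, div_le_iff₀ (by positivity), lt_div_iff₀ (by positivity),
    pow_add]
  push_cast
  constructor <;> rintro ⟨h1, h2⟩ <;> constructor <;> nlinarith

lemma eq_add_of_box_inter_nonempty {c : ℕ} (hc : 0 < c) {i j : ℕ} {k k' : Fin d → ℕ}
    (h : (box c (i + j) k' ∩ box c i k).Nonempty) :
    ∃ k'' ∈ grid d c j, k' = fun a => c ^ j * k a + k'' a := by
  obtain ⟨y, hy', hy⟩ := h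
  have hr := rescale_mem_hoCube hc hy
  refine ⟨boxIdx c j (rescale c i k y), boxIdx_mem_grid hc j hr, ?_⟩
  have h1 : y ∈ rescale c i k ⁻¹' box c j (boxIdx c j (rescale c i k y)) :=
    mem_box_boxIdx hc j fun a => (hr a).1
  rw [rescale_preimage_box hc] at h1
  have hy0 : ∀ a, 0 ≤ y a := fun a => le_trans (by positivity) (hy a).1
  rw [mem_box_iff hc hy0] at hy' h1
  exact hy'.symm.trans h1

lemma boxIdx_add {c : ℕ} (hc : 0 < c) {i : ℕ} (j : ℕ) {k : Fin d → ℕ} {y : Fin d → ℝ}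
    (hy : y ∈ box c i k) :
    boxIdx c (i + j) y = fun a => c ^ j * k a + boxIdx c j (rescale c i k y) a := by
  have hr := rescale_mem_hoCube hc hy
  have h1 : y ∈ rescale c i k ⁻¹' box c j (boxIdx c j (rescale c i k y)) :=
    mem_box_boxIdx hc j fun a => (hr a).1
  rw [rescale_preimage_box hc] at h1
  exact (mem_box_iff hc fun a => le_trans (by positivity) (hy a).1).1 h1

/-- The rescaled bound only concerns neighbours inside the box, while the level set is defined with
neighbours in the whole grid. Those outside have measure zero, because the measure is absolutely
continuous with respect to the restriction of `m` to the box. -/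
lemma ae_exists_mem_levelSet (hd : 1 ≤ d) {c : ℕ} (hc : 0 < c) {m : Measure (Fin d → ℝ)}
    {mL : ℕ → (Fin d → ℕ) → Measure (Fin d → ℝ)} {β : ℝ} {φ : ℝ → ℝ}
    (hself : SelfSimilar c m mL β φ) {i : ℕ} {k : Fin d → ℕ} (hk : k ∈ grid d c i) :
    ∀ᵐ y ∂(mL i k), ∃ n, y ∈ levelSet c (mL i k) β φ i k n := by
  obtain ⟨hfin, hac, -, hup⟩ := hself i k hk
  have h1 := ae_of_ae_map (measurable_rescale c i k).aemeasurable hup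
  have hbox : ∀ᵐ y ∂(mL i k), y ∈ box c i k :=
    hac.ae_le (ae_restrict_mem (measurableSet_box c i k))
  filter_upwards [h1, hbox] with y hy1 hy
  obtain ⟨j₀, hj₀⟩ := hy1 (rescale_mem_hoCube hc hy)
  refine ⟨j₀, hy, fun j hj k' hk' => ?_⟩
  obtain ⟨j', rfl⟩ : ∃ j', j = i + j' := ⟨j - i, by omega⟩
  by_cases hne : (box c (i + j') k' ∩ box c i k).Nonempty
  · obtain ⟨k'', hk''g, rfl⟩ := eq_add_of_box_inter_nonempty hc hne
    have hn : k'' ∈ nbrs c j' (rescale c i k y) := by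
      refine ⟨hk''g, fun a => ?_⟩
      have := hk'.2 a
      rw [boxIdx_add hc j' hy] at this
      simp only at this
      omega
    have h2 := hj₀ j' (by omega) k'' hn
    unfold DBound at h2
    rw [map_measureReal_apply (measurable_rescale c i k) (measurableSet_box _ _ _),
      rescale_preimage_box hc, diam_box hd hc] at h2
    rw [diam_box hd hc, diam_box hd hc, pow_add]
    have e : (((c : ℝ) ^ i * (c : ℝ) ^ j')⁻¹ / ((c : ℝ) ^ i)⁻¹) = ((c : ℝ) ^ j')⁻¹ := by
      field_simp
    rw [e]
    exact h2
  · have h0 : (mL i k) (box c (i + j') k') = 0 := by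
      refine measure_mono_null ?_ (ae_iff.1 hbox)
      intro z hz hz'
      exact hne ⟨z, hz, hz'⟩
    rw [measureReal_def, h0]
    simp only [ENNReal.toReal_zero]
    apply Real.rpow_nonneg
    exact div_nonneg Metric.diam_nonneg Metric.diam_nonneg

lemma levelSet_mono (c : ℕ) (ν : Measure (Fin d → ℝ)) (β : ℝ) (φ : ℝ → ℝ) (i : ℕ)
    (k : Fin d → ℕ) : Monotone (levelSet c ν β φ i k) :=
  fun _ _ hn _ hy => ⟨hy.1, fun j hj => hy.2 j (by omega)⟩

/-- The set defining `growth` is nonempty, so that the infimum is attained. -/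
lemma half_le_levelSet_growth (hd : 1 ≤ d) {c : ℕ} (hc : 0 < c) {m : Measure (Fin d → ℝ)}
    {mL : ℕ → (Fin d → ℕ) → Measure (Fin d → ℝ)} {β : ℝ} {φ : ℝ → ℝ}
    (hself : SelfSimilar c m mL β φ) {i : ℕ} {k : Fin d → ℕ} (hk : k ∈ grid d c i) :
    (mL i k).real univ / 2 ≤
      (mL i k).real (levelSet c (mL i k) β φ i k (growth c (mL i k) β φ i k)) := by
  have := (hself i k hk).1
  have hne : {n : ℕ | 1 ≤ n ∧
      (mL i k).real univ / 2 ≤ (mL i k).real (levelSet c (mL i k) β φ i k n)}.Nonempty := by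
    rcases eq_or_ne ((mL i k) univ) 0 with h0 | h0
    · exact ⟨1, le_rfl, by simp [measureReal_def, h0]⟩
    · have h1 : (mL i k) (⋃ n, levelSet c (mL i k) β φ i k n) = (mL i k) univ := by
        apply measure_congr
        filter_upwards [ae_exists_mem_levelSet hd hc hself hk] with y hy
        apply propext
        exact ⟨fun _ => trivial, fun _ => mem_iUnion.2 hy⟩
      -- Continuity from below for an increasing sequence; the level sets need not be shown
      -- measurable.
      rw [(levelSet_mono c (mL i k) β φ i k).measure_iUnion] at h1
      have h2 : (mL i k) univ / 2 < ⨆ n, (mL i k) (levelSet c (mL i k) β φ i k n) := by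
        rw [h1]; exact ENNReal.half_lt_self h0 (measure_ne_top _ _)
      obtain ⟨n, hn⟩ := lt_iSup_iff.1 h2
      -- The infimum runs over `n ≥ 1`; level sets increase, so the shift is harmless.
      refine ⟨n + 1, by omega, ?_⟩
      have h3 := hn.le.trans (measure_mono (levelSet_mono c (mL i k) β φ i k (Nat.le_succ n)))
      have h4 := ENNReal.toReal_mono (measure_ne_top _ _) h3
      rw [ENNReal.toReal_div] at h4
      simpa [measureReal_def] using h4
  exact (Nat.sInf_mem hne).2

lemma measure_univ_pos {c : ℕ} {m : Measure (Fin d → ℝ)}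
    {mL : ℕ → (Fin d → ℕ) → Measure (Fin d → ℝ)} {β : ℝ} {φ : ℝ → ℝ}
    (hself : SelfSimilar c m mL β φ) {i : ℕ} {k : Fin d → ℕ} (hk : k ∈ grid d c i)
    (hm : m (box c i k) ≠ 0) : 0 < (mL i k).real univ := by
  have := (hself i k hk).1
  refine ENNReal.toReal_pos (fun h => hm ?_) (measure_ne_top _ _)
  have := (hself i k hk).2.2.1 h
  simpa using this

lemma IsGaugeExponent.nonneg {f : ℝ → ℝ} (hf : IsGaugeExponent f) {r : ℝ} (hr : 0 ≤ r) :
    0 ≤ f r := by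
  have := hf.mono (mem_Ici.2 le_rfl) (mem_Ici.2 hr) hr
  rwa [hf.zero] at this

lemma IsGaugeExponent.tendsto {f : ℝ → ℝ} (hf : IsGaugeExponent f) :
    Tendsto f (𝓝[≥] 0) (𝓝 0) := by
  have := hf.cont 0 (mem_Ici.2 le_rfl)
  rw [ContinuousWithinAt, hf.zero] at this
  exact this

lemma tendsto_inv_pow_atTop {c : ℕ} (hc : 2 ≤ c) :
    Tendsto (fun i : ℕ => ((c : ℝ) ^ i)⁻¹) atTop (𝓝 0) := by
  have hc1 : (1 : ℝ) < c := by exact_mod_cast hc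
  exact (tendsto_pow_atTop_atTop_of_one_lt hc1).inv_tendsto_atTop

lemma IsGaugeExponent.tendsto_generation {f : ℝ → ℝ} (hf : IsGaugeExponent f) {c : ℕ}
    (hc : 2 ≤ c) : Tendsto (fun i : ℕ => f ((c : ℝ) ^ i)⁻¹) atTop (𝓝 0) := by
  refine hf.tendsto.comp (tendsto_nhdsWithin_iff.2 ⟨tendsto_inv_pow_atTop hc, ?_⟩)
  exact Eventually.of_forall fun i => by
    show (0 : ℝ) ≤ _
    positivity

/-- A gauge exponent may be traded for a loss in the exponent. -/
lemma IsGaugeExponent.exists_rpow_le {φ : ℝ → ℝ} (hφ : IsGaugeExponent φ) {b β : ℝ}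
    (hb : b < β) : ∃ K : ℝ, 1 ≤ K ∧ ∀ u, 0 < u → u ≤ 1 → u ^ (β - φ u) ≤ K * u ^ b := by
  have hev : ∀ᶠ u in 𝓝[≥] (0 : ℝ), φ u < β - b :=
    hφ.tendsto.eventually_lt_const (by linarith)
  obtain ⟨u₀, hu₀, hu⟩ := mem_nhdsGE_iff_exists_Ico_subset.1 hev
  have hu₀' : (0 : ℝ) < u₀ := hu₀
  have hφ1 := hφ.nonneg zero_le_one
  refine ⟨max 1 (u₀ ^ (-φ 1)), le_max_left _ _, fun u hu0 hu1 => ?_⟩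
  have hub : 0 < u ^ b := Real.rpow_pos_of_pos hu0 _
  rcases lt_or_ge u u₀ with h | h
  · have h1 : φ u < β - b := hu ⟨hu0.le, h⟩
    calc u ^ (β - φ u) ≤ u ^ b := Real.rpow_le_rpow_of_exponent_ge hu0 hu1 (by linarith)
      _ = 1 * u ^ b := (one_mul _).symm
      _ ≤ _ := by gcongr; exact le_max_left _ _
  · have hφu : φ u ≤ φ 1 := hφ.mono (mem_Ici.2 hu0.le)
      (mem_Ici.2 zero_le_one) hu1
    calc u ^ (β - φ u) ≤ u ^ (-φ 1 + b) :=
          Real.rpow_le_rpow_of_exponent_ge hu0 hu1 (by linarith)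
      _ = u ^ (-φ 1) * u ^ b := Real.rpow_add hu0 _ _
      _ ≤ u₀ ^ (-φ 1) * u ^ b := by
          exact mul_le_mul_of_nonneg_right
            (Real.rpow_le_rpow_of_nonpos hu₀' h (by linarith)) hub.le
      _ ≤ _ := by gcongr; exact le_max_right _ _

/-- Growth of a measure around the points of a level set. -/
lemma measureReal_closedBall_le_of_mem_levelSet (hd : 1 ≤ d) {c : ℕ} (hc : 2 ≤ c)
    (ν : Measure (Fin d → ℝ)) [IsFiniteMeasure ν] (hν : ν (hoCube d)ᶜ = 0) {β b K : ℝ}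
    {φ : ℝ → ℝ} (hb : 0 < b) (hK : 1 ≤ K)
    (hKφ : ∀ u, 0 < u → u ≤ 1 → u ^ (β - φ u) ≤ K * u ^ b) {i : ℕ} {k : Fin d → ℕ}
    (hk : k ∈ grid d c i) {n : ℕ} {y : Fin d → ℝ} (hy : y ∈ levelSet c ν β φ i k n) {r : ℝ}
    (hr : 0 < r) (hr' : r ≤ ((c : ℝ) ^ (n + i))⁻¹) :
    ν.real (Metric.closedBall y r) ≤
      3 ^ d * (K * c ^ b) * (r / ((c : ℝ) ^ (n + i))⁻¹) ^ b := by
  have hc0 : 0 < c := by omega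
  have hc1 : (1 : ℝ) ≤ c := by exact_mod_cast hc0
  have hcR : (0 : ℝ) < c := by linarith
  set r₁ : ℝ := ((c : ℝ) ^ (n + i))⁻¹ with hr₁
  have hr₁0 : 0 < r₁ := by positivity
  -- Measuring `r` in units of `r₁` forces the generation used to be at least `n + i`, where the
  -- level set controls the neighbours.
  obtain ⟨j, hj1, hj2⟩ := exists_generation_ge hc (div_pos hr hr₁0) ((div_le_one hr₁0).2 hr')
  have hrj : r ≤ ((c : ℝ) ^ (n + i + j))⁻¹ := by
    rw [div_le_iff₀ hr₁0] at hj1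
    rw [pow_add, mul_inv, mul_comm]
    exact hj1
  have hyc := box_subset_hoCube hc0 hk hy.1
  have := measureReal_closedBall_le_of_nbrs (A := K * (c * (r / r₁)) ^ b) hc0 ν hν hyc hrj
    (by positivity) fun k' hk' => ?_
  · refine this.trans (le_of_eq ?_)
    rw [Real.mul_rpow (by positivity) (by positivity)]
    ring
  · have h := hy.2 (n + i + j) (by omega) k' hk'
    rw [diam_box hd hc0, diam_box hd hc0] at h
    have e : (((c : ℝ) ^ (n + i + j))⁻¹ / ((c : ℝ) ^ i)⁻¹) = ((c : ℝ) ^ (n + j))⁻¹ := by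
      rw [pow_add, pow_add, pow_add]; field_simp
    rw [e] at h
    refine h.trans ((hKφ _ (by positivity) (inv_le_one_of_one_le₀ (one_le_pow₀ hc1))).trans ?_)
    have : ((c : ℝ) ^ (n + j))⁻¹ ≤ c * (r / r₁) := by
      refine le_trans ?_ hj2
      apply inv_anti₀ (by positivity)
      exact pow_le_pow_right₀ hc1 (by omega)
    gcongr

/-- The cost threshold attached to a box. -/
noncomputable def costThreshold (c : ℕ) (mL : ℕ → (Fin d → ℕ) → Measure (Fin d → ℝ)) (β : ℝ)
    (φ : ℝ → ℝ) (s κ : ℝ) (i : ℕ) (k : Fin d → ℕ) : ℝ :=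
  κ * ((c : ℝ) ^ (growth c (mL i k) β φ i k + i))⁻¹ ^ s * min 1 ((mL i k).real univ / 2)

/-- With `u` the side of a good box, the two inequalities of goodness bound the threshold below by
`κ / 2 * u ^ (s + s * φ u + φ u)`. Since `φ u → 0`, the gap between `s` and `t` absorbs all losses.
This is what lets the descent restart from a good box. -/
lemma eventually_le_costThreshold (hd : 1 ≤ d) {c : ℕ} (hc : 2 ≤ c)
    (mL : ℕ → (Fin d → ℕ) → Measure (Fin d → ℝ)) {β : ℝ} {φ : ℝ → ℝ} (hφ : IsGaugeExponent φ)
    {s t κ : ℝ} (hs : 0 < s) (hst : s < t) (hκ : 0 < κ) :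
    ∃ I : ℕ, ∀ i, I ≤ i → ∀ k, GoodBox c mL β φ i k →
      ((c : ℝ) ^ i)⁻¹ ^ t ≤ costThreshold c mL β φ s κ i k := by
  have hc0 : 0 < c := by omega
  have hc1 : (1 : ℝ) < c := by exact_mod_cast hc
  have hcR : (0 : ℝ) < c := by linarith
  have h1 : ∀ᶠ i : ℕ in atTop, φ ((c : ℝ) ^ i)⁻¹ < (t - s) / (2 * (s + 1)) :=
    (hφ.tendsto_generation hc).eventually_lt_const (by apply div_pos <;> linarith)
  have h2 : ∀ᶠ i : ℕ in atTop, ((c : ℝ) ^ i)⁻¹ ^ ((t - s) / 2) < κ / 2 := by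
    have : Tendsto (fun i : ℕ => ((c : ℝ) ^ i)⁻¹ ^ ((t - s) / 2)) atTop (𝓝 0) := by
      have h := ((Real.continuousAt_rpow_const (0 : ℝ) ((t - s) / 2)
        (Or.inr (by linarith))).tendsto).comp (tendsto_inv_pow_atTop hc)
      rwa [Real.zero_rpow (by linarith)] at h
    exact this.eventually_lt_const (by linarith)
  obtain ⟨I, hI⟩ := eventually_atTop.1 (h1.and h2)
  refine ⟨I, fun i hi k hg => ?_⟩
  obtain ⟨hφi, hκi⟩ := hI i hi
  obtain ⟨hg1, hg2⟩ := hg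
  rw [diam_box hd hc0] at hg1 hg2
  set u : ℝ := ((c : ℝ) ^ i)⁻¹ with hu
  have hu0 : 0 < u := by positivity
  have hu1 : u ≤ 1 := inv_le_one_of_one_le₀ (one_le_pow₀ hc1.le)
  have hφ0 : 0 ≤ φ u := hφ.nonneg hu0.le
  set g := growth c (mL i k) β φ i k with hgdef
  have hgu : u ^ (φ u) ≤ ((c : ℝ) ^ g)⁻¹ := by
    rw [hu, ← Real.rpow_natCast, ← Real.rpow_natCast, ← Real.rpow_neg hcR.le,
      ← Real.rpow_neg hcR.le, ← Real.rpow_mul hcR.le]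
    apply Real.rpow_le_rpow_of_exponent_le hc1.le
    rw [Real.rpow_neg hcR.le, Real.rpow_natCast, ← hu]
    linarith
  have hle1 : u ^ (s + s * φ u) ≤ ((c : ℝ) ^ (g + i))⁻¹ ^ s := by
    calc u ^ (s + s * φ u) = (u ^ φ u * u) ^ s := by
          rw [Real.mul_rpow (by positivity) hu0.le, ← Real.rpow_mul hu0.le, ← Real.rpow_add hu0]
          ring_nf
      _ ≤ (((c : ℝ) ^ g)⁻¹ * u) ^ s := by gcongr
      _ = _ := by rw [hu, pow_add, mul_inv]
  have hle2 : u ^ φ u / 2 ≤ min 1 ((mL i k).real univ / 2) := by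
    apply le_min
    · have := Real.rpow_le_one hu0.le hu1 hφ0
      linarith
    · linarith
  calc u ^ t = u ^ ((t - s) / 2) * u ^ ((t + s) / 2) := by
        rw [← Real.rpow_add hu0]; ring_nf
    _ ≤ κ / 2 * u ^ ((t + s) / 2) := by gcongr
    _ ≤ κ / 2 * u ^ (s + s * φ u + φ u) := by
        gcongr ?_ * ?_
        apply Real.rpow_le_rpow_of_exponent_ge hu0 hu1
        rw [lt_div_iff₀ (by linarith)] at hφi
        linarith
    _ = κ * u ^ (s + s * φ u) * (u ^ φ u / 2) := by
        rw [Real.rpow_add hu0 (s + s * φ u)]; ring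
    _ ≤ κ * ((c : ℝ) ^ (g + i))⁻¹ ^ s * min 1 ((mL i k).real univ / 2) := by gcongr

/-! ### The descent -/

section Descent

variable {X : Type*}

/-- The cost of those members of a family of sets that meet `U`. -/
noncomputable def cost (s : ℝ) (C : Set (Set X × ℝ)) (U : Set X) : ℝ≥0∞ :=
  ∑' p : C, open Classical in
    if ((p : Set X × ℝ).1 ∩ U).Nonempty then ENNReal.ofReal ((p : Set X × ℝ).2 ^ s) else 0

/-- A family of sets, each with a positive bound for its diameter. -/
def IsSizedFamily [MetricSpace X] (C : Set (Set X × ℝ)) : Prop :=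
  ∀ p ∈ C, 0 < p.2 ∧ ∀ y ∈ p.1, ∀ z ∈ p.1, dist y z ≤ p.2

lemma cost_mono (s : ℝ) (C : Set (Set X × ℝ)) {U U' : Set X} (h : U ⊆ U') :
    cost s C U ≤ cost s C U' := by
  classical
  refine ENNReal.tsum_le_tsum fun p => ?_
  by_cases hp : ((p : Set X × ℝ).1 ∩ U).Nonempty
  · rw [if_pos hp, if_pos (hp.mono (inter_subset_inter_right _ h))]
  · rw [if_neg hp]; exact zero_le

lemma cost_union_le (s : ℝ) (C C' : Set (Set X × ℝ)) (U : Set X) :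
    cost s (C ∪ C') U ≤ cost s C U + cost s C' U := by
  classical
  exact ENNReal.tsum_union_le (fun p : Set X × ℝ =>
    if (p.1 ∩ U).Nonempty then ENNReal.ofReal (p.2 ^ s) else 0) C C'

/-- The family is a set of pairs, so repetitions in the sequence are merged; choosing one index per
pair embeds it in `ℕ`. -/
lemma cost_range_le (s : ℝ) (V : ℕ → Set X) (v : ℕ → ℝ) (U : Set X) :
    cost s (range fun n => (V n, v n)) U ≤ ∑' n, ENNReal.ofReal (v n ^ s) := by
  classical
  have h1 : ∀ n, ∃ n', (V n', v n') = (V n, v n) := fun n => ⟨n, rfl⟩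
  have hsel : ∀ p : range fun n => (V n, v n), ∃ n, (V n, v n) = (p : Set X × ℝ) := fun p => p.2
  choose sel hselp using hsel
  have hinj : Function.Injective sel := fun p q h => by
    apply Subtype.ext
    rw [← hselp p, ← hselp q, h]
  refine le_trans ?_ (ENNReal.tsum_comp_le_tsum_of_injective hinj _)
  refine ENNReal.tsum_le_tsum fun p => ?_
  have e : v (sel p) = (p : Set X × ℝ).2 := by rw [← hselp p]
  show _ ≤ ENNReal.ofReal (v (sel p) ^ s)
  rw [e]
  split_ifs
  · exact le_rfl
  · exact zero_le

lemma le_cost {s : ℝ} {C : Set (Set X × ℝ)} {U : Set X} {p : Set X × ℝ} (hp : p ∈ C)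
    (h : (p.1 ∩ U).Nonempty) : ENNReal.ofReal (p.2 ^ s) ≤ cost s C U := by
  classical
  refine le_trans ?_ (ENNReal.le_tsum (⟨p, hp⟩ : C))
  rw [if_pos h]

end Descent

/-- The index `n` is at least `N`, satisfies `Q`, and the ball of centre `x n` and radius `rad n`
contains a good box of size at least `ell n` and generation at least `N`. -/
def HasGoodBox (c : ℕ) (mL : ℕ → (Fin d → ℕ) → Measure (Fin d → ℝ)) (β : ℝ) (φ : ℝ → ℝ)
    (x : ℕ → Fin d → ℝ) (rad ell : ℕ → ℝ) (Q : ℕ → Prop) (N n : ℕ) : Prop :=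
  N ≤ n ∧ Q n ∧ ∃ (i : ℕ) (k : Fin d → ℕ), N ≤ i ∧ k ∈ grid d c i ∧
    box c i k ⊆ Metric.ball (x n) (rad n) ∧ GoodBox c mL β φ i k ∧ ell n ≤ ((c : ℝ) ^ i)⁻¹

/-- One step of the descent. -/
lemma exists_next_ball (hd : 1 ≤ d) {c : ℕ} (hc : 2 ≤ c) {m : Measure (Fin d → ℝ)}
    {mL : ℕ → (Fin d → ℕ) → Measure (Fin d → ℝ)} {β : ℝ} {φ : ℝ → ℝ} (hφ : IsGaugeExponent φ)
    (hm : ∀ i, ∀ k ∈ grid d c i, m (box c i k) ≠ 0)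
    (hself : SelfSimilar c m mL β φ) (x : ℕ → Fin d → ℝ) (rad ell : ℕ → ℝ)
    (hell : ∀ n, 0 < ell n) (Q : ℕ → Prop) {K₂ s s' t b' : ℝ} (hK₂ : 1 ≤ K₂) (hs : 0 < s)
    (hss' : s ≤ s') (hsb : s' ≤ b') (hbβ : b' < β)
    (hblock : ∀ N : ℕ, ∀ᵐ y ∂m, y ∈ hoCube d → ∀ R₀ > 0, ∃ R, 0 < R ∧ R < R₀ ∧
      IsBlock (fun n => Metric.closedBall (x n) (rad n)) ell
        (HasGoodBox c mL β φ x rad ell Q N) b' s' t K₂ y R) :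
    ∃ a : ℕ → (Fin d → ℕ) → ℝ, (∀ i, ∀ k ∈ grid d c i, 0 < a i k) ∧
      (∀ t₀, s < t₀ → ∃ I : ℕ, ∀ i, I ≤ i → ∀ k, GoodBox c mL β φ i k →
        ((c : ℝ) ^ i)⁻¹ ^ t₀ ≤ a i k) ∧
      ∀ N i, ∀ k ∈ grid d c i, ∀ O : Set (Fin d → ℝ), IsOpen O → box c i k ⊆ O →
        ∀ C, IsSizedFamily C → cost s C O < ENNReal.ofReal (a i k) →
          ∃ n, HasGoodBox c mL β φ x rad ell Q N n ∧ Metric.closedBall (x n) (rad n) ⊆ O ∧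
            cost s' C (Metric.closedBall (x n) (rad n)) < ENNReal.ofReal (ell n ^ t) := by
  classical
  have hc0 : 0 < c := by omega
  have hc1 : (1 : ℝ) ≤ c := by exact_mod_cast hc0
  -- Two successive losses: `b < β` absorbs the gauge `φ` in the growth of the measure of the box,
  -- and `b' < b` absorbs constants at small radii.
  obtain ⟨b, hb'b, hbβ'⟩ := exists_between hbβ
  have hb0 : 0 < b := by linarith
  obtain ⟨K₀, hK₀, hKφ⟩ := hφ.exists_rpow_le hbβ'
  set K : ℝ := 3 ^ d * (K₀ * c ^ b) with hKdef
  have hK : 1 ≤ K := by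
    have h1 : (1 : ℝ) ≤ 3 ^ d := one_le_pow₀ (by norm_num)
    have h2 : (1 : ℝ) ≤ (c : ℝ) ^ b := Real.one_le_rpow hc1 hb0.le
    have h3 : (1 : ℝ) ≤ K₀ * c ^ b := by nlinarith
    nlinarith
  set κ : ℝ := (4 * K * 8 ^ b)⁻¹ with hκdef
  have hκ : 0 < κ := by positivity
  refine ⟨costThreshold c mL β φ s κ, fun i k hk => ?_, fun t₀ ht₀ =>
    eventually_le_costThreshold hd hc mL hφ hs ht₀ hκ, fun N i k hk O hO hbox C hC hcost => ?_⟩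
  · have := measure_univ_pos hself hk (hm i k hk)
    have h1 : 0 < min 1 ((mL i k).real univ / 2) := lt_min one_pos (by linarith)
    have hcR : (0 : ℝ) < c := by linarith
    unfold costThreshold
    positivity
  have hfin := (hself i k hk).1
  have hpos := measure_univ_pos hself hk (hm i k hk)
  set ν := mL i k with hν
  set g := growth c ν β φ i k with hg
  have hνho : ν (hoCube d)ᶜ = 0 := by
    refine (hself i k hk).2.1 ?_
    rw [Measure.restrict_apply' (measurableSet_box c i k)]
    have : (hoCube d)ᶜ ∩ box c i k = ∅ := by
      ext z
      simp only [mem_inter_iff, mem_compl_iff, mem_empty_iff_false, iff_false, not_and]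
      exact fun h1 h2 => h1 (box_subset_hoCube hc0 hk h2)
    rw [this, measure_empty]
  -- almost every point of the box is centre of blocks
  set B : Set (Fin d → ℝ) := {y | y ∈ hoCube d → ∀ R₀ > 0, ∃ R, 0 < R ∧ R < R₀ ∧
      IsBlock (fun n => Metric.closedBall (x n) (rad n)) ell
        (HasGoodBox c mL β φ x rad ell Q N) b' s' t K₂ y R} with hB
  have hBae : ν Bᶜ = 0 := by
    refine (hself i k hk).2.1 ?_
    exact nonpos_iff_eq_zero.1 ((Measure.restrict_le_self _).trans (ae_iff.1 (hblock N)).le)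
  set F := levelSet c ν β φ i k g ∩ B with hF
  have hνF : ν.real univ / 2 ≤ ν.real F := by
    refine (half_le_levelSet_growth hd hc0 hself hk).trans ?_
    have h1 : ν (levelSet c ν β φ i k g) ≤ ν F := by
      calc ν (levelSet c ν β φ i k g) ≤ ν (F ∪ Bᶜ) := measure_mono fun z hz => by
            by_cases h : z ∈ B
            · exact Or.inl ⟨hz, h⟩
            · exact Or.inr h
        _ ≤ ν F + ν Bᶜ := measure_union_le _ _
        _ = ν F := by rw [hBae, add_zero]
    exact ENNReal.toReal_mono (measure_ne_top _ _) h1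
  have hcR : (0 : ℝ) < c := by linarith
  have hr1 : (0 : ℝ) < ((c : ℝ) ^ (g + i))⁻¹ := by positivity
  have hr1' : ((c : ℝ) ^ (g + i))⁻¹ ≤ 1 := inv_le_one_of_one_le₀ (one_le_pow₀ hc1)
  have hF0 : 0 < ν.real F := by linarith
  -- Only members meeting `O` are controlled by the hypothesis. The ball to be found lies in `O`, so
  -- no other member can meet it.
  set J := {p : C // ((p : Set (Fin d → ℝ) × ℝ).1 ∩ O).Nonempty} with hJ
  have hsum : ∑' j : J, ENNReal.ofReal (((j : C) : Set (Fin d → ℝ) × ℝ).2 ^ s) ≤ cost s C O := by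
    refine le_trans (ENNReal.tsum_le_tsum fun j => ?_) (ENNReal.tsum_comp_le_tsum_of_injective
      (Subtype.val_injective (p := fun p : C => ((p : Set (Fin d → ℝ) × ℝ).1 ∩ O).Nonempty))
      (fun p : C => if ((p : Set (Fin d → ℝ) × ℝ).1 ∩ O).Nonempty then
        ENNReal.ofReal ((p : Set (Fin d → ℝ) × ℝ).2 ^ s) else 0))
    rw [if_pos j.2]
  obtain ⟨n, ⟨hn, hnO⟩, hcost'⟩ := exists_small_cost_of_blocks (J := J) ν F hF0 hK hK₂ hr1 hr1' hs
    hss' hsb hb'b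
    (fun y hy r hr hr' => measureReal_closedBall_le_of_mem_levelSet hd hc ν hνho hb0 hK₀ hKφ hk
      hy.1 hr hr')
    (fun n => Metric.closedBall (x n) (rad n)) ell
    (fun n => HasGoodBox c mL β φ x rad ell Q N n ∧ Metric.closedBall (x n) (rad n) ⊆ O)
    (fun n _ => hell n) (fun y hy R₀ hR₀ => by
      have hyL := hy.1.1
      obtain ⟨δ, hδ, hδO⟩ := Metric.isOpen_iff.1 hO y (hbox hyL)
      -- A scale below `δ / 2` keeps the whole block inside `O`.
      obtain ⟨R, hR, hRlt, G, hG, hG1, hG2⟩ := hy.2 (box_subset_hoCube hc0 hk hyL)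
        (min R₀ (δ / 2)) (lt_min hR₀ (by positivity))
      refine ⟨R, hR, hRlt.trans_le (min_le_left _ _), G, hG, fun n hn => ?_, hG2⟩
      obtain ⟨h1, h2, h3⟩ := hG1 n hn
      refine ⟨⟨h1, h2.trans (Subset.trans ?_ hδO)⟩, h2, h3⟩
      apply Metric.closedBall_subset_ball
      have := hRlt.trans_le (min_le_right _ _)
      linarith)
    (fun j => ((j : C) : Set (Fin d → ℝ) × ℝ).1) (fun j => ((j : C) : Set (Fin d → ℝ) × ℝ).2)
    (fun j => (hC _ (j : C).2).1) (fun j => (hC _ (j : C).2).2)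
    (hsum.trans_lt (hcost.trans_le (ENNReal.ofReal_le_ofReal (by
      unfold costThreshold
      have := min_le_min_left 1 hνF
      gcongr))))
  refine ⟨n, hn, hnO, lt_of_le_of_lt ?_ hcost'⟩
  unfold cost
  set f : C → ℝ≥0∞ := fun p =>
    if ((p : Set (Fin d → ℝ) × ℝ).1 ∩ Metric.closedBall (x n) (rad n)).Nonempty then
      ENNReal.ofReal ((p : Set (Fin d → ℝ) × ℝ).2 ^ s') else 0 with hf
  have hsupp : Function.support f ⊆ {p : C | ((p : Set (Fin d → ℝ) × ℝ).1 ∩ O).Nonempty} := by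
    intro p hp
    by_contra hcon
    apply hp
    rw [hf]
    simp only
    rw [if_neg]
    exact fun h => hcon (h.mono (inter_subset_inter_right _ hnO))
  have := tsum_subtype_eq_of_support_subset hsupp
  rw [← this]
  exact le_rfl

lemma IsSizedFamily.union {X : Type*} [MetricSpace X] {C C' : Set (Set X × ℝ)}
    (h : IsSizedFamily C) (h' : IsSizedFamily C') : IsSizedFamily (C ∪ C') :=
  fun p hp => hp.elim (h p) (h' p)

/-- The state of the descent: a box, an open set containing it, and a family of sets. -/
structure DescentState (d : ℕ) where
  /-- generation of the box -/
  gen : ℕ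
  /-- index of the box -/
  idx : Fin d → ℕ
  /-- open set containing the box -/
  nhd : Set (Fin d → ℝ)
  /-- sets to be avoided -/
  fam : Set (Set (Fin d → ℝ) × ℝ)

/-- The limsup set of balls satisfying `Q` is not covered by countably many sets of dimension
less than `D` if at almost every point there are blocks of balls containing good boxes. -/
theorem exists_mem_limsup_notMem (hd : 1 ≤ d) {c : ℕ} (hc : 2 ≤ c) {m : Measure (Fin d → ℝ)}
    {mL : ℕ → (Fin d → ℕ) → Measure (Fin d → ℝ)} {β : ℝ} {φ : ℝ → ℝ} (hφ : IsGaugeExponent φ)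
    (hm : ∀ i, ∀ k ∈ grid d c i, m (box c i k) ≠ 0)
    (hself : SelfSimilar c m mL β φ) (x : ℕ → Fin d → ℝ) (rad ell : ℕ → ℝ)
    (hell : ∀ n, 0 < ell n) (Q : ℕ → Prop) {K₂ D : ℝ} (hK₂ : 1 ≤ K₂) (hD : 0 < D)
    (hblock : ∀ s t, 0 < s → s < t → t < D → ∃ b, s ≤ b ∧ b < β ∧
      ∀ N : ℕ, ∀ᵐ y ∂m, y ∈ hoCube d → ∀ R₀ > 0, ∃ R, 0 < R ∧ R < R₀ ∧
      IsBlock (fun n => Metric.closedBall (x n) (rad n)) ell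
        (HasGoodBox c mL β φ x rad ell Q N) b s t K₂ y R)
    (A : ℕ → Set (Fin d → ℝ)) (hA : ∀ j, dimH (A j) < ENNReal.ofReal D) :
    ∃ y, (∀ N, ∃ n, N ≤ n ∧ Q n ∧ y ∈ Metric.closedBall (x n) (rad n)) ∧ ∀ j, y ∉ A j := by
  classical
  have hc0 : 0 < c := by omega
  have hc1 : (1 : ℝ) < c := by exact_mod_cast hc
  -- The exponent increases to `D` along the descent, so that each `A l` is eventually null for it;
  -- the midpoint between `s j` and `D` leaves room for the loss in the threshold.
  obtain ⟨s, hsmono, hsD, hslim⟩ : ∃ s : ℕ → ℝ, StrictMono s ∧ (∀ j, s j ∈ Ioo 0 D) ∧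
      Tendsto s atTop (𝓝 D) := exists_seq_strictMono_tendsto' hD
  set t : ℕ → ℝ := fun j => (s j + D) / 2 with ht
  have hst : ∀ j, s j < t j := fun j => by have := (hsD j).2; simp only [ht]; linarith
  have htD : ∀ j, t j < D := fun j => by have := (hsD j).2; simp only [ht]; linarith
  have hs0 : ∀ j, 0 < s j := fun j => (hsD j).1
  have hstep : ∀ j, ∃ a : ℕ → (Fin d → ℕ) → ℝ, (∀ i, ∀ k ∈ grid d c i, 0 < a i k) ∧
      (∀ t₀, s j < t₀ → ∃ I : ℕ, ∀ i, I ≤ i → ∀ k, GoodBox c mL β φ i k →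
        ((c : ℝ) ^ i)⁻¹ ^ t₀ ≤ a i k) ∧
      ∀ N i, ∀ k ∈ grid d c i, ∀ O : Set (Fin d → ℝ), IsOpen O → box c i k ⊆ O →
        ∀ C, IsSizedFamily C → cost (s j) C O < ENNReal.ofReal (a i k) →
          ∃ n, HasGoodBox c mL β φ x rad ell Q N n ∧ Metric.closedBall (x n) (rad n) ⊆ O ∧
            cost (s (j + 1)) C (Metric.closedBall (x n) (rad n)) <
              ENNReal.ofReal (ell n ^ t (j + 1)) := by
    intro j
    obtain ⟨b, hsb, hbβ, hbl⟩ := hblock (s (j + 1)) (t (j + 1)) (hs0 _) (hst _) (htD _)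
    exact exists_next_ball hd hc hφ hm hself x rad ell hell Q hK₂ (hs0 j)
      (hsmono.monotone (Nat.le_succ j)) hsb hbβ hbl
  choose a ha0 haI hnext using hstep
  choose I hI using fun j => haI j (t j) (hst j)
  -- the sets to be avoided at each stage
  set A' : ℕ → Set (Fin d → ℝ) := fun j =>
    ⋃ l ∈ {l : ℕ | l ≤ j ∧ dimH (A l) < ENNReal.ofReal (s j)}, A l with hA'
  have hA'0 : ∀ j, μH[s j] (A' j) = 0 := by
    intro j
    rw [hA', measure_biUnion_null_iff (Set.to_countable _)]
    intro l hl
    have h1 : dimH (A l) < ((s j).toNNReal : ℝ≥0∞) := hl.2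
    have := hausdorffMeasure_of_dimH_lt h1
    rwa [Real.coe_toNNReal _ (hs0 j).le] at this
  have hAA' : ∀ l, ∃ j₀, ∀ j, j₀ ≤ j → A l ⊆ A' j := by
    intro l
    have h1 : Tendsto (fun j => ENNReal.ofReal (s j)) atTop (𝓝 (ENNReal.ofReal D)) :=
      (ENNReal.continuous_ofReal.tendsto _).comp hslim
    obtain ⟨j₀, hj₀⟩ := eventually_atTop.1 (h1.eventually_const_lt (hA l))
    refine ⟨max j₀ l, fun j hj => subset_iUnion₂ (s := fun l (_ : l ∈ {l : ℕ | l ≤ j ∧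
      dimH (A l) < ENNReal.ofReal (s j)}) => A l) l ?_⟩
    exact ⟨(le_max_right _ _).trans hj, hj₀ j ((le_max_left _ _).trans hj)⟩
  -- the invariant and the transition
  let Inv : ℕ → DescentState d → Prop := fun j σ => σ.idx ∈ grid d c σ.gen ∧ IsOpen σ.nhd ∧
    box c σ.gen σ.idx ⊆ σ.nhd ∧ IsSizedFamily σ.fam ∧
    cost (s j) σ.fam σ.nhd < ENNReal.ofReal (a j σ.gen σ.idx)
  let Rel : ℕ → DescentState d → DescentState d → Prop := fun j σ σ' => σ.fam ⊆ σ'.fam ∧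
    (∀ y ∈ A' j, ∃ p ∈ σ'.fam, y ∈ p.1) ∧ j ≤ σ'.gen ∧
    cost (s (j + 1)) σ'.fam σ'.nhd < ENNReal.ofReal (((c : ℝ) ^ σ'.gen)⁻¹ ^ t (j + 1)) ∧
    ∃ n, j ≤ n ∧ Q n ∧ Metric.closedBall (x n) (rad n) ⊆ σ.nhd ∧
      σ'.nhd = Metric.ball (x n) (rad n)
  have hex : ∀ j σ, Inv j σ → ∃ σ', Inv (j + 1) σ' ∧ Rel j σ σ' := by
    rintro j ⟨i, k, O, C⟩ ⟨hk, hO, hbox, hC, hcost⟩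
    simp only at hk hO hbox hC hcost
    -- The cover of the new sets costs less than the slack left by the invariant.
    obtain ⟨V, v, hVA, hv0, hVv, hVsum⟩ := exists_cover_of_hausdorffMeasure_zero (hs0 j) (hA'0 j)
      (tsub_pos_of_lt hcost)
    set C' : Set (Set (Fin d → ℝ) × ℝ) := C ∪ range fun n => (V n, v n) with hC'
    have hC's : IsSizedFamily C' := by
      refine hC.union ?_
      rintro _ ⟨n, rfl⟩
      exact ⟨hv0 n, hVv n⟩
    have hC'cost : cost (s j) C' O < ENNReal.ofReal (a j i k) := by
      refine (cost_union_le _ _ _ _).trans_lt ?_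
      have h1 : cost (s j) (range fun n => (V n, v n)) O <
          ENNReal.ofReal (a j i k) - cost (s j) C O := (cost_range_le _ _ _ _).trans_lt hVsum
      rw [add_comm]
      exact lt_tsub_iff_right.1 h1
    -- Index and generation at least `j` yield the limsup condition and shrinking boxes. Generation
    -- at least `I (j + 1)` makes the next threshold at least the power `t (j + 1)` of the side,
    -- which restores the invariant.
    obtain ⟨n, ⟨hNn, hQn, i', k', hNi, hk', hbox', hgood, hell'⟩, hnO, hncost⟩ :=
      hnext j (max j (I (j + 1))) i k hk O hO hbox C' hC's hC'cost
    have hcost1 : cost (s (j + 1)) C' (Metric.ball (x n) (rad n)) <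
        ENNReal.ofReal (((c : ℝ) ^ i')⁻¹ ^ t (j + 1)) := by
      refine (cost_mono _ _ Metric.ball_subset_closedBall).trans_lt (hncost.trans_le ?_)
      apply ENNReal.ofReal_le_ofReal
      exact Real.rpow_le_rpow (hell n).le hell' ((hs0 _).trans (hst _)).le
    refine ⟨⟨i', k', Metric.ball (x n) (rad n), C'⟩, ⟨hk', Metric.isOpen_ball, hbox', hC's, ?_⟩,
      subset_union_left, ?_, (le_max_left _ _).trans hNi, hcost1,
      n, (le_max_left _ _).trans hNn, hQn, hnO, rfl⟩
    · refine hcost1.trans_le (ENNReal.ofReal_le_ofReal ?_)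
      exact hI (j + 1) i' ((le_max_right _ _).trans hNi) k' hgood
    · intro y hy
      obtain ⟨l, hl⟩ := mem_iUnion.1 (hVA hy)
      exact ⟨(V l, v l), Or.inr ⟨l, rfl⟩, hl⟩
  choose! nxt hnxtI hnxtR using hex
  let σ : ℕ → DescentState d := fun j =>
    Nat.rec ⟨0, fun _ => 0, univ, ∅⟩ (fun j τ => nxt j τ) j
  have hσs : ∀ j, σ (j + 1) = nxt j (σ j) := fun j => rfl
  have hInv : ∀ j, Inv j (σ j) := by
    intro j
    induction j with
    | zero =>
      have hk0 : (fun _ => 0 : Fin d → ℕ) ∈ grid d c 0 := fun i => by simp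
      refine ⟨hk0, isOpen_univ, subset_univ _, fun p hp => absurd hp (by simp [σ]), ?_⟩
      have : cost (s 0) (∅ : Set (Set (Fin d → ℝ) × ℝ)) univ = 0 := by simp [cost]
      show cost (s 0) ∅ univ < ENNReal.ofReal (a 0 0 fun _ => 0)
      rw [this]
      exact ENNReal.ofReal_pos.2 (ha0 0 0 _ hk0)
    | succ j ih => rw [hσs]; exact hnxtI j _ ih
  have hRel : ∀ j, Rel j (σ j) (σ (j + 1)) := fun j => by rw [hσs]; exact hnxtR j _ (hInv j)
  choose n hjn hQn hnsub hnhd using fun j => (hRel j).2.2.2.2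
  have hfam : Monotone fun j => (σ j).fam := monotone_nat_of_le_succ fun j => (hRel j).1
  have hnested : ∀ j, Metric.closedBall (x (n (j + 1))) (rad (n (j + 1))) ⊆
      Metric.closedBall (x (n j)) (rad (n j)) := fun j =>
    (hnsub (j + 1)).trans ((hnhd j).symm ▸ Metric.ball_subset_closedBall)
  have hballne : ∀ j, (Metric.closedBall (x (n j)) (rad (n j))).Nonempty := by
    intro j
    have h1 := (hInv (j + 1)).2.2.1
    rw [hnhd j] at h1
    have hcpos : (0 : ℝ) < ((c : ℝ) ^ (σ (j + 1)).gen)⁻¹ := by positivity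
    exact ⟨_, Metric.ball_subset_closedBall (h1 (corner_add_mem_box hc0 _ _ le_rfl hcpos))⟩
  obtain ⟨y, hy⟩ := IsCompact.nonempty_iInter_of_sequence_nonempty_isCompact_isClosed
    (fun j => Metric.closedBall (x (n j)) (rad (n j))) hnested hballne
    (isCompact_closedBall _ _) fun j => Metric.isClosed_closedBall
  have hyj : ∀ j, y ∈ Metric.closedBall (x (n j)) (rad (n j)) := fun j => mem_iInter.1 hy j
  refine ⟨y, fun N => ⟨n N, hjn N, hQn N, hyj N⟩, fun l hyl => ?_⟩
  obtain ⟨j₀, hj₀⟩ := hAA' l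
  obtain ⟨p, hp, hyp⟩ := (hRel j₀).2.1 y (hj₀ j₀ le_rfl hyl)
  have hp0 : 0 < p.2 := ((hInv (j₀ + 1)).2.2.2.1 p hp).1
  -- The member `p` containing `y` meets every later neighbourhood, so its own term alone stays
  -- below thresholds tending to `0`, although `p.2` is fixed and positive.
  have hlt : ∀ j, j₀ ≤ j → p.2 ^ s (j + 1) < ((c : ℝ) ^ j)⁻¹ ^ s 0 := by
    intro j hj
    have hpj : p ∈ (σ (j + 1)).fam := hfam (by omega : j₀ + 1 ≤ j + 1) hp
    have hyn : y ∈ (σ (j + 1)).nhd := hnsub (j + 1) (hyj (j + 1))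
    have h1 := (le_cost (s := s (j + 1)) hpj ⟨y, hyp, hyn⟩).trans_lt (hRel j).2.2.2.1
    have hcpos : (0 : ℝ) < ((c : ℝ) ^ (σ (j + 1)).gen)⁻¹ := by positivity
    rw [ENNReal.ofReal_lt_ofReal_iff (Real.rpow_pos_of_pos hcpos _)] at h1
    refine h1.trans_le ?_
    have hs0t : s 0 ≤ t (j + 1) := (hsmono.monotone (Nat.zero_le _)).trans (hst (j + 1)).le
    calc _ ≤ ((c : ℝ) ^ j)⁻¹ ^ t (j + 1) := by
          apply Real.rpow_le_rpow hcpos.le _ ((hs0 _).trans (hst _)).le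
          exact inv_anti₀ (by positivity) (pow_le_pow_right₀ hc1.le (hRel j).2.2.1)
      _ ≤ _ := Real.rpow_le_rpow_of_exponent_ge (by positivity)
          (inv_le_one_of_one_le₀ (one_le_pow₀ hc1.le)) hs0t
  -- The exponent varies with `j`; truncating the size at `1` and raising to the power `D` gives a
  -- bound free of `j`.
  have hlow : ∀ j, min p.2 1 ^ D ≤ p.2 ^ s (j + 1) := by
    intro j
    calc min p.2 1 ^ D ≤ min p.2 1 ^ s (j + 1) :=
          Real.rpow_le_rpow_of_exponent_ge (lt_min hp0 one_pos) (min_le_right _ _)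
            (hsD (j + 1)).2.le
      _ ≤ _ := Real.rpow_le_rpow (lt_min hp0 one_pos).le (min_le_left _ _) (hs0 _).le
  have hlim : Tendsto (fun j : ℕ => ((c : ℝ) ^ j)⁻¹ ^ s 0) atTop (𝓝 0) := by
    have h := ((Real.continuousAt_rpow_const (0 : ℝ) (s 0)
      (Or.inr (hs0 0).le)).tendsto).comp (tendsto_inv_pow_atTop hc)
    rwa [Real.zero_rpow (hs0 0).ne'] at h
  have hpos : 0 < min p.2 1 ^ D := Real.rpow_pos_of_pos (lt_min hp0 one_pos) _
  obtain ⟨j, hj, hj'⟩ := ((hlim.eventually_lt_const hpos).and (eventually_ge_atTop j₀)).exists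
  have := hlt j hj'
  have := hlow j
  linarith

/-! ### Upper bounds for the dimension of limsup sets -/

lemma inv_two_pow_rpow (J : ℕ) (s : ℝ) : ((2 : ℝ) ^ J)⁻¹ ^ s = (2 : ℝ) ^ (-(J * s)) := by
  rw [← Real.rpow_natCast, ← Real.rpow_neg (by norm_num), ← Real.rpow_mul (by norm_num)]
  ring_nf

/-- Counting balls at each dyadic scale bounds the dimension of a limsup set. -/
lemma dimH_le_of_card_le {X : Type*} [MetricSpace X] (E : Set X) (x : ℕ → X) (rad : ℕ → ℝ)
    (S : ℕ → Finset ℕ)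
    (hcov : ∀ y ∈ E, ∀ J₀, ∃ J, J₀ ≤ J ∧ ∃ n ∈ S J, y ∈ Metric.closedBall (x n) (rad n))
    {e δ : ℝ} (he : 0 ≤ e) (hδ : 0 < δ)
    (hcard : ∀ᶠ J in atTop, ((S J).card : ℝ) ≤ (2 : ℝ) ^ (J * e))
    (hrad : ∀ᶠ J in atTop, ∀ n ∈ S J, rad n ≤ ((2 : ℝ) ^ J)⁻¹ ^ δ) :
    dimH E ≤ ENNReal.ofReal (e / δ) := by
  borelize X
  refine le_of_forall_gt_imp_ge_of_dense fun s' hs' => ?_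
  rcases eq_or_ne s' ⊤ with rfl | hs'top
  · exact le_top
  lift s' to NNReal using hs'top
  have hs'' : e / δ < s' := by
    have := (ENNReal.ofReal_lt_iff_lt_toReal (by positivity) ENNReal.coe_ne_top).1 hs'
    simpa using this
  set s : ℝ := (s' : ℝ) with hs
  have hs0 : 0 ≤ s := s'.2
  have hes : e < δ * s := by rwa [div_lt_iff₀ hδ, mul_comm] at hs''
  refine dimH_le_of_hausdorffMeasure_ne_top ?_
  obtain ⟨J₁, hJ₁⟩ := eventually_atTop.1 (hcard.and hrad)
  -- The ratio of a geometric series: at most `2 ^ (J * e)` balls of radius at most `2 ^ (-J * δ)`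
  -- cost about `q ^ J` at exponent `s`.
  set q : ℝ := (2 : ℝ) ^ (e - δ * s) with hq
  have hq0 : 0 < q := by positivity
  have hq1 : q < 1 := Real.rpow_lt_one_of_one_lt_of_neg (by norm_num) (by linarith)
  have hsmall : ∀ J, J₁ ≤ J → ∀ n ∈ S J,
      Metric.ediam (Metric.closedBall (x n) (rad n)) ≤
        ENNReal.ofReal (2 * ((2 : ℝ) ^ J)⁻¹ ^ δ) := by
    intro J hJ n hn
    refine Metric.ediam_le fun y hy z hz => ?_
    rw [edist_dist]
    apply ENNReal.ofReal_le_ofReal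
    have h1 := (hJ₁ J hJ).2 n hn
    rw [Metric.mem_closedBall] at hy hz
    have := dist_triangle_right y z (x n)
    linarith
  have hterm : ∀ J, J₁ ≤ J → ∑' n : S J,
      Metric.ediam (Metric.closedBall (x n) (rad n)) ^ s ≤ ENNReal.ofReal (2 ^ s * q ^ J) := by
    intro J hJ
    calc _ ≤ ∑' _n : S J, ENNReal.ofReal ((2 * ((2 : ℝ) ^ J)⁻¹ ^ δ) ^ s) := by
          refine ENNReal.tsum_le_tsum fun n => ?_
          rw [← ENNReal.ofReal_rpow_of_nonneg (by positivity) hs0]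
          exact ENNReal.rpow_le_rpow (hsmall J hJ n n.2) hs0
      _ = ENNReal.ofReal ((S J).card * (2 * ((2 : ℝ) ^ J)⁻¹ ^ δ) ^ s) := by
          rw [tsum_fintype, Finset.sum_const, nsmul_eq_mul, ENNReal.ofReal_mul (by positivity),
            ENNReal.ofReal_natCast]
          simp
      _ ≤ _ := by
          apply ENNReal.ofReal_le_ofReal
          calc _ ≤ (2 : ℝ) ^ (J * e) * (2 * ((2 : ℝ) ^ J)⁻¹ ^ δ) ^ s := by
                gcongr; exact (hJ₁ J hJ).1
            _ = 2 ^ s * ((2 : ℝ) ^ (J * e) * 2 ^ (-(J * δ) * s)) := by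
                rw [Real.mul_rpow (by norm_num) (by positivity), inv_two_pow_rpow,
                  ← Real.rpow_mul (by norm_num)]
                ring
            _ = 2 ^ s * q ^ J := by
                rw [← Real.rpow_add (by norm_num), hq, ← Real.rpow_natCast,
                  ← Real.rpow_mul (by norm_num)]
                ring_nf
  set ι : ℕ → Type := fun J₀ => Σ i : ℕ, S (J₀ + i) with hι
  have hle := Measure.hausdorffMeasure_le_liminf_tsum (ι := ι) s E (l := atTop)
    (fun J₀ : ℕ => ENNReal.ofReal (2 * ((2 : ℝ) ^ J₀)⁻¹ ^ δ)) (by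
      have h2 := ((Real.continuousAt_rpow_const (0 : ℝ) δ (Or.inr hδ.le)).tendsto).comp
        (tendsto_inv_pow_atTop (c := 2) le_rfl)
      rw [Real.zero_rpow hδ.ne'] at h2
      have h3 := (h2.const_mul 2)
      rw [mul_zero] at h3
      have h4 := (ENNReal.continuous_ofReal.tendsto 0).comp h3
      rw [ENNReal.ofReal_zero] at h4
      simpa [Function.comp_def] using h4)
    (fun J₀ p => Metric.closedBall (x p.2) (rad p.2)) (by
      filter_upwards [eventually_ge_atTop J₁] with J₀ hJ₀ p
      refine (hsmall (J₀ + p.1) (by omega) p.2 p.2.2).trans ?_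
      apply ENNReal.ofReal_le_ofReal
      have : ((2 : ℝ) ^ (J₀ + p.1))⁻¹ ≤ ((2 : ℝ) ^ J₀)⁻¹ :=
        inv_anti₀ (by positivity) (pow_le_pow_right₀ (by norm_num) (by omega))
      gcongr) (Eventually.of_forall fun J₀ y hy => by
      obtain ⟨J, hJ, n, hn, hyn⟩ := hcov y hy J₀
      obtain ⟨i, rfl⟩ : ∃ i, J = J₀ + i := ⟨J - J₀, by omega⟩
      exact mem_iUnion.2 ⟨⟨i, ⟨n, hn⟩⟩, hyn⟩)
  refine ne_top_of_le_ne_top ?_ (hle.trans (liminf_le_of_frequently_le' (x :=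
    ENNReal.ofReal (2 ^ s * ∑' i, q ^ i)) (Eventually.frequently ?_)))
  · exact ENNReal.ofReal_ne_top
  · filter_upwards [eventually_ge_atTop J₁] with J₀ hJ₀
    refine (ENNReal.tsum_sigma (fun (i : ℕ) (n : S (J₀ + i)) =>
      Metric.ediam (Metric.closedBall (x n) (rad n)) ^ s)).le.trans ?_
    have hgeo : Summable fun i : ℕ => q ^ i := summable_geometric_of_lt_one hq0.le hq1
    calc _ ≤ ∑' i : ℕ, ENNReal.ofReal (2 ^ s * q ^ i) := by
          refine ENNReal.tsum_le_tsum fun i => (hterm (J₀ + i) (by omega)).trans ?_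
          apply ENNReal.ofReal_le_ofReal
          have : q ^ (J₀ + i) ≤ q ^ i := pow_le_pow_of_le_one hq0.le hq1.le (by omega)
          gcongr
      _ = ENNReal.ofReal (2 ^ s * ∑' i, q ^ i) := by
          rw [← tsum_mul_left, ENNReal.ofReal_tsum_of_nonneg (fun i => by positivity)
            (hgeo.mul_left _)]

/-! ### Counting boxes -/

lemma measure_compl_hoCube {μ : Measure (Fin d → ℝ)} (hμ : μ.support = cube d)
    (hμ' : μ (cube d \ hoCube d) = 0) : μ (hoCube d)ᶜ = 0 := by
  have h1 : μ (cube d)ᶜ = 0 := by rw [← hμ]; exact Measure.measure_compl_support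
  refine measure_mono_null (t := (cube d)ᶜ ∪ (cube d \ hoCube d)) (fun z hz => ?_)
    (measure_union_null h1 hμ')
  by_cases h : z ∈ cube d
  · exact Or.inr ⟨h, hz⟩
  · exact Or.inl h

lemma measure_box_ne_zero {μ : Measure (Fin d → ℝ)} (hμ : μ.support = cube d) {c : ℕ}
    (hc : 0 < c) {j : ℕ} {k : Fin d → ℕ} (hk : k ∈ grid d c j) : μ (box c j k) ≠ 0 := by
  have hc' : (0 : ℝ) < ((c : ℝ) ^ j)⁻¹ := by positivity
  have hy := corner_add_mem_box hc j k (t := ((c : ℝ) ^ j)⁻¹ / 2) (by positivity) (by linarith)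
  set y : Fin d → ℝ := fun i => (k i : ℝ) / (c : ℝ) ^ j + ((c : ℝ) ^ j)⁻¹ / 2 with hydef
  have hyc : y ∈ μ.support := by
    rw [hμ]
    have := box_subset_hoCube hc hk hy
    exact ⟨fun i => (this i).1, fun i => (this i).2.le⟩
  refine ((Measure.mem_support_iff_forall y).1 hyc _ ?_).ne'
  rw [box_eq_pi]
  refine set_pi_mem_nhds finite_univ fun i _ => Ico_mem_nhds ?_ ?_
  · simp only [hydef]; linarith
  · have : ((k i : ℝ) + 1) / (c : ℝ) ^ j = (k i : ℝ) / (c : ℝ) ^ j + ((c : ℝ) ^ j)⁻¹ := by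
      field_simp
    simp only [hydef, this]; linarith

/-- A `q` nearly attaining the infimum satisfies τ_μ(q) > αq - β - η, and the liminf turns this into
a bound at all large generations. The value `⊥` of τ_μ(q) is excluded, since it would make the
Legendre difference infinite; `⊤` is harmless. -/
lemma exists_moment_bound {c : ℕ} (hc : 2 ≤ c) {μ : Measure (Fin d → ℝ)} [IsFiniteMeasure μ]
    (hμ : μ.support = cube d) {α β : ℝ} (hβτ : tauStar c μ α = (β : EReal)) {η : ℝ}
    (hη : 0 < η) : ∃ q : ℝ, ∀ᶠ j : ℕ in atTop,
      ∑ k : Fin d → Fin (c ^ j), μ.real (box c j (fun i => (k i : ℕ))) ^ q ≤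
        ((c : ℝ) ^ j) ^ (β + η - α * q) := by
  have hc0 : 0 < c := by omega
  have hc1 : (1 : ℝ) < c := by exact_mod_cast hc
  have h1 : tauStar c μ α < ((β + η : ℝ) : EReal) := by
    rw [hβτ]; exact_mod_cast (by linarith : β < β + η)
  unfold tauStar at h1
  obtain ⟨q, hq⟩ := iInf_lt_iff.1 h1
  refine ⟨q, ?_⟩
  have h2 : ((α * q - β - η : ℝ) : EReal) < tau c μ q := by
    induction hT : tau c μ q with
    | bot =>
      rw [hT, EReal.sub_bot (EReal.coe_ne_bot _)] at hq
      exact absurd hq not_top_lt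
    | top => exact EReal.coe_lt_top _
    | coe T =>
      rw [hT] at hq
      have h3 : α * q - T < β + η := by exact_mod_cast hq
      exact_mod_cast (by linarith : α * q - β - η < T)
  have h3 := eventually_lt_of_lt_liminf h2
  filter_upwards [h3, eventually_gt_atTop 0] with j hj hj0
  have h4 : α * q - β - η < -(j : ℝ)⁻¹ * Real.logb c
      (∑ k : Fin d → Fin (c ^ j), μ.real (box c j (fun i => (k i : ℕ))) ^ q) := by
    exact_mod_cast hj
  have hjR : (0 : ℝ) < j := by exact_mod_cast hj0
  have hcj : NeZero (c ^ j) := ⟨(pow_pos hc0 j).ne'⟩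
  have hpos : 0 < ∑ k : Fin d → Fin (c ^ j), μ.real (box c j (fun i => (k i : ℕ))) ^ q := by
    refine Finset.sum_pos (fun k _ => Real.rpow_pos_of_pos ?_ _) Finset.univ_nonempty
    exact ENNReal.toReal_pos (measure_box_ne_zero hμ hc0 fun i => (k i).2) (measure_ne_top _ _)
  set Mq := ∑ k : Fin d → Fin (c ^ j), μ.real (box c j (fun i => (k i : ℕ))) ^ q with hMq
  have h5 : Real.logb c Mq ≤ j * (β + η - α * q) := by
    have e : -(j : ℝ)⁻¹ * Real.logb c Mq * j = - Real.logb c Mq := by field_simp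
    nlinarith
  rw [Real.logb_le_iff_le_rpow hc1 hpos, Real.rpow_mul (by linarith), Real.rpow_natCast] at h5
  exact h5

/-- The value `τ_μ^*(α)` is at most the dimension of the space. -/
lemma le_dimension_of_tauStar {c : ℕ} (hc : 2 ≤ c) {μ : Measure (Fin d → ℝ)}
    {α β : ℝ} (hβτ : tauStar c μ α = (β : EReal)) : β ≤ d := by
  have hc1 : (1 : ℝ) < c := by exact_mod_cast hc
  -- At `q = 0` every box contributes `1`, whatever its mass, so the sum counts the `c ^ (j * d)`
  -- boxes.
  have h0 : tau c μ 0 = ((-(d : ℝ) : ℝ) : EReal) := by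
    unfold tau
    refine Tendsto.liminf_eq (tendsto_const_nhds.congr' ?_)
    filter_upwards [eventually_gt_atTop 0] with j hj
    have hjR : (j : ℝ) ≠ 0 := by exact_mod_cast hj.ne'
    congr 1
    simp only [Real.rpow_zero, Finset.sum_const, Finset.card_univ, Fintype.card_fun,
      Fintype.card_fin, nsmul_eq_mul, mul_one]
    push_cast
    rw [Real.logb_pow, Real.logb_pow, Real.logb_self_eq_one hc1]
    field_simp
  have h1 : tauStar c μ α ≤ ((α * 0 : ℝ) : EReal) - tau c μ 0 := iInf_le _ 0
  rw [h0, hβτ] at h1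
  have h2 : β ≤ α * 0 - -(d : ℝ) := by exact_mod_cast h1
  linarith

/-- The distance from a point to the points of the neighbouring boxes. -/
lemma dist_le_of_mem_box_nbrs {c : ℕ} (hc : 0 < c) {j : ℕ} {y z : Fin d → ℝ} {k : Fin d → ℕ}
    (hy : ∀ i, 0 ≤ y i) (hk : k ∈ nbrs c j y) (hz : z ∈ box c j k) :
    dist z y ≤ 2 * ((c : ℝ) ^ j)⁻¹ := by
  have hc' : (0 : ℝ) < (c : ℝ) ^ j := by positivity
  refine (dist_pi_le_iff (by positivity)).2 fun i => ?_
  have h1 := hz i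
  have h2 := mem_box_boxIdx hc j hy i
  have h3 := hk.2 i
  have h4 : (k i : ℝ) ≤ boxIdx c j y i + 1 := by exact_mod_cast h3.1
  have h5 : (boxIdx c j y i : ℝ) ≤ k i + 1 := by exact_mod_cast h3.2
  have e : (c : ℝ) ^ j * ((c : ℝ) ^ j)⁻¹ = 1 := mul_inv_cancel₀ hc'.ne'
  rw [div_le_iff₀ hc', lt_div_iff₀ hc'] at h1 h2
  have h6 : (z i - y i) * (c : ℝ) ^ j ≤ 2 := by linarith
  have h7 : -2 ≤ (z i - y i) * (c : ℝ) ^ j := by linarith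
  rw [Real.dist_eq, abs_le]
  constructor
  · rw [← div_eq_mul_inv, ← neg_div, div_le_iff₀ hc']; exact h7
  · rw [← div_eq_mul_inv, le_div_iff₀ hc']; exact h6

/-- Balls of controlled mass are close to boxes of controlled mass. -/
lemma exists_box_near_ball {c : ℕ} (hc : 2 ≤ c) {μ : Measure (Fin d → ℝ)}
    [IsFiniteMeasure μ] (hμ : μ.support = cube d) (hμ' : μ (cube d \ hoCube d) = 0) {α : ℝ}
    (q : ℝ) : ∃ C κ : ℝ, 1 ≤ C ∧ 0 < κ ∧ ∀ h, 0 < h → h ≤ 1 / 2 →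
      ∃ g : ℕ, ((c : ℝ) ^ g)⁻¹ ≤ C * h ∧ h ≤ C * ((c : ℝ) ^ g)⁻¹ ∧
        ∀ x ∈ cube d, ∀ r, h / 2 ≤ r → r ≤ h → ∀ e, |e| ≤ α → |e| ≤ 1 →
          r ^ (α + e) ≤ μ.real (Metric.closedBall x r) →
          μ.real (Metric.closedBall x r) ≤ r ^ (α - e) →
          ∃ k ∈ grid d c g, box c g k ⊆ Metric.closedBall x (C * h) ∧
            κ * ((c : ℝ) ^ g)⁻¹ ^ (α * q + |e| * |q|) ≤ μ.real (box c g k) ^ q := by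
  have hc0 : 0 < c := by omega
  have hc1 : (2 : ℝ) ≤ c := by exact_mod_cast hc
  have hcR : (0 : ℝ) < c := by linarith
  -- For `q ≥ 0` a box of large mass is needed, found by pigeonhole among at most `3 ^ d`
  -- neighbours. For `q < 0` a box of small mass is needed, and any box inside the ball is one.
  rcases le_or_gt 0 q with hq | hq
  -- The side is at most `2 * c * h`; points of a neighbour are within two sides of `y`, itself
  -- within `h` of `x`. The bounds on `|e|` keep the exponents nonnegative and the constants
  -- independent of `e`.
  · refine ⟨4 * c + 1, ((3 ^ d)⁻¹ / 2) ^ q * ((4 * (c : ℝ))⁻¹ ^ (α + 1)) ^ q, by linarith,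
      by positivity, fun h hh hh' => ?_⟩
    obtain ⟨g, hg1, hg2⟩ := exists_generation_ge hc (r := 2 * h) (by positivity) (by linarith)
    set u : ℝ := ((c : ℝ) ^ g)⁻¹ with hu
    have hu0 : 0 < u := by positivity
    have hu1 : u ≤ 1 := inv_le_one_of_one_le₀ (one_le_pow₀ (by linarith))
    refine ⟨g, by nlinarith, by nlinarith, fun x hx r hr1 hr2 e he1 he2 hlow _ => ?_⟩
    have hr0 : 0 < r := by linarith
    have hre : 0 < r ^ (α + e) := Real.rpow_pos_of_pos hr0 _
    have hαe : 0 ≤ α + e := by have := neg_abs_le e; linarith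
    have hμh := measure_compl_hoCube hμ hμ'
    obtain ⟨y, hyx, hyc⟩ : ∃ y ∈ Metric.closedBall x r, y ∈ hoCube d := by
      by_contra hcon
      push Not at hcon
      have : μ (Metric.closedBall x r) = 0 := measure_mono_null (fun z hz => hcon z hz) hμh
      rw [measureReal_def, this] at hlow
      simp at hlow
      linarith
    have hsub : Metric.closedBall x r ⊆ Metric.closedBall y (2 * r) := by
      apply Metric.closedBall_subset_closedBall'
      rw [dist_comm]
      have := Metric.mem_closedBall.1 hyx
      linarith
    obtain ⟨k, hk, hkμ⟩ : ∃ k ∈ nbrs c g y,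
        (3 ^ d)⁻¹ / 2 * r ^ (α + e) ≤ μ.real (box c g k) := by
      by_contra hcon
      push Not at hcon
      have h1 := measureReal_closedBall_le_of_nbrs hc0 μ hμh hyc (r := 2 * r) (j := g)
        (by rw [← hu]; linarith) (by positivity) fun k hk => (hcon k hk).le
      have h2 := hlow.trans ((measureReal_mono hsub).trans h1)
      have e3 : (3 : ℝ) ^ d * ((3 ^ d)⁻¹ / 2 * r ^ (α + e)) = r ^ (α + e) / 2 := by field_simp
      rw [e3] at h2
      linarith
    refine ⟨k, hk.1, fun z hz => ?_, ?_⟩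
    · have h1 := dist_le_of_mem_box_nbrs hc0 (fun i => (hyc i).1) hk hz
      rw [← hu] at h1
      have h2 := dist_triangle z y x
      have h3 := Metric.mem_closedBall.1 hyx
      rw [Metric.mem_closedBall]
      nlinarith
    · have hru : (4 * (c : ℝ))⁻¹ * u ≤ r := by
        rw [inv_mul_le_iff₀ (by positivity)]
        nlinarith
      have h1 : (4 * (c : ℝ))⁻¹ ^ (α + 1) * u ^ (α + |e|) ≤ r ^ (α + e) := by
        calc _ ≤ (4 * (c : ℝ))⁻¹ ^ (α + e) * u ^ (α + e) := by
              have hi : (4 * (c : ℝ))⁻¹ ≤ 1 := inv_le_one_of_one_le₀ (by linarith)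
              have h2 := le_abs_self e
              apply mul_le_mul _ _ (by positivity) (by positivity)
              · exact Real.rpow_le_rpow_of_exponent_ge (by positivity) hi (by linarith)
              · exact Real.rpow_le_rpow_of_exponent_ge hu0 hu1 (by linarith)
          _ = ((4 * (c : ℝ))⁻¹ * u) ^ (α + e) := (Real.mul_rpow (by positivity) hu0.le).symm
          _ ≤ _ := Real.rpow_le_rpow (by positivity) hru hαe
      calc _ = ((3 ^ d)⁻¹ / 2 * ((4 * (c : ℝ))⁻¹ ^ (α + 1) * u ^ (α + |e|))) ^ q := by
            rw [← hu, Real.mul_rpow (x := (3 ^ d)⁻¹ / 2) (by positivity) (by positivity),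
              Real.mul_rpow (y := u ^ (α + |e|)) (by positivity) (by positivity),
              ← Real.rpow_mul hu0.le, abs_of_nonneg hq, add_mul, mul_assoc]
        _ ≤ ((3 ^ d)⁻¹ / 2 * r ^ (α + e)) ^ q := by gcongr
        _ ≤ _ := by gcongr
  · refine ⟨2 * c, ((2 * (c : ℝ)) ^ (α + 1)) ^ q, by linarith, by positivity, fun h hh hh' => ?_⟩
    obtain ⟨g, hg1, hg2⟩ := exists_generation hc (r := h / 2) (by positivity) (by linarith)
    set u : ℝ := ((c : ℝ) ^ g)⁻¹ with hu
    have hu0 : 0 < u := by positivity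
    have hu1 : u ≤ 1 := inv_le_one_of_one_le₀ (one_le_pow₀ (by linarith))
    refine ⟨g, by nlinarith, by nlinarith, fun x hx r hr1 hr2 e he1 he2 _ hup => ?_⟩
    have hr0 : 0 < r := by linarith
    have hαe : 0 ≤ α - e := by have := le_abs_self e; linarith
    obtain ⟨k, hk, hkx⟩ := exists_box_subset_closedBall hc0 g hx
    refine ⟨k, hk, hkx.trans (Metric.closedBall_subset_closedBall (by rw [← hu]; nlinarith)), ?_⟩
    have hkr : μ.real (box c g k) ≤ r ^ (α - e) :=
      (measureReal_mono (hkx.trans (Metric.closedBall_subset_closedBall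
        (by rw [← hu]; linarith)))).trans hup
    have hpos : 0 < μ.real (box c g k) :=
      ENNReal.toReal_pos (measure_box_ne_zero hμ hc0 hk) (measure_ne_top _ _)
    have h1 : r ^ (α - e) ≤ (2 * c : ℝ) ^ (α + 1) * u ^ (α - |e|) := by
      calc r ^ (α - e) ≤ (2 * c * u) ^ (α - e) := by
            apply Real.rpow_le_rpow hr0.le _ hαe
            nlinarith
        _ = (2 * c : ℝ) ^ (α - e) * u ^ (α - e) := Real.mul_rpow (by positivity) hu0.le
        _ ≤ _ := by
            have h2 := neg_abs_le e
            have h3 := le_abs_self e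
            apply mul_le_mul _ _ (by positivity) (by positivity)
            · exact Real.rpow_le_rpow_of_exponent_le (by linarith) (by linarith)
            · exact Real.rpow_le_rpow_of_exponent_ge hu0 hu1 (by linarith)
    calc _ = ((2 * c : ℝ) ^ (α + 1) * u ^ (α - |e|)) ^ q := by
          rw [← hu, Real.mul_rpow (y := u ^ (α - |e|)) (by positivity) (by positivity),
            ← Real.rpow_mul hu0.le, abs_of_neg hq, sub_mul, mul_neg, sub_eq_add_neg]
      _ ≤ _ := Real.rpow_le_rpow_of_nonpos hpos (hkr.trans h1) hq.le

/-! ### The upper bound for conditioned limsup sets -/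

/-- The condition on the mass of the `n`-th ball in the definition of `condLimsup`. -/
def MassCond (μ : Measure (Fin d → ℝ)) (x : ℕ → Fin d → ℝ) (lam : ℕ → ℝ) (ρ α : ℝ)
    (ε : ℕ → ℝ) (n : ℕ) : Prop :=
  lam n ^ (ρ * (α + ε n)) ≤ μ.real (Metric.closedBall (x n) (lam n ^ ρ)) ∧
    μ.real (Metric.closedBall (x n) (lam n ^ ρ)) ≤ lam n ^ (ρ * (α - ε n))

lemma mem_condLimsup {μ : Measure (Fin d → ℝ)} {x : ℕ → Fin d → ℝ} {lam : ℕ → ℝ} {ρ α : ℝ}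
    {δ ε : ℕ → ℝ} {y : Fin d → ℝ} : y ∈ condLimsup μ x lam ρ δ α ε ↔
      ∀ N, ∃ n, N ≤ n ∧ MassCond μ x lam ρ α ε n ∧ y ∈ Metric.closedBall (x n) (lam n ^ δ n) := by
  simp only [condLimsup, mem_iInter, mem_iUnion, MassCond, exists_prop]
  exact forall_congr' fun N => exists_congr fun n => by tauto

lemma lt_index_of_lt {lam : ℕ → ℝ} (hlam_anti : Antitone lam) {n N : ℕ}
    (h : lam n < lam N) : N < n := by
  by_contra hcon
  exact absurd (hlam_anti (not_lt.1 hcon)) (not_le.2 h)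

lemma finite_scaleSet {lam : ℕ → ℝ} (hlam_lim : Tendsto lam atTop (𝓝 0)) (J : ℕ) :
    (scaleSet lam J).Finite := by
  have h : (0 : ℝ) < ((2 : ℝ) ^ (J + 1))⁻¹ := by positivity
  obtain ⟨n₀, hn₀⟩ := eventually_atTop.1 (hlam_lim.eventually_lt_const h)
  refine (finite_lt_nat n₀).subset fun n hn => ?_
  by_contra hcon
  exact absurd (hn₀ n (not_lt.1 hcon)) (not_lt.2 hn.1.le)

lemma eventually_scaleSet_ge {lam : ℕ → ℝ} (hlam : ∀ n, 0 < lam n) (hlam_anti : Antitone lam)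
    (n₀ : ℕ) : ∀ᶠ J in atTop, ∀ n ∈ scaleSet lam J, n₀ ≤ n := by
  have h := (tendsto_inv_pow_atTop (c := 2) le_rfl).eventually_lt_const (hlam n₀)
  filter_upwards [h] with J hJ n hn
  push_cast at hJ
  exact (lt_index_of_lt hlam_anti (hn.2.trans_lt hJ)).le

lemma exists_mem_scaleSet {lam : ℕ → ℝ} (hlam : ∀ n, 0 < lam n)
    (hlam_lim : Tendsto lam atTop (𝓝 0)) (J₀ : ℕ) :
    ∃ N, ∀ n, N ≤ n → ∃ J, J₀ ≤ J ∧ n ∈ scaleSet lam J := by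
  have h : (0 : ℝ) < ((2 : ℝ) ^ J₀)⁻¹ := by positivity
  obtain ⟨N, hN⟩ := eventually_atTop.1 (hlam_lim.eventually_lt_const h)
  refine ⟨N, fun n hn => ?_⟩
  have h1 : lam n < ((2 : ℝ) ^ J₀)⁻¹ := hN n hn
  have h2 : ((2 : ℝ) ^ J₀)⁻¹ ≤ 1 := inv_le_one_of_one_le₀ (one_le_pow₀ (by norm_num))
  obtain ⟨J, hJ1, hJ2⟩ := exists_nat_pow_near_of_lt_one (hlam n) (h1.le.trans h2)
    (by norm_num : (0 : ℝ) < 2⁻¹) (by norm_num)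
  rw [inv_pow] at hJ1 hJ2
  refine ⟨J, ?_, hJ1, hJ2⟩
  have h3 := hJ1.trans h1
  rw [inv_lt_inv₀ (by positivity) (by positivity)] at h3
  have := (pow_lt_pow_iff_right₀ (by norm_num : (1 : ℝ) < 2)).1 h3
  omega

/-- The number of indices of a given scale satisfying the mass condition. -/
lemma exists_card_scale_le {c : ℕ} (hc : 2 ≤ c) {μ : Measure (Fin d → ℝ)} [IsFiniteMeasure μ]
    (hμ : μ.support = cube d) (hμ' : μ (cube d \ hoCube d) = 0) {ρ : ℝ} (hρ : 0 < ρ)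
    (hρ' : ρ ≤ 1) {α β : ℝ} (hα : 0 < α) (hβ : 0 < β) (hβτ : tauStar c μ α = (β : EReal))
    {x : ℕ → Fin d → ℝ} (hx : ∀ n, x n ∈ cube d) {lam : ℕ → ℝ} (hlam : ∀ n, 0 < lam n)
    (hlam_anti : Antitone lam) (hlam_lim : Tendsto lam atTop (𝓝 0))
    (hred : WeaklyRedundant x lam) {ε : ℕ → ℝ} (hε : Tendsto ε atTop (𝓝 0)) {η : ℝ}
    (hη : 0 < η) : ∃ S : ℕ → Finset ℕ,
      (∀ J n, n ∈ S J ↔ n ∈ scaleSet lam J ∧ MassCond μ x lam ρ α ε n) ∧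
      ∀ᶠ J : ℕ in atTop, ((S J).card : ℝ) ≤
        (2 : ℝ) ^ (J * (d * (1 - ρ) + ρ * β + 4 * η)) := by
  classical
  have hc0 : 0 < c := by omega
  have hc1 : (1 : ℝ) ≤ c := by exact_mod_cast hc0
  have hcR : (0 : ℝ) < c := by linarith
  have hfinS : ∀ J, {n | n ∈ scaleSet lam J ∧ MassCond μ x lam ρ α ε n}.Finite := fun J =>
    (finite_scaleSet hlam_lim J).subset fun n hn => hn.1
  refine ⟨fun J => (hfinS J).toFinset, fun J n => by simp, ?_⟩
  -- The final `4 * η` is spent as follows: one `η` on the moment bound, one on `|ε n| * |q|`, one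
  -- on `N J`, one on the constants.
  obtain ⟨q, hq⟩ := exists_moment_bound hc hμ hβτ hη
  obtain ⟨j₀, hj₀⟩ := eventually_atTop.1 hq
  obtain ⟨C, κ, hC, hκ, hnear⟩ := exists_box_near_ball hc hμ hμ' (α := α) q
  obtain ⟨N, hN, hT⟩ := hred
  have hlimρ : Tendsto (fun J : ℕ => ((2 : ℝ) ^ J)⁻¹ ^ ρ) atTop (𝓝 0) := by
    have h := ((Real.continuousAt_rpow_const (0 : ℝ) ρ (Or.inr hρ.le)).tendsto).comp
      (tendsto_inv_pow_atTop (c := 2) le_rfl)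
    rw [Real.zero_rpow hρ.ne'] at h
    simpa [Function.comp_def] using h
  have ev1 : ∀ᶠ J : ℕ in atTop, ((2 : ℝ) ^ J)⁻¹ ^ ρ < 1 / 2 :=
    hlimρ.eventually_lt_const (by norm_num)
  have ev2 : ∀ᶠ J : ℕ in atTop, ((2 : ℝ) ^ J)⁻¹ ^ ρ < ((c : ℝ) ^ j₀)⁻¹ / C :=
    hlimρ.eventually_lt_const (by positivity)
  have ev3 : ∀ᶠ J : ℕ in atTop, ∀ n ∈ scaleSet lam J, |ε n| ≤ α ∧ |ε n| ≤ 1 ∧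
      |ε n| * |q| ≤ η := by
    have habs : Tendsto (fun n => |ε n|) atTop (𝓝 0) := by simpa using hε.abs
    have h1 := habs.eventually_lt_const hα
    have h2 := habs.eventually_lt_const one_pos
    have h3 : ∀ᶠ n in atTop, |ε n| * |q| < η := by
      have := habs.mul_const |q|
      rw [zero_mul] at this
      exact this.eventually_lt_const hη
    obtain ⟨n₀, hn₀⟩ := eventually_atTop.1 (h1.and (h2.and h3))
    filter_upwards [eventually_scaleSet_ge hlam hlam_anti n₀] with J hJ n hn
    obtain ⟨a1, a2, a3⟩ := hn₀ n (hJ n hn)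
    exact ⟨a1.le, a2.le, a3.le⟩
  have ev4 : ∀ᶠ J : ℕ in atTop, (N J : ℝ) ≤ (2 : ℝ) ^ (J * η) := by
    have hlog : 0 < η * Real.log 2 := mul_pos hη (Real.log_pos (by norm_num))
    filter_upwards [hN.eventually_lt_const hlog, eventually_gt_atTop 0] with J hJ hJ0
    have hJR : (0 : ℝ) < J := by exact_mod_cast hJ0
    rcases Nat.eq_zero_or_pos (N J) with h0 | h0
    · rw [h0]; simp only [Nat.cast_zero]; positivity
    · have hNR : (0 : ℝ) < N J := by exact_mod_cast h0
      rw [div_lt_iff₀ hJR] at hJ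
      rw [← Real.log_le_log_iff hNR (by positivity), Real.log_rpow (by norm_num)]
      linarith
  set const : ℝ := (2 + 2 * C) ^ d * (κ⁻¹ * C ^ (β + 2 * η)) with hconst
  have ev5 : ∀ᶠ J : ℕ in atTop, const ≤ (2 : ℝ) ^ (J * η) := by
    have h1 : Tendsto (fun J : ℕ => (2 : ℝ) ^ (J * η)) atTop atTop := by
      have h2 : (1 : ℝ) < 2 ^ η := Real.one_lt_rpow (by norm_num) hη
      refine (tendsto_pow_atTop_atTop_of_one_lt h2).congr fun J => ?_
      rw [← Real.rpow_natCast, ← Real.rpow_mul (by norm_num), mul_comm]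
    exact h1.eventually_ge_atTop const
  filter_upwards [ev1, ev2, ev3, ev4, ev5, eventually_ge_atTop 1] with J h1 h2 h3 h4 h5 hJ
  set h : ℝ := ((2 : ℝ) ^ J)⁻¹ ^ ρ with hh
  have hh0 : 0 < h := by positivity
  have hh2 : h = (2 : ℝ) ^ (-(J * ρ)) := inv_two_pow_rpow J ρ
  obtain ⟨g, hg1, hg2, hbox⟩ := hnear h hh0 h1.le
  have hgj : j₀ ≤ g := by
    have h6 : ((c : ℝ) ^ g)⁻¹ < ((c : ℝ) ^ j₀)⁻¹ := by
      refine hg1.trans_lt ?_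
      rw [lt_div_iff₀ (by linarith)] at h2
      linarith
    rw [inv_lt_inv₀ (by positivity) (by positivity)] at h6
    have := (pow_lt_pow_iff_right₀ (by exact_mod_cast hc : (1 : ℝ) < c)).1 h6
    omega
  set S := (hfinS J).toFinset with hS
  have hSmem : ∀ n ∈ S, n ∈ scaleSet lam J ∧ MassCond μ x lam ρ α ε n := fun n hn => by
    simpa [hS] using hn
  set u : ℝ := ((c : ℝ) ^ g)⁻¹ with hu
  have hu0 : 0 < u := by positivity
  have hu1 : u ≤ 1 := inv_le_one_of_one_le₀ (one_le_pow₀ hc1)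
  have hk : ∀ n ∈ S, ∃ k ∈ grid d c g, box c g k ⊆ Metric.closedBall (x n) (C * h) ∧
      κ * u ^ (α * q + η) ≤ μ.real (box c g k) ^ q := by
    intro n hn
    obtain ⟨hn1, hn2⟩ := hSmem n hn
    obtain ⟨a1, a2, a3⟩ := h3 n hn1
    have hl := hlam n
    obtain ⟨k, hk1, hk2, hk3⟩ := hbox (x n) (hx n) (lam n ^ ρ) (by
        have e1 : h / 2 ≤ (((2 : ℝ) ^ (J + 1))⁻¹) ^ ρ := by
          rw [pow_succ, mul_inv, Real.mul_rpow (by positivity) (by norm_num), ← hh,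
            div_eq_mul_inv]
          gcongr
          have := Real.rpow_le_rpow_of_exponent_ge (by norm_num : (0 : ℝ) < 2⁻¹) (by norm_num) hρ'
          simpa using this
        exact e1.trans (Real.rpow_le_rpow (by positivity) hn1.1.le hρ.le))
      (Real.rpow_le_rpow hl.le hn1.2 hρ.le) (ε n) a1 a2
      (by rw [← Real.rpow_mul hl.le]; exact hn2.1) (by rw [← Real.rpow_mul hl.le]; exact hn2.2)
    refine ⟨k, hk1, hk2, le_trans ?_ hk3⟩
    refine mul_le_mul_of_nonneg_left ?_ hκ.le
    exact Real.rpow_le_rpow_of_exponent_ge hu0 hu1 (by linarith)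
  choose! k hkg hkb hkμ using hk
  -- Each selected box contributes at least `κ * u ^ (α * q + η)` to the moment sum. Dividing
  -- eliminates `q` and leaves a multiple of `u⁻¹ ^ (β + 2 * η)`, with `u⁻¹` at most a multiple of
  -- `2 ^ (J * ρ)`.
  have himage : ((S.image k).card : ℝ) ≤ κ⁻¹ * C ^ (β + 2 * η) * 2 ^ (J * (ρ * β + 2 * η)) := by
    have hsum : ((S.image k).card : ℝ) * (κ * u ^ (α * q + η)) ≤ u⁻¹ ^ (β + η - α * q) := by
      have hinj : Function.Injective
          (fun (f : Fin d → Fin (c ^ g)) => (fun i => (f i : ℕ) : Fin d → ℕ)) := by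
        intro f f' hff
        funext i
        exact Fin.ext (congrFun hff i)
      calc ((S.image k).card : ℝ) * (κ * u ^ (α * q + η))
          = ∑ _k ∈ S.image k, κ * u ^ (α * q + η) := by simp
        _ ≤ ∑ k' ∈ S.image k, μ.real (box c g k') ^ q := by
            refine Finset.sum_le_sum fun k' hk' => ?_
            obtain ⟨n, hn, rfl⟩ := Finset.mem_image.1 hk'
            exact hkμ n hn
        _ ≤ ∑ k' ∈ Finset.univ.image
              (fun (f : Fin d → Fin (c ^ g)) => (fun i => (f i : ℕ) : Fin d → ℕ)),
              μ.real (box c g k') ^ q := by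
            refine Finset.sum_le_sum_of_subset_of_nonneg (fun k' hk' => ?_) fun _ _ _ => by
              positivity
            obtain ⟨n, hn, rfl⟩ := Finset.mem_image.1 hk'
            exact Finset.mem_image.2 ⟨fun i => ⟨k n i, hkg n hn i⟩, Finset.mem_univ _, rfl⟩
        _ = ∑ f : Fin d → Fin (c ^ g), μ.real (box c g (fun i => (f i : ℕ))) ^ q :=
            Finset.sum_image fun _ _ _ _ hff => hinj hff
        _ ≤ u⁻¹ ^ (β + η - α * q) := by
            rw [hu, inv_inv]
            exact hj₀ g hgj
    have hpos : 0 < κ * u ^ (α * q + η) := by positivity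
    rw [← le_div_iff₀ hpos] at hsum
    refine hsum.trans ?_
    have huC : u⁻¹ ≤ C * 2 ^ (J * ρ) := by
      rw [inv_le_comm₀ hu0 (by positivity), mul_inv, ← Real.rpow_neg (by norm_num), ← hh2,
        inv_mul_le_iff₀ (by linarith)]
      exact hg2
    calc u⁻¹ ^ (β + η - α * q) / (κ * u ^ (α * q + η))
        = κ⁻¹ * u⁻¹ ^ (β + 2 * η) := by
          rw [div_eq_mul_inv, mul_inv, ← Real.inv_rpow hu0.le, mul_left_comm,
            ← Real.rpow_add (by positivity)]
          ring_nf
      _ ≤ κ⁻¹ * (C * 2 ^ (J * ρ)) ^ (β + 2 * η) := by gcongr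
      _ = κ⁻¹ * C ^ (β + 2 * η) * 2 ^ (J * ρ * (β + 2 * η)) := by
          rw [Real.mul_rpow (by linarith) (by positivity), ← Real.rpow_mul (by norm_num)]
          ring
      _ ≤ _ := by
          have hJ0 : (0 : ℝ) ≤ J := by positivity
          have : ρ * η ≤ η := by nlinarith
          rw [mul_assoc (J : ℝ)]
          exact mul_le_mul_of_nonneg_left (Real.rpow_le_rpow_of_exponent_le (by norm_num)
            (mul_le_mul_of_nonneg_left (by linarith) hJ0)) (by positivity)
  obtain ⟨T, hTU, -, hTd⟩ := hT J hJ
  -- Within one class, the balls assigned to the same box are disjoint, have radius at least `2 ^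
  -- (-(J + 1))`, and have centres within `C * h` of the corner of that box.
  have hfiber : ∀ i, ∀ k' ∈ (S.filter (· ∈ T i)).image k,
      (((S.filter (· ∈ T i)).filter (fun n => k n = k')).card : ℝ) ≤
        (2 + 2 * C) ^ d * 2 ^ (J * (d * (1 - ρ))) := by
    intro i k' _
    have hpos : (0 : ℝ) < ((c : ℝ) ^ g)⁻¹ := by positivity
    have hcard := card_le_of_disjoint_balls ((S.filter (· ∈ T i)).filter (fun n => k n = k'))
      x lam (a := ((2 : ℝ) ^ (J + 1))⁻¹) (v := C * h) (by positivity) (by positivity)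
      (fun n hn => by
        simp only [Finset.mem_filter] at hn
        exact (hSmem n hn.1.1).1.1.le)
      ((hTd i).subset fun n hn => by
        simp only [Finset.coe_filter, Finset.mem_filter, mem_ofPred_eq] at hn
        exact hn.1.2)
      _ (fun n hn => by
        simp only [Finset.mem_filter] at hn
        have hb := hkb n hn.1.1
        rw [hn.2] at hb
        refine ⟨x n, Metric.mem_closedBall_self (hlam n).le, ?_⟩
        have := hb (corner_add_mem_box hc0 g k' le_rfl hpos)
        rw [Metric.mem_closedBall, dist_comm] at this
        exact this)
    refine hcard.trans ?_
    have e1 : C * h / ((2 : ℝ) ^ (J + 1))⁻¹ = 2 * C * 2 ^ (J * (1 - ρ)) := by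
      rw [hh2, div_inv_eq_mul, pow_succ, ← Real.rpow_natCast,
        show (J : ℝ) * (1 - ρ) = -(J * ρ) + J by ring, Real.rpow_add (by norm_num)]
      ring
    have e2 : (1 : ℝ) ≤ 2 ^ (J * (1 - ρ)) :=
      Real.one_le_rpow (by norm_num) (mul_nonneg (by positivity) (by linarith))
    rw [e1]
    calc (2 + 2 * C * 2 ^ (J * (1 - ρ))) ^ d ≤ ((2 + 2 * C) * 2 ^ (J * (1 - ρ))) ^ d := by
          gcongr
          nlinarith
      _ = _ := by
          rw [mul_pow, ← Real.rpow_natCast (2 ^ (J * (1 - ρ))), ← Real.rpow_mul (by norm_num)]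
          ring_nf
  have hTi : ∀ i, ((S.filter (· ∈ T i)).card : ℝ) ≤ const * 2 ^ (J * (d * (1 - ρ) + ρ * β + 2 * η)) := by
    intro i
    have h6 := Finset.card_le_mul_card_image (f := k) (S.filter (· ∈ T i))
      ⌊(2 + 2 * C) ^ d * (2 : ℝ) ^ (J * (d * (1 - ρ)))⌋₊ fun k' hk' => Nat.le_floor (hfiber i k' hk')
    have h7 : ((S.filter (· ∈ T i)).card : ℝ) ≤
        ⌊(2 + 2 * C) ^ d * (2 : ℝ) ^ (J * (d * (1 - ρ)))⌋₊ * ((S.filter (· ∈ T i)).image k).card := by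
      exact_mod_cast h6
    have h8 : (((S.filter (· ∈ T i)).image k).card : ℝ) ≤ (S.image k).card := by
      exact_mod_cast Finset.card_le_card (Finset.image_subset_image (Finset.filter_subset _ _))
    calc _ ≤ _ := h7
      _ ≤ ((2 + 2 * C) ^ d * (2 : ℝ) ^ (J * (d * (1 - ρ)))) *
          (κ⁻¹ * C ^ (β + 2 * η) * 2 ^ (J * (ρ * β + 2 * η))) := by
          gcongr
          · exact Nat.floor_le (by positivity)
          · exact h8.trans himage
      _ = const * ((2 : ℝ) ^ (J * (d * (1 - ρ))) * 2 ^ (J * (ρ * β + 2 * η))) := by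
          rw [hconst]; ring
      _ = _ := by
          rw [← Real.rpow_add (by norm_num)]
          ring_nf
  have hcover : S ⊆ Finset.univ.biUnion fun i => S.filter (· ∈ T i) := by
    intro n hn
    have : n ∈ ⋃ i, T i := by rw [hTU]; exact (hSmem n hn).1
    obtain ⟨i, hi⟩ := mem_iUnion.1 this
    exact Finset.mem_biUnion.2 ⟨i, Finset.mem_univ _, Finset.mem_filter.2 ⟨hn, hi⟩⟩
  calc (S.card : ℝ) ≤ ∑ i : Fin (N J), ((S.filter (· ∈ T i)).card : ℝ) := by
        exact_mod_cast (Finset.card_le_card hcover).trans Finset.card_biUnion_le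
    _ ≤ ∑ _i : Fin (N J), const * 2 ^ (J * (d * (1 - ρ) + ρ * β + 2 * η)) :=
        Finset.sum_le_sum fun i _ => hTi i
    _ = N J * (const * 2 ^ (J * (d * (1 - ρ) + ρ * β + 2 * η))) := by simp
    _ ≤ 2 ^ (J * η) * (2 ^ (J * η) * 2 ^ (J * (d * (1 - ρ) + ρ * β + 2 * η))) := by gcongr
    _ = _ := by
        rw [← Real.rpow_add (by norm_num), ← Real.rpow_add (by norm_num)]
        ring_nf

/-- The upper bound for the dimension of a conditioned limsup set. -/
theorem dimH_condLimsup_le {c : ℕ} (hc : 2 ≤ c) {μ : Measure (Fin d → ℝ)} [IsFiniteMeasure μ]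
    (hμ : μ.support = cube d) (hμ' : μ (cube d \ hoCube d) = 0) {ρ : ℝ} (hρ : 0 < ρ)
    (hρ' : ρ ≤ 1) {α β : ℝ} (hα : 0 < α) (hβ : 0 < β) (hβτ : tauStar c μ α = (β : EReal))
    {x : ℕ → Fin d → ℝ} (hx : ∀ n, x n ∈ cube d) {lam : ℕ → ℝ} (hlam : ∀ n, 0 < lam n)
    (hlam_anti : Antitone lam) (hlam_lim : Tendsto lam atTop (𝓝 0))
    (hred : WeaklyRedundant x lam) {ε : ℕ → ℝ} (hε : Tendsto ε atTop (𝓝 0))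
    {δ : ℝ} (hδ : 0 < δ) {δhat : ℕ → ℝ} (hδhat : Tendsto δhat atTop (𝓝 δ)) :
    dimH (condLimsup μ x lam ρ δhat α ε) ≤ ENNReal.ofReal ((d * (1 - ρ) + ρ * β) / δ) := by
  have he : 0 ≤ (d : ℝ) * (1 - ρ) + ρ * β := by
    have : 0 ≤ (d : ℝ) * (1 - ρ) := mul_nonneg (by positivity) (by linarith)
    positivity
  have hmain : ∀ η, 0 < η → ∀ δ', 0 < δ' → δ' < δ → dimH (condLimsup μ x lam ρ δhat α ε) ≤
      ENNReal.ofReal ((d * (1 - ρ) + ρ * β + 4 * η) / δ') := by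
    intro η hη δ' hδ' hδδ'
    obtain ⟨S, hS, hcard⟩ := exists_card_scale_le hc hμ hμ' hρ hρ' hα hβ hβτ hx hlam hlam_anti
      hlam_lim hred hε hη
    refine dimH_le_of_card_le _ x (fun n => lam n ^ δhat n) S (fun y hy J₀ => ?_) (by positivity)
      hδ' hcard ?_
    · obtain ⟨N, hN⟩ := exists_mem_scaleSet hlam hlam_lim J₀
      obtain ⟨n, hn, hn1, hn2⟩ := mem_condLimsup.1 hy N
      obtain ⟨J, hJ, hJn⟩ := hN n hn
      exact ⟨J, hJ, n, (hS J n).2 ⟨hJn, hn1⟩, hn2⟩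
    · obtain ⟨n₀, hn₀⟩ := eventually_atTop.1 (hδhat.eventually_const_lt hδδ')
      filter_upwards [eventually_scaleSet_ge hlam hlam_anti n₀] with J hJ n hn
      have hn' := ((hS J n).1 hn).1
      have h1 := hn₀ n (hJ n hn')
      have h2 : ((2 : ℝ) ^ J)⁻¹ ≤ 1 := inv_le_one_of_one_le₀ (one_le_pow₀ (by norm_num))
      calc lam n ^ δhat n ≤ lam n ^ δ' :=
            Real.rpow_le_rpow_of_exponent_ge (hlam n) (hn'.2.trans h2) h1.le
        _ ≤ _ := Real.rpow_le_rpow (hlam n).le hn'.2 hδ'.le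
  have hlim : Tendsto (fun η : ℝ => ENNReal.ofReal
      ((d * (1 - ρ) + ρ * β + 4 * η) / (δ - η))) (𝓝[>] 0)
      (𝓝 (ENNReal.ofReal ((d * (1 - ρ) + ρ * β) / δ))) := by
    refine (ENNReal.continuous_ofReal.tendsto _).comp ?_
    have h1 : ContinuousAt (fun η : ℝ => (d * (1 - ρ) + ρ * β + 4 * η) / (δ - η)) 0 :=
      ContinuousAt.div (by fun_prop) (by fun_prop) (by simpa using hδ.ne')
    have h2 := h1.tendsto
    simp only [mul_zero, add_zero, sub_zero] at h2
    exact h2.mono_left nhdsWithin_le_nhds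
  refine ge_of_tendsto hlim ?_
  filter_upwards [Ioo_mem_nhdsGT hδ] with η hη
  exact hmain η hη.1 (δ - η) (by linarith [hη.2]) (by linarith [hη.1])

/-! ### The mass condition along balls close to typical points -/

/-- The logarithm equals log M / log r + A (log 2 / log r + 1), and constants disappear because log
r → -∞. -/
lemma tendsto_logb_mul_rpow {r A : ℕ → ℝ} {α M : ℝ} (hM : 0 < M) (hr : ∀ n, 0 < r n)
    (hr0 : Tendsto r atTop (𝓝 0)) (hA : Tendsto A atTop (𝓝 α)) :
    Tendsto (fun n => Real.logb (r n) (M * (2 * r n) ^ A n)) atTop (𝓝 α) := by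
  have hlog : Tendsto (fun n => Real.log (r n)) atTop atBot :=
    Real.tendsto_log_nhdsGT_zero.comp
      (tendsto_nhdsWithin_iff.2 ⟨hr0, Eventually.of_forall hr⟩)
  have h1 : Tendsto (fun n => Real.log M / Real.log (r n)) atTop (𝓝 0) :=
    hlog.const_div_atBot _
  have h2 : Tendsto (fun n => Real.log 2 / Real.log (r n)) atTop (𝓝 0) :=
    hlog.const_div_atBot _
  have h3 : Tendsto (fun n => Real.log M / Real.log (r n) +
      A n * (Real.log 2 / Real.log (r n) + 1)) atTop (𝓝 (0 + α * (0 + 1))) :=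
    h1.add (hA.mul (h2.add_const 1))
  simp only [zero_add, mul_one] at h3
  refine h3.congr' ?_
  filter_upwards [hlog.eventually_lt_atBot 0] with n hn
  have hrn := hr n
  rw [Real.logb, Real.log_mul hM.ne' (by positivity), Real.log_rpow (by positivity),
    Real.log_mul (by norm_num) hrn.ne']
  field_simp [hn.ne]

lemma tendsto_epsSeq {lam : ℕ → ℝ} (hlam : ∀ n, 0 < lam n) (hlam_lim : Tendsto lam atTop (𝓝 0))
    {ρ α M : ℝ} (hρ : 0 < ρ) (hM : 0 < M) {ψ χ : ℝ → ℝ} (hψ : Tendsto ψ (𝓝[≥] 0) (𝓝 0))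
    (hχ : Tendsto χ (𝓝[≥] 0) (𝓝 0)) :
    Tendsto (epsSeq lam ρ α ψ χ M) atTop (𝓝 0) := by
  have hr : ∀ n, 0 < lam n ^ ρ := fun n => Real.rpow_pos_of_pos (hlam n) _
  have hr0 : Tendsto (fun n => lam n ^ ρ) atTop (𝓝 0) := by
    have h := ((Real.continuousAt_rpow_const (0 : ℝ) ρ (Or.inr hρ.le)).tendsto).comp hlam_lim
    rwa [Real.zero_rpow hρ.ne'] at h
  have h2r : Tendsto (fun n => 2 * lam n ^ ρ) atTop (𝓝[≥] 0) := by
    refine tendsto_nhdsWithin_iff.2 ⟨by simpa using hr0.const_mul 2,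
      Eventually.of_forall fun n => mem_Ici.2 (by have := hr n; positivity)⟩
  have hψ' := hψ.comp h2r
  have hχ' := (hχ.comp h2r).const_mul (2 * α)
  have hA : Tendsto (fun n => α - ψ (2 * lam n ^ ρ) - 2 * α * χ (2 * lam n ^ ρ)) atTop (𝓝 α) := by
    simpa using (hψ'.const_sub α).sub hχ'
  have hB : Tendsto (fun n => α + ψ (2 * lam n ^ ρ) + 2 * α * χ (2 * lam n ^ ρ)) atTop (𝓝 α) := by
    simpa using (hψ'.const_add α).add hχ'
  have h1 := (tendsto_logb_mul_rpow hM hr hr0 hA).const_sub α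
  have h2 := (tendsto_logb_mul_rpow (inv_pos.2 hM) hr hr0 hB).sub_const α
  rw [sub_self] at h1 h2
  have h3 := h1.max h2
  rw [max_self] at h3
  exact h3

/-- The two terms of the maximum turn the bounds with `M` into exact powers of `r`. As `r < 1`,
replacing either term by the maximum only weakens the corresponding inequality. -/
lemma massCond_epsSeq {μ : Measure (Fin d → ℝ)} {x : ℕ → Fin d → ℝ} {lam : ℕ → ℝ}
    {ρ α M : ℝ} (hM : 0 < M) {ψ χ : ℝ → ℝ} {n : ℕ} (hlam : 0 < lam n) {r : ℝ}
    (hr : r = lam n ^ ρ) (hr1 : r < 1)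
    (hlow : M⁻¹ * (2 * r) ^ (α + ψ (2 * r) + 2 * α * χ (2 * r)) ≤
      μ.real (Metric.closedBall (x n) r))
    (hup : μ.real (Metric.closedBall (x n) r) ≤
      M * (2 * r) ^ (α - ψ (2 * r) - 2 * α * χ (2 * r))) :
    MassCond μ x lam ρ α (epsSeq lam ρ α ψ χ M) n := by
  have hr0 : 0 < r := by rw [hr]; exact Real.rpow_pos_of_pos hlam _
  unfold MassCond
  rw [Real.rpow_mul hlam.le, Real.rpow_mul hlam.le, ← hr]
  have h1 : α - Real.logb r (M * (2 * r) ^ (α - ψ (2 * r) - 2 * α * χ (2 * r))) ≤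
      epsSeq lam ρ α ψ χ M n := by
    unfold epsSeq; rw [← hr]; exact le_max_left _ _
  have h2 : Real.logb r (M⁻¹ * (2 * r) ^ (α + ψ (2 * r) + 2 * α * χ (2 * r))) - α ≤
      epsSeq lam ρ α ψ χ M n := by
    unfold epsSeq; rw [← hr]; exact le_max_right _ _
  constructor
  · refine le_trans ?_ hlow
    rw [← Real.rpow_logb hr0 hr1.ne (by positivity :
      0 < M⁻¹ * (2 * r) ^ (α + ψ (2 * r) + 2 * α * χ (2 * r)))]
    exact Real.rpow_le_rpow_of_exponent_ge hr0 hr1.le (by linarith)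
  · refine hup.trans ?_
    rw [← Real.rpow_logb hr0 hr1.ne (by positivity :
      0 < M * (2 * r) ^ (α - ψ (2 * r) - 2 * α * χ (2 * r)))]
    exact Real.rpow_le_rpow_of_exponent_ge hr0 hr1.le (by linarith)

lemma generation_ge_of_lt {c : ℕ} (hc : 2 ≤ c) {i j : ℕ}
    (h : ((c : ℝ) ^ j)⁻¹ < ((c : ℝ) ^ i)⁻¹) : i < j := by
  have hc1 : (1 : ℝ) < c := by exact_mod_cast hc
  rw [inv_lt_inv₀ (by positivity) (by positivity)] at h
  exact (pow_lt_pow_iff_right₀ hc1).1 h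

/-- Near a point where `μ` obeys the local scaling, balls not too far from the point have
controlled mass. -/
lemma exists_mass_bounds (hd : 1 ≤ d) {c : ℕ} (hc : 2 ≤ c) {μ : Measure (Fin d → ℝ)}
    [IsFiniteMeasure μ] (hμh : μ (hoCube d)ᶜ = 0) {α ρ : ℝ} (hα : 0 < α) (hρ : 0 < ρ)
    {ψ χ : ℝ → ℝ} (hψ : IsGaugeExponent ψ) (hχ : ∀ r, 0 ≤ r → 0 ≤ χ r) :
    ∃ M : ℝ, 1 ≤ M ∧ ∀ y ∈ hoCube d, (∃ j₀ : ℕ, ∀ j : ℕ, j₀ ≤ j →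
      ∀ k ∈ nbrs c j y, PBound μ α ψ (box c j k)) → ∃ r₀ > 0, ∀ r, 0 < r → r < r₀ →
        ∀ z, dist z y ≤ 2 ^ (-ρ) * r →
          M⁻¹ * (2 * r) ^ (α + ψ (2 * r) + 2 * α * χ (2 * r)) ≤ μ.real (Metric.closedBall z r) ∧
          μ.real (Metric.closedBall z r) ≤
            M * (2 * r) ^ (α - ψ (2 * r) - 2 * α * χ (2 * r)) := by
  have hc0 : 0 < c := by omega
  have hc1 : (1 : ℝ) < c := by exact_mod_cast hc
  have hcR : (0 : ℝ) < c := by linarith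
  -- A centre at distance at most `2 ^ (-ρ) * r` from `y` leaves room `θ * r` around `y` inside the
  -- ball, enough for a box containing `y`.
  set θ : ℝ := 1 - 2 ^ (-ρ) with hθ
  have h2ρ : (2 : ℝ) ^ (-ρ) < 1 := Real.rpow_lt_one_of_one_lt_of_neg (by norm_num) (by linarith)
  have h2ρ0 : (0 : ℝ) < 2 ^ (-ρ) := by positivity
  have hθ0 : 0 < θ := by linarith
  have hθ1 : θ < 1 := by linarith
  set M₁ : ℝ := 3 ^ d * c ^ α with hM₁
  set M₂ : ℝ := ((θ / (2 * c)) ^ (α + 1))⁻¹ with hM₂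
  have hM₂0 : 0 < M₂ := by positivity
  have hMmax : M₂ ≤ max 1 (max M₁ M₂) := (le_max_right _ _).trans (le_max_right _ _)
  have hMmax' : M₁ ≤ max 1 (max M₁ M₂) := (le_max_left _ _).trans (le_max_right _ _)
  have hMpos : 0 < max 1 (max M₁ M₂) := lt_of_lt_of_le one_pos (le_max_left _ _)
  refine ⟨max 1 (max M₁ M₂), le_max_left _ _, fun y hy ⟨j₀, hj₀⟩ => ?_⟩
  obtain ⟨rψ, hrψ, hanti⟩ := hψ.anti
  have hψ1 : ∀ᶠ u in 𝓝[≥] (0 : ℝ), ψ u < 1 := hψ.tendsto.eventually_lt_const one_pos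
  obtain ⟨u₀, hu₀, hu⟩ := mem_nhdsGE_iff_exists_Ico_subset.1 hψ1
  have hu₀' : (0 : ℝ) < u₀ := hu₀
  set r₀ : ℝ := min (min (rψ / (2 * c)) (u₀ / 2)) (min (1 / 2) (((c : ℝ) ^ j₀)⁻¹ / (2 * c)))
    with hr₀
  refine ⟨r₀, by positivity, fun r hr hrr z hz => ?_⟩
  have hr1 : 2 * c * r < rψ := by
    have : r < rψ / (2 * c) := hrr.trans_le ((min_le_left _ _).trans (min_le_left _ _))
    rw [lt_div_iff₀ (by positivity)] at this; linarith
  have hr2 : 2 * r < u₀ := by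
    have : r < u₀ / 2 := hrr.trans_le ((min_le_left _ _).trans (min_le_right _ _))
    linarith
  have hr3 : 2 * r < 1 := by
    have : r < 1 / 2 := hrr.trans_le ((min_le_right _ _).trans (min_le_left _ _))
    linarith
  have hr4 : 2 * c * r < ((c : ℝ) ^ j₀)⁻¹ := by
    have : r < ((c : ℝ) ^ j₀)⁻¹ / (2 * c) :=
      hrr.trans_le ((min_le_right _ _).trans (min_le_right _ _))
    rw [lt_div_iff₀ (by positivity)] at this; linarith
  have h2r : 0 < 2 * r := by positivity
  have hχr : 0 ≤ 2 * α * χ (2 * r) := mul_nonneg (by positivity) (hχ _ h2r.le)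
  have hψr : 0 ≤ ψ (2 * r) := hψ.nonneg h2r.le
  have hψr1 : ψ (2 * r) < 1 := hu ⟨h2r.le, hr2⟩
  constructor
  · obtain ⟨j, hj1, hj2⟩ := exists_generation hc (r := θ * r) (by positivity) (by nlinarith)
    set u : ℝ := ((c : ℝ) ^ j)⁻¹ with hudef
    have hu0 : 0 < u := by positivity
    have huθ : u ≤ θ * r := hj1
    have hu2r : u ≤ 2 * r := by nlinarith
    have hu1 : u ≤ 1 := by linarith
    have hjj₀ : j₀ ≤ j := (generation_ge_of_lt hc (lt_of_le_of_lt (by nlinarith) hr4)).le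
    have hself : boxIdx c j y ∈ nbrs c j y :=
      boxIdx_mem_nbrs hc0 hy hy (by rw [dist_self]; positivity)
    have hP := (hj₀ j hjj₀ _ hself).1
    rw [diam_box hd hc0] at hP
    have hsub : box c j (boxIdx c j y) ⊆ Metric.closedBall z r := by
      intro w hw
      have h1 := dist_le_of_mem_box hc0 hw (mem_box_boxIdx hc0 j fun i => (hy i).1)
      have h2 := dist_triangle w y z
      rw [dist_comm] at hz
      rw [Metric.mem_closedBall]
      have e : θ * r = r - 2 ^ (-ρ) * r := by rw [hθ]; ring
      linarith
    refine le_trans ?_ (hP.trans (measureReal_mono hsub))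
    have hψu : ψ u ≤ ψ (2 * r) := hψ.mono (mem_Ici.2 hu0.le) (mem_Ici.2 h2r.le) hu2r
    have hle : θ / (2 * c) * (2 * r) ≤ u := by
      rw [div_mul_eq_mul_div, div_le_iff₀ (by positivity)]
      nlinarith
    have hθc : θ / (2 * c) ≤ 1 := by rw [div_le_one (by positivity)]; linarith
    have hθc0 : 0 < θ / (2 * c) := by positivity
    calc (max 1 (max M₁ M₂))⁻¹ * (2 * r) ^ (α + ψ (2 * r) + 2 * α * χ (2 * r))
        ≤ M₂⁻¹ * (2 * r) ^ (α + ψ (2 * r)) := by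
          apply mul_le_mul (inv_anti₀ hM₂0 hMmax) _ (by positivity) (by positivity)
          exact Real.rpow_le_rpow_of_exponent_ge h2r hr3.le (by linarith)
      _ ≤ (θ / (2 * c)) ^ (α + ψ (2 * r)) * (2 * r) ^ (α + ψ (2 * r)) := by
          rw [hM₂, inv_inv]
          refine mul_le_mul_of_nonneg_right ?_ (by positivity)
          exact Real.rpow_le_rpow_of_exponent_ge hθc0 hθc (by linarith)
      _ = (θ / (2 * c) * (2 * r)) ^ (α + ψ (2 * r)) := (Real.mul_rpow hθc0.le h2r.le).symm
      _ ≤ u ^ (α + ψ (2 * r)) := Real.rpow_le_rpow (by positivity) hle (by linarith)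
      _ ≤ u ^ (α + ψ u) := Real.rpow_le_rpow_of_exponent_ge hu0 hu1 (by linarith)
  · obtain ⟨j, hj1, hj2⟩ := exists_generation_ge hc h2r hr3.le
    set u : ℝ := ((c : ℝ) ^ j)⁻¹ with hudef
    have hu0 : 0 < u := by positivity
    have huc : u ≤ 2 * c * r := by linarith
    have hjj₀ : j₀ ≤ j := (generation_ge_of_lt hc (lt_of_le_of_lt (by linarith) hr4)).le
    have hsub : Metric.closedBall z r ⊆ Metric.closedBall y (2 * r) := by
      apply Metric.closedBall_subset_closedBall'
      nlinarith
    have hball := measureReal_closedBall_le_of_nbrs (A := u ^ (α - ψ u)) hc0 μ hμh hy hj1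
      (by positivity) fun k hk => by
        have := (hj₀ j hjj₀ k hk).2
        rwa [diam_box hd hc0] at this
    refine (measureReal_mono hsub).trans (hball.trans ?_)
    -- Since `2 * r ≤ u`, monotonicity of `ψ` goes the wrong way here; the assumed monotonicity of
    -- `r ↦ r ^ (-ψ r)` is what transfers the bound.
    have ha : u ^ (-ψ u) ≤ (2 * r) ^ (-ψ (2 * r)) :=
      hanti ⟨h2r, by nlinarith⟩ ⟨hu0, by linarith⟩ hj1
    calc 3 ^ d * u ^ (α - ψ u) = 3 ^ d * (u ^ α * u ^ (-ψ u)) := by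
          rw [sub_eq_add_neg, Real.rpow_add hu0]
      _ ≤ 3 ^ d * ((c * (2 * r)) ^ α * (2 * r) ^ (-ψ (2 * r))) := by
          gcongr
      _ = M₁ * (2 * r) ^ (α - ψ (2 * r)) := by
          rw [Real.mul_rpow hcR.le h2r.le, sub_eq_add_neg, Real.rpow_add h2r, hM₁]
          ring
      _ ≤ _ := by
          apply mul_le_mul hMmax' _ (by positivity) hMpos.le
          exact Real.rpow_le_rpow_of_exponent_ge h2r hr3.le (by linarith)

/-! ### Existence of blocks -/

/-- The mass condition holds at `n` as soon as the centre is close to a typical point. -/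
def MassCondNear (c : ℕ) (μ : Measure (Fin d → ℝ)) (α ρ : ℝ) (ψ : ℝ → ℝ)
    (x : ℕ → Fin d → ℝ) (lam : ℕ → ℝ) (Q : ℕ → Prop) : Prop :=
  ∀ y ∈ hoCube d, (∃ j₀ : ℕ, ∀ j : ℕ, j₀ ≤ j → ∀ k ∈ nbrs c j y, PBound μ α ψ (box c j k)) →
    ∃ r₀ > 0, ∀ n, lam n < r₀ → dist (x n) y ≤ 2 ^ (-ρ) * lam n ^ ρ → Q n

/-- Existence of the constant `M` for which the mass condition holds near typical points. -/
lemma exists_massCondNear (hd : 1 ≤ d) {c : ℕ} (hc : 2 ≤ c) {μ : Measure (Fin d → ℝ)}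
    [IsFiniteMeasure μ] (hμh : μ (hoCube d)ᶜ = 0) {α ρ : ℝ} (hα : 0 < α) (hρ : 0 < ρ)
    {ψ χ : ℝ → ℝ} (hψ : IsGaugeExponent ψ) (hχ : ∀ r, 0 ≤ r → 0 ≤ χ r)
    (x : ℕ → Fin d → ℝ) {lam : ℕ → ℝ} (hlam : ∀ n, 0 < lam n) :
    ∃ M : ℝ, 1 ≤ M ∧ MassCondNear c μ α ρ ψ x lam
      (MassCond μ x lam ρ α (epsSeq lam ρ α ψ χ M)) := by
  obtain ⟨M, hM, h⟩ := exists_mass_bounds hd hc hμh hα hρ hψ hχ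
  refine ⟨M, hM, fun y hy hyP => ?_⟩
  obtain ⟨r₀, hr₀, hr⟩ := h y hy hyP
  refine ⟨min r₀ 1 ^ ρ⁻¹, by positivity, fun n hn hdist => ?_⟩
  have hlt : lam n ^ ρ < min r₀ 1 := by
    have := Real.rpow_lt_rpow (hlam n).le hn hρ
    rwa [← Real.rpow_mul (by positivity), inv_mul_cancel₀ hρ.ne', Real.rpow_one] at this
  obtain ⟨h1, h2⟩ := hr (lam n ^ ρ) (Real.rpow_pos_of_pos (hlam n) _)
    (hlt.trans_le (min_le_left _ _)) (x n) hdist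
  exact massCond_epsSeq (by linarith) (hlam n) rfl (hlt.trans_le (min_le_right _ _)) h1 h2

/-- At `b = β` the last inequality reads `δ * t < E`, so it persists for `b` slightly below `β`.
Such a `b` serves both for the growth of the measure and for the size condition of blocks. -/
lemma exists_exponent {E ρ β δ s t : ℝ} (hρ : 0 < ρ) (hδ : 0 < δ) (hE : E / β ≤ δ) (hβ : 0 < β)
    (hst : s < t) (ht : t < E / δ) : s < β ∧ t * δ < E ∧
      ∃ b, s < b ∧ b < β ∧ δ * t < ρ * b + (E - ρ * β) := by
  have h1 : t * δ < E := (lt_div_iff₀ hδ).1 ht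
  have h2 : E ≤ δ * β := (div_le_iff₀ hβ).1 hE
  have hsβ : s < β := by
    have h3 : t * δ < β * δ := by linarith
    exact hst.trans (lt_of_mul_lt_mul_right h3 hδ.le)
  refine ⟨hsβ, h1, ?_⟩
  have h4 : (δ * t - (E - ρ * β)) / ρ < β := by
    rw [div_lt_iff₀ hρ]; linarith
  obtain ⟨b, hb1, hb2⟩ := exists_between (max_lt hsβ h4)
  refine ⟨b, (le_max_left _ _).trans_lt hb1, hb2, ?_⟩
  have := (le_max_right _ _).trans_lt hb1
  rw [div_lt_iff₀ hρ] at this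
  linarith

/-- A box contained in a small ball has large generation. -/
lemma generation_ge_of_box_subset (hd : 1 ≤ d) {c : ℕ} (hc : 2 ≤ c) {N i : ℕ} {k : Fin d → ℕ}
    {z : Fin d → ℝ} {r : ℝ} (hr : 0 ≤ r) (h : box c i k ⊆ Metric.ball z r)
    (hN : 2 * r < ((c : ℝ) ^ N)⁻¹) : N ≤ i := by
  have h1 := Metric.diam_mono h Metric.isBounded_ball
  rw [diam_box hd (by omega)] at h1
  have h2 := h1.trans (Metric.diam_ball hr)
  exact (generation_ge_of_lt hc (h2.trans_lt hN)).le

/-- Every ball centred in the cube contains a box of comparable size. -/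
lemma exists_box_subset_ball {c : ℕ} (hc : 2 ≤ c) {z : Fin d → ℝ} (hz : z ∈ cube d) {r : ℝ}
    (hr : 0 < r) (hr1 : r ≤ 1) :
    ∃ (i : ℕ) (k : Fin d → ℕ), k ∈ grid d c i ∧ box c i k ⊆ Metric.ball z r ∧
      r / (2 * c) ≤ ((c : ℝ) ^ i)⁻¹ := by
  have hcR : (0 : ℝ) < c := by exact_mod_cast (by omega : 0 < c)
  obtain ⟨i, hi1, hi2⟩ := exists_generation hc (r := r / 2) (by positivity) (by linarith)
  obtain ⟨k, hk, hkb⟩ := exists_box_subset_closedBall (c := c) (by omega) i hz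
  refine ⟨i, k, hk, hkb.trans (Metric.closedBall_subset_ball (by linarith)), ?_⟩
  rw [div_le_iff₀ (by positivity)]
  linarith

/-- Blocks consisting of a single ball. -/
lemma exists_block_of_frequently (hd : 1 ≤ d) {c : ℕ} (hc : 2 ≤ c) {μ m : Measure (Fin d → ℝ)}
    {mL : ℕ → (Fin d → ℕ) → Measure (Fin d → ℝ)} {α β : ℝ} (hβ : 0 < β) {φ ψ : ℝ → ℝ}
    {x : ℕ → Fin d → ℝ} (hx : ∀ n, x n ∈ cube d) {lam : ℕ → ℝ} (hlam : ∀ n, 0 < lam n)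
    (hlam_lim : Tendsto lam atTop (𝓝 0)) {Q : ℕ → Prop}
    (hQ : MassCondNear c μ α 1 ψ x lam Q) (hscal : LocalScaling c m μ α ψ)
    {δ : ℝ} (hδ : 1 ≤ δ) {δhat : ℕ → ℝ} (hδ1 : ∀ n, 1 ≤ δhat n) (hδδ : ∀ n, δhat n ≤ δ)
    (hgood : ∀ᵐ y ∂m, ∃ᶠ n in atTop, y ∈ Metric.closedBall (x n) (lam n / 2) ∧
      ∃ (i : ℕ) (k : Fin d → ℕ), IsMaxBox c (Metric.ball (x n) (lam n ^ δhat n)) i k ∧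
        GoodBox c mL β φ i k) (s t : ℝ) (hs : 0 < s) (hst : s < t) (ht : t < β / δ) :
    ∃ b, s ≤ b ∧ b < β ∧ ∀ N : ℕ, ∀ᵐ y ∂m, y ∈ hoCube d → ∀ R₀ > 0, ∃ R, 0 < R ∧ R < R₀ ∧
      IsBlock (fun n => Metric.closedBall (x n) (lam n ^ δhat n))
        (fun n => lam n ^ δhat n / (2 * c))
        (HasGoodBox c mL β φ x (fun n => lam n ^ δhat n) (fun n => lam n ^ δhat n / (2 * c)) Q N)
        b s t 1 y R := by
  have hcR : (0 : ℝ) < c := by exact_mod_cast (by omega : 0 < c)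
  have hδ0 : 0 < δ := by linarith
  have ht0 : 0 < t := by linarith
  obtain ⟨hsβ, htδ, b, hsb, hbβ, hb⟩ := exists_exponent (E := β) one_pos hδ0
    (by rw [div_self hβ.ne']; exact hδ) hβ hst ht
  have hbδ : δ * t < b := by linarith
  refine ⟨b, hsb.le, hbβ, fun N => ?_⟩
  filter_upwards [hgood, hscal] with y hy1 hy2 hyc R₀ hR₀
  obtain ⟨r₀, hr₀, hr⟩ := hQ y hyc (hy2 hyc)
  have hpow : Tendsto (fun n => lam n ^ (b - δ * t)) atTop (𝓝 0) := by
    have h := ((Real.continuousAt_rpow_const (0 : ℝ) (b - δ * t)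
      (Or.inr (by linarith))).tendsto).comp hlam_lim
    rwa [Real.zero_rpow (by linarith)] at h
  have e1 := hlam_lim.eventually_lt_const hr₀
  have e2 := hlam_lim.eventually_lt_const hR₀
  have e3 := hlam_lim.eventually_lt_const (show (0 : ℝ) < ((c : ℝ) ^ N)⁻¹ / 2 by positivity)
  have e4 := hlam_lim.eventually_lt_const one_pos
  have e5 := hpow.eventually_lt_const (show (0 : ℝ) < (2 * (c : ℝ))⁻¹ ^ t by positivity)
  obtain ⟨n, ⟨hyn, i, k, hmax, hgb⟩, n1, n2, n3, n4, n5, n6⟩ :=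
    (hy1.and_eventually (e1.and (e2.and (e3.and (e4.and (e5.and (eventually_ge_atTop N))))))).exists
  have hl := hlam n
  have hradle : lam n ^ δhat n ≤ lam n := by
    have := Real.rpow_le_rpow_of_exponent_ge hl n4.le (hδ1 n)
    rwa [Real.rpow_one] at this
  have hrad0 : 0 < lam n ^ δhat n := Real.rpow_pos_of_pos hl _
  rw [Metric.mem_closedBall, dist_comm] at hyn
  -- The block is the single index `n` at scale `lam n`, and its distribution condition holds
  -- trivially. The size condition holds because `δ * t < b`, the factor `(2 * c) ^ t` being
  -- absorbed by `e5`.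
  refine ⟨lam n, hl, n2, {n}, Finset.singleton_nonempty n, fun g hg => ?_, fun V v _ _ _ G' hG' _ =>
    Or.inl ?_⟩
  · obtain rfl := Finset.mem_singleton.1 hg
    refine ⟨⟨n6, hr g n1 ?_, i, k, ?_, hmax.1, hmax.2.1, hgb, ?_⟩, ?_, ?_⟩
    · rw [Real.rpow_one, Real.rpow_neg_one]; linarith
    · exact generation_ge_of_box_subset hd hc hrad0.le hmax.2.1 (by linarith)
    -- Maximality compares the good box with a box of known side in the same ball.
    · obtain ⟨i', k', hk', hb', hsize⟩ := exists_box_subset_ball hc (hx g) hrad0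
        (hradle.trans n4.le)
      have h1 := hmax.2.2 i' k' hk' hb'
      rw [diam_box hd (by omega), diam_box hd (by omega)] at h1
      exact hsize.trans h1
    · apply Metric.closedBall_subset_closedBall'
      linarith
    · simp only [Finset.card_singleton, Nat.cast_one, one_mul]
      calc lam g ^ b = lam g ^ (b - δ * t) * lam g ^ (δ * t) := by
            rw [← Real.rpow_add hl]; ring_nf
        _ ≤ (2 * (c : ℝ))⁻¹ ^ t * lam g ^ (δ * t) := by gcongr
        _ = (lam g ^ δ / (2 * c)) ^ t := by
            rw [Real.rpow_mul hl.le, ← Real.mul_rpow (by positivity) (by positivity)]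
            congr 1
            field_simp
        _ ≤ (lam g ^ δhat g / (2 * c)) ^ t := by
            have := Real.rpow_le_rpow_of_exponent_ge hl n4.le (hδδ g)
            gcongr
  · have := Finset.card_le_card hG'
    rw [Finset.card_singleton] at this
    exact_mod_cast this

lemma tendsto_rpow_neg_mul {c : ℕ} (hc : 2 ≤ c) {ρ : ℝ} (hρ : 0 < ρ) :
    Tendsto (fun j : ℕ => (c : ℝ) ^ (-(ρ * (j : ℝ)))) atTop (𝓝 0) := by
  have hc1 : (1 : ℝ) < c := by exact_mod_cast hc
  have h1 : (c : ℝ) ^ (-ρ) < 1 := Real.rpow_lt_one_of_one_lt_of_neg hc1 (by linarith)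
  refine (tendsto_pow_atTop_nhds_zero_of_lt_one (by positivity) h1).congr fun j => ?_
  rw [← Real.rpow_natCast, ← Real.rpow_mul (by positivity)]
  ring_nf

/-- Blocks obtained from the covering condition for `ρ < 1`. -/
lemma exists_block_of_manyPoints (hd : 1 ≤ d) {c : ℕ} (hc : 2 ≤ c) {μ m : Measure (Fin d → ℝ)}
    {mL : ℕ → (Fin d → ℕ) → Measure (Fin d → ℝ)} {α β : ℝ} (hβ : 0 < β) (hβd : β ≤ d)
    {φ ψ χ : ℝ → ℝ} {x : ℕ → Fin d → ℝ} (hx : ∀ n, x n ∈ cube d) {lam : ℕ → ℝ}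
    (hlam : ∀ n, 0 < lam n) (hlam_anti : Antitone lam) {Q : ℕ → Prop} {ρ : ℝ} (hρ : 0 < ρ)
    (hρ1 : ρ < 1) (hQ : MassCondNear c μ α ρ ψ x lam Q) (hscal : LocalScaling c m μ α ψ)
    (hχ : IsGaugeExponent χ) (hmany : ManyPoints c ρ m χ x lam)
    (hunif : UniformGrowthControl c mL β φ) {δ : ℝ} (hδ : 1 ≤ δ)
    (hδβ : ((d : ℝ) * (1 - ρ) + ρ * β) / β ≤ δ) (s t : ℝ) (hs : 0 < s) (hst : s < t)
    (ht : t < ((d : ℝ) * (1 - ρ) + ρ * β) / δ) :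
    ∃ b, s ≤ b ∧ b < β ∧ ∀ N : ℕ, ∀ᵐ y ∂m, y ∈ hoCube d → ∀ R₀ > 0, ∃ R, 0 < R ∧ R < R₀ ∧
      IsBlock (fun n => Metric.closedBall (x n) (lam n ^ δ)) (fun n => lam n ^ δ / (2 * c))
        (HasGoodBox c mL β φ x (fun n => lam n ^ δ) (fun n => lam n ^ δ / (2 * c)) Q N)
        b s t (3 ^ d) y R := by
  have hc1 : (1 : ℝ) < c := by exact_mod_cast hc
  have hc2 : (2 : ℝ) ≤ c := by exact_mod_cast hc
  have hcR : (0 : ℝ) < c := by linarith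
  have hδ0 : 0 < δ := by linarith
  have ht0 : 0 < t := by linarith
  obtain ⟨hsβ, htδ, b, hsb, hbβ, hb⟩ := exists_exponent hρ hδ0 hδβ hβ hst ht
  have hb' : δ * t < ρ * b + d * (1 - ρ) := by linarith
  obtain ⟨J, hJ⟩ := hunif
  refine ⟨b, hsb.le, hbβ, fun N => ?_⟩
  filter_upwards [hmany, hscal] with y hy1 hy2 hyc R₀ hR₀
  obtain ⟨r₀, hr₀, hr⟩ := hQ y hyc (hy2 hyc)
  -- a margin in the exponents
  set η : ℝ := min (min ((ρ * b + d * (1 - ρ) - δ * t) / 2) (ρ * (b - s) / 2)) (1 - ρ) with hη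
  have hη0 : 0 < η := by
    refine lt_min (lt_min (by linarith) ?_) (by linarith)
    have : 0 < ρ * (b - s) := mul_pos hρ (by linarith)
    linarith
  have hη1 : 2 * η ≤ ρ * b + d * (1 - ρ) - δ * t := by
    have : η ≤ (ρ * b + d * (1 - ρ) - δ * t) / 2 := (min_le_left _ _).trans (min_le_left _ _)
    linarith
  have hη2 : 2 * η ≤ ρ * (b - s) := by
    have : η ≤ ρ * (b - s) / 2 := (min_le_left _ _).trans (min_le_right _ _)
    linarith
  have hη3 : η ≤ 1 - ρ := min_le_right _ _
  have hRlim := tendsto_rpow_neg_mul hc hρ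
  have hχlim : Tendsto (fun j : ℕ => χ ((c : ℝ) ^ (-(j : ℝ)))) atTop (𝓝 0) := by
    refine (hχ.tendsto_generation hc).congr fun j => ?_
    rw [Real.rpow_neg hcR.le, Real.rpow_natCast]
  have hbig : Tendsto (fun j : ℕ => (c : ℝ) ^ ((j : ℝ) * η)) atTop atTop := by
    have h2 : (1 : ℝ) < (c : ℝ) ^ η := Real.one_lt_rpow hc1 hη0
    refine (tendsto_pow_atTop_atTop_of_one_lt h2).congr fun j => ?_
    rw [← Real.rpow_natCast, ← Real.rpow_mul hcR.le, mul_comm]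
  have e1 := hRlim.eventually_lt_const hr₀
  have e2 := hRlim.eventually_lt_const hR₀
  have e3 := hRlim.eventually_lt_const
    (show (0 : ℝ) < ((c : ℝ) ^ (max N J))⁻¹ / 2 by positivity)
  have e4 := hRlim.eventually_lt_const one_pos
  have e5 := hRlim.eventually_lt_const (hlam N)
  have e6 := hχlim.eventually_lt_const hη0
  have e7 := hbig.eventually_ge_atTop (max ((2 * (c : ℝ)) ^ t) (3 ^ d))
  obtain ⟨j, ⟨S, hcard, hS, hdisj⟩, j1, j2, j3, j4, j5, j6, j7⟩ :=
    ((Nat.frequently_atTop_iff_infinite.2 hy1).and_eventually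
      (e1.and (e2.and (e3.and (e4.and (e5.and (e6.and e7))))))).exists
  set χj := χ ((c : ℝ) ^ (-(j : ℝ))) with hχj
  set R : ℝ := (c : ℝ) ^ (-(ρ * (j : ℝ))) with hR
  have hR0 : 0 < R := by positivity
  have hj0 : (0 : ℝ) ≤ j := by positivity
  have hlamR : ∀ n ∈ S, lam n ≤ R := fun n hn => by
    refine (hS n hn).2.2.trans ?_
    apply Real.rpow_le_rpow_of_exponent_le hc1.le
    nlinarith
  have hlamlow : ∀ n ∈ S, (c : ℝ) ^ (-(j : ℝ)) ≤ lam n := fun n hn =>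
    (Real.rpow_le_rpow_of_exponent_le hc1.le (by linarith)).trans (hS n hn).2.1
  have hlam1 : ∀ n ∈ S, lam n < 1 := fun n hn => (hlamR n hn).trans_lt j4
  have hradle : ∀ n ∈ S, lam n ^ δ ≤ lam n := fun n hn => by
    have := Real.rpow_le_rpow_of_exponent_ge (hlam n) (hlam1 n hn).le hδ
    rwa [Real.rpow_one] at this
  have hcardlow : (c : ℝ) ^ ((j : ℝ) * ((d : ℝ) * (1 - ρ) - η)) ≤ S.card := by
    refine le_trans ?_ hcard
    apply Real.rpow_le_rpow_of_exponent_le hc1.le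
    exact mul_le_mul_of_nonneg_left (by linarith) hj0
  have hSne : S.Nonempty := by
    rw [← Finset.card_pos]
    have : (0 : ℝ) < S.card := lt_of_lt_of_le (by positivity) hcardlow
    exact_mod_cast this
  refine ⟨R, hR0, j2, S, hSne, fun n hn => ?_, fun V v hv hvR hV G' hG' hmeet => ?_⟩
  · have hl := hlam n
    have hrad0 : 0 < lam n ^ δ := Real.rpow_pos_of_pos hl _
    have hlR := hlamR n hn
    have hrl := hradle n hn
    obtain ⟨i, k, hk, hkb, hksize⟩ := exists_box_subset_ball hc (hx n) hrad0
      (hrl.trans (hlam1 n hn).le)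
    have hgen : max N J ≤ i := generation_ge_of_box_subset hd hc hrad0.le hkb (by linarith)
    have hxy := (hS n hn).1
    rw [Metric.mem_closedBall] at hxy
    refine ⟨⟨(lt_index_of_lt hlam_anti (hlR.trans_lt j5)).le, hr n (hlR.trans_lt j1) ?_, i, k,
      (le_max_left _ _).trans hgen, hk, hkb, hJ i ((le_max_right _ _).trans hgen) k hk, hksize⟩,
      ?_, ?_⟩
    · refine hxy.trans ?_
      -- The extra `+ 1` in the lower bound for `lam n`, together with `2 ≤ c`, supplies the factor
      -- `2 ^ (-ρ)`.
      have h1 : ((c : ℝ) ^ (-(j : ℝ) + 1)) ^ ρ ≤ lam n ^ ρ :=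
        Real.rpow_le_rpow (by positivity) (hS n hn).2.1 hρ.le
      have h2 : ((c : ℝ) ^ (-(j : ℝ) + 1)) ^ ρ = R * (c : ℝ) ^ ρ := by
        rw [← Real.rpow_mul hcR.le, hR, ← Real.rpow_add hcR]
        ring_nf
      have h3 : (2 : ℝ) ^ ρ ≤ (c : ℝ) ^ ρ := Real.rpow_le_rpow (by norm_num) hc2 hρ.le
      rw [Real.rpow_neg (by norm_num), ← div_eq_inv_mul, le_div_iff₀ (by positivity)]
      calc R * 2 ^ ρ ≤ R * (c : ℝ) ^ ρ := by gcongr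
        _ ≤ _ := by rw [← h2]; exact h1
    · apply Metric.closedBall_subset_closedBall'
      linarith
    · have h1 : (c : ℝ) ^ (-((j : ℝ) * (δ * t))) ≤ (lam n ^ δ) ^ t := by
        calc (c : ℝ) ^ (-((j : ℝ) * (δ * t))) = (((c : ℝ) ^ (-(j : ℝ))) ^ δ) ^ t := by
              rw [← Real.rpow_mul hcR.le, ← Real.rpow_mul hcR.le]; ring_nf
          _ ≤ _ := by
              have := hlamlow n hn
              gcongr
      have h2 : (2 * (c : ℝ)) ^ t ≤ (c : ℝ) ^ ((j : ℝ) * η) := (le_max_left _ _).trans j7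
      rw [Real.div_rpow hrad0.le (by positivity), ← mul_div_assoc,
        le_div_iff₀ (by positivity)]
      calc R ^ b * (2 * (c : ℝ)) ^ t ≤ R ^ b * (c : ℝ) ^ ((j : ℝ) * η) := by gcongr
        _ = (c : ℝ) ^ ((j : ℝ) * (-(ρ * b) + η)) := by
            rw [hR, ← Real.rpow_mul hcR.le, ← Real.rpow_add hcR]; ring_nf
        _ ≤ (c : ℝ) ^ ((j : ℝ) * (d * (1 - ρ) - η - δ * t)) := by
            apply Real.rpow_le_rpow_of_exponent_le hc1.le
            exact mul_le_mul_of_nonneg_left (by linarith) hj0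
        _ = (c : ℝ) ^ ((j : ℝ) * ((d : ℝ) * (1 - ρ) - η)) *
              (c : ℝ) ^ (-((j : ℝ) * (δ * t))) := by
            rw [← Real.rpow_add hcR]; ring_nf
        _ ≤ _ := by gcongr
  · rcases G'.eq_empty_or_nonempty with rfl | ⟨n₀, hn₀⟩
    · left
      simp only [Finset.card_empty, Nat.cast_zero]
      positivity
    obtain ⟨p, hpV, -⟩ := hmeet n₀ hn₀
    set a : ℝ := (c : ℝ) ^ (-(j : ℝ)) with ha
    have ha0 : 0 < a := by positivity
    have hcount := card_le_of_disjoint_balls G' x lam ha0 hv.le (fun n hn => hlamlow n (hG' hn))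
      (hdisj.subset (by exact_mod_cast hG')) p (fun n hn => by
        obtain ⟨z, hzV, hz⟩ := hmeet n hn
        exact ⟨z, Metric.closedBall_subset_closedBall (hradle n (hG' hn)) hz, hV z hzV p hpV⟩)
    -- A set of size at most `a` meets at most `3 ^ d` of the disjoint balls. A larger one meets at
    -- most `3 ^ d * (v / a) ^ d`; since `v ≤ R` and `s < b < β ≤ d`, the factor `v ^ d` is traded
    -- for `R ^ (d - s) * v ^ s` and compared with `S.card`.
    rcases le_or_gt v a with hva | hva
    · left
      refine hcount.trans (pow_le_pow_left₀ (by positivity) ?_ d)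
      have := (div_le_one ha0).2 hva
      linarith
    · right
      have hva1 : 1 ≤ v / a := (one_le_div ha0).2 hva.le
      have h3 : (3 : ℝ) ^ d ≤ (c : ℝ) ^ ((j : ℝ) * η) := (le_max_right _ _).trans j7
      have hcount' : (G'.card : ℝ) ≤ 3 ^ d * (v ^ (d : ℝ) * (c : ℝ) ^ ((j : ℝ) * d)) := by
        refine hcount.trans ?_
        calc (2 + v / a) ^ d ≤ (3 * (v / a)) ^ d := by gcongr; linarith
          _ = 3 ^ d * (v ^ d * (a⁻¹) ^ d) := by rw [mul_pow, div_eq_mul_inv, mul_pow]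
          _ = _ := by
              rw [ha, ← Real.rpow_neg hcR.le, neg_neg, ← Real.rpow_natCast v,
                ← Real.rpow_natCast ((c : ℝ) ^ (j : ℝ)), ← Real.rpow_mul hcR.le]
      have hvd : v ^ (d : ℝ) ≤ R ^ ((d : ℝ) - s) * v ^ s := by
        calc v ^ (d : ℝ) = v ^ ((d : ℝ) - s) * v ^ s := by
              rw [← Real.rpow_add hv]; ring_nf
          _ ≤ _ := by
              have : 0 ≤ (d : ℝ) - s := by linarith
              gcongr
      calc R ^ b * G'.card
          ≤ R ^ b * ((c : ℝ) ^ ((j : ℝ) * η) *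
            ((R ^ ((d : ℝ) - s) * v ^ s) * (c : ℝ) ^ ((j : ℝ) * d))) := by
            refine mul_le_mul_of_nonneg_left (hcount'.trans ?_) (by positivity)
            gcongr
        _ = (c : ℝ) ^ ((j : ℝ) * (d * (1 - ρ) + η - ρ * (b - s))) * v ^ s := by
            rw [show R ^ b * ((c : ℝ) ^ ((j : ℝ) * η) *
              ((R ^ ((d : ℝ) - s) * v ^ s) * (c : ℝ) ^ ((j : ℝ) * d))) =
              (R ^ b * R ^ ((d : ℝ) - s)) * ((c : ℝ) ^ ((j : ℝ) * η) *
                (c : ℝ) ^ ((j : ℝ) * d)) * v ^ s by ring,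
              ← Real.rpow_add hR0, hR, ← Real.rpow_mul hcR.le, ← Real.rpow_add hcR,
              ← Real.rpow_add hcR]
            ring_nf
        _ ≤ (c : ℝ) ^ ((j : ℝ) * ((d : ℝ) * (1 - ρ) - η)) * v ^ s := by
            refine mul_le_mul_of_nonneg_right (Real.rpow_le_rpow_of_exponent_le hc1.le ?_)
              (by positivity)
            exact mul_le_mul_of_nonneg_left (by linarith) hj0
        _ ≤ S.card * v ^ s := by gcongr

/-! ### Choice of the exponents -/

/-- If at each stage `k` almost every point lies in infinitely many of the sets `B n` with
`p k n`, then the stage may be made to depend on `n`, growing slowly. -/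
lemma exists_monotone_stage {X : Type*} [MeasurableSpace X] {m : Measure X} [IsFiniteMeasure m]
    {B : ℕ → Set X} (hB : ∀ n, MeasurableSet (B n)) {p : ℕ → ℕ → Prop}
    (h : ∀ k, ∀ᵐ y ∂m, ∃ᶠ n in atTop, y ∈ B n ∧ p k n) :
    ∃ κ : ℕ → ℕ, Monotone κ ∧ Tendsto κ atTop atTop ∧
      ∀ᵐ y ∂m, ∃ᶠ n in atTop, y ∈ B n ∧ p (κ n) n := by
  classical
  obtain ⟨w, hw0, hw⟩ := ENNReal.exists_pos_sum_of_countable' one_ne_zero ℕ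
  -- Almost every point has an occurrence after `N`, so by continuity from above a long enough
  -- window misses only a set of measure at most `w k`.
  have hnext : ∀ k N, ∃ N', N < N' ∧ m {y | ∀ n, N ≤ n → n < N' → ¬ (y ∈ B n ∧ p k n)} ≤ w k := by
    intro k N
    set U : ℕ → Set X := fun N' => {y | ∀ n, N ≤ n → n < N' → ¬ (y ∈ B n ∧ p k n)} with hU
    have hmeas : ∀ N', MeasurableSet (U N') := by
      intro N'
      have e : U N' = ⋂ n ∈ {n | N ≤ n ∧ n < N' ∧ p k n}, (B n)ᶜ := by
        ext y
        simp only [hU, mem_ofPred_eq, mem_iInter, mem_compl_iff]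
        exact ⟨fun hy n hn hyn => hy n hn.1 hn.2.1 ⟨hyn, hn.2.2⟩,
          fun hy n h1 h2 h3 => hy n ⟨h1, h2, h3.2⟩ h3.1⟩
      rw [e]
      exact MeasurableSet.biInter (Set.to_countable _) fun n _ => (hB n).compl
    have hanti : Antitone U := fun a b hab y hy n h1 h2 => hy n h1 (h2.trans_le hab)
    have hnull : m (⋂ N', U N') = 0 := by
      refine measure_mono_null (fun y hy => ?_) (ae_iff.1 (h k))
      rw [mem_ofPred_eq, not_frequently]
      filter_upwards [eventually_ge_atTop N] with n hn
      exact mem_iInter.1 hy (n + 1) n hn (Nat.lt_succ_self n)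
    have hlim := tendsto_measure_iInter_atTop (fun N' => (hmeas N').nullMeasurableSet) hanti
      ⟨0, measure_ne_top m _⟩
    rw [hnull] at hlim
    obtain ⟨N', hN', hN''⟩ :=
      ((hlim.eventually_lt_const (hw0 k)).and (eventually_gt_atTop N)).exists
    exact ⟨N', hN'', hN'.le⟩
  choose nxt hnxt1 hnxt2 using hnext
  let s : ℕ → ℕ := fun k => Nat.rec 0 (fun k N => nxt k N) k
  have hs : ∀ k, s (k + 1) = nxt k (s k) := fun k => rfl
  have hsmono : StrictMono s := strictMono_nat_of_lt_succ fun k => by rw [hs]; exact hnxt1 k _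
  -- The stage is `k` exactly on the window `s k ≤ n < s (k + 1)`.
  set κ : ℕ → ℕ := fun n => @Nat.findGreatest (fun k => s k ≤ n) (fun k => Nat.decLe (s k) n) n with hκ
  have hκle : ∀ {k n}, s k ≤ n → k ≤ κ n := fun {k n} hk =>
    @Nat.le_findGreatest k (s · ≤ n) (fun k => Nat.decLe (s k) n) n ((hsmono.id_le k).trans hk) hk
  have hκspec : ∀ n, s (κ n) ≤ n := by
    intro n
    have h0 : s 0 ≤ n := Nat.zero_le n
    exact @Nat.findGreatest_spec 0 (s · ≤ n) (fun k => Nat.decLe (s k) n) n (Nat.zero_le n) h0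
  have hκmono : Monotone κ := fun a b hab => hκle ((hκspec a).trans hab)
  refine ⟨κ, hκmono, tendsto_atTop.2 fun k => ?_, ?_⟩
  · filter_upwards [eventually_ge_atTop (s k)] with n hn
    exact hκle hn
  -- Borel–Cantelli: the measures of the missed sets are summable, so almost every point has an
  -- occurrence in all but finitely many windows.
  · have hBC : m {y | ∃ᶠ k in atTop, y ∈
        {y | ∀ n, s k ≤ n → n < s (k + 1) → ¬ (y ∈ B n ∧ p k n)}} = 0 := by
      refine measure_setOfPred_frequently_eq_zero (ne_top_of_le_ne_top (hw.trans ENNReal.one_lt_top).ne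
        (ENNReal.tsum_le_tsum fun k => ?_))
      rw [hs]
      exact hnxt2 k (s k)
    have hae : ∀ᵐ y ∂m, ¬ ∃ᶠ k in atTop, y ∈
        {y | ∀ n, s k ≤ n → n < s (k + 1) → ¬ (y ∈ B n ∧ p k n)} := by
      rw [ae_iff]
      simpa only [not_not] using hBC
    filter_upwards [hae] with y hy
    rw [not_frequently] at hy
    obtain ⟨k₀, hk₀⟩ := eventually_atTop.1 hy
    rw [frequently_atTop]
    intro N
    have h1 : ¬ ∀ n, s (max k₀ N) ≤ n → n < s (max k₀ N + 1) →
      ¬ (y ∈ B n ∧ p (max k₀ N) n) := hk₀ (max k₀ N) (le_max_left _ _)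
    push Not at h1
    obtain ⟨n, hn1, hn2, hn3, hn4⟩ := h1
    have hNn : N ≤ n := (le_max_right _ _).trans ((hsmono.id_le _).trans hn1)
    refine ⟨n, hNn, hn3, ?_⟩
    have : κ n = max k₀ N := by
      apply le_antisymm
      · by_contra hcon
        have := hsmono.monotone (show max k₀ N + 1 ≤ κ n by omega)
        have := hκspec n
        omega
      · exact hκle hn1
    rwa [this]

lemma one_le_of_mem_exponentLimits {D : Set ℝ} (hD : D ⊆ Ioi 1) {δ : ℝ}
    (hδ : δ ∈ exponentLimits D) : 1 ≤ δ := by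
  obtain ⟨u, -, hu, hlim⟩ := hδ
  refine ge_of_tendsto' hlim fun n => ?_
  rcases hu n with h | h
  · exact (mem_singleton_iff.1 h).ge
  · exact (mem_Ioi.1 (hD h)).le

/-- An exponent of `D` is kept constant. Otherwise an approximating sequence eventually exceeds `1`,
hence takes its values in `D`, and is followed slowly enough for almost every point to keep meeting
the required balls. -/
lemma exists_exponent_sequence {X : Type*} [MeasurableSpace X] {m : Measure X}
    [IsFiniteMeasure m] {B : ℕ → Set X} (hB : ∀ n, MeasurableSet (B n)) {p : ℝ → ℕ → Prop}
    {D : Set ℝ} (hD : D ⊆ Ioi 1) (h : ∀ e ∈ D, ∀ᵐ y ∂m, ∃ᶠ n in atTop, y ∈ B n ∧ p e n)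
    {δ : ℝ} (hδ : δ ∈ exponentLimits D) (hδ1 : δ ≠ 1) :
    ∃ δhat : ℕ → ℝ, Monotone δhat ∧ (∀ n, 1 ≤ δhat n) ∧ (∀ n, δhat n ≤ δ) ∧
      Tendsto δhat atTop (𝓝 δ) ∧ (δ ∈ {1} ∪ D → ∀ n, δhat n = δ) ∧
      ∀ᵐ y ∂m, ∃ᶠ n in atTop, y ∈ B n ∧ p (δhat n) n := by
  have h1δ := one_le_of_mem_exponentLimits hD hδ
  by_cases hmem : δ ∈ ({1} ∪ D : Set ℝ)
  · have hδD : δ ∈ D := hmem.resolve_left hδ1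
    exact ⟨fun _ => δ, monotone_const, fun _ => h1δ, fun _ => le_rfl, tendsto_const_nhds,
      fun _ _ => rfl, h δ hδD⟩
  · obtain ⟨u, humono, hu, hlim⟩ := hδ
    have hlt : 1 < δ := lt_of_le_of_ne h1δ hδ1.symm
    obtain ⟨n₁, hn₁⟩ := eventually_atTop.1 (hlim.eventually_const_lt hlt)
    have huD : ∀ k, u (k + n₁) ∈ D := fun k => by
      refine (hu (k + n₁)).resolve_left fun h => ?_
      have := hn₁ (k + n₁) (by omega)
      rw [mem_singleton_iff.1 h] at this
      exact lt_irrefl _ this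
    obtain ⟨κ, hκ, hκlim, hae⟩ := exists_monotone_stage hB fun k => h _ (huD k)
    refine ⟨fun n => u (κ n + n₁), fun a b hab => humono (by have := hκ hab; omega),
      fun n => (hn₁ _ (by omega)).le, fun n => humono.ge_of_tendsto hlim _, ?_,
      fun h => absurd h hmem, hae⟩
    exact hlim.comp (tendsto_atTop_mono (fun n => Nat.le_add_right _ _) hκlim)

/-! ### Absolute continuity with respect to sets of small dimension -/

lemma hoCube_eq_box (c : ℕ) : hoCube d = box c 0 (fun _ => 0) := by
  ext y; simp [hoCube, box]

/-- Mass distribution principle: where the neighbour bounds hold from a given generation on, balls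
have mass at most a multiple of `r ^ s` for some `s < β` with `μH[s] A = 0`. Countably many such
sets exhaust almost all of the cube. -/
lemma measure_inter_hoCube_eq_zero (hd : 1 ≤ d) {c : ℕ} (hc : 2 ≤ c) {m : Measure (Fin d → ℝ)}
    [IsFiniteMeasure m] {β : ℝ} {φ : ℝ → ℝ} (hφ : IsGaugeExponent φ)
    (hup : LocalUpper c m β φ) {A : Set (Fin d → ℝ)} (hA : dimH A < ENNReal.ofReal β) :
    m (A ∩ hoCube d) = 0 := by
  have hc0 : 0 < c := by omega
  have hc1 : (1 : ℝ) ≤ c := by exact_mod_cast hc0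
  have hcR : (0 : ℝ) < c := by linarith
  obtain ⟨s₀, hs₀A, hs₀⟩ := ENNReal.lt_iff_exists_nnreal_btwn.1 hA
  have hs₀β : (s₀ : ℝ) < β := by
    have := (ENNReal.lt_ofReal_iff_toReal_lt ENNReal.coe_ne_top).1 hs₀
    simpa using this
  have hs₀pos : 0 < (s₀ : ℝ) := by
    have : (0 : ℝ≥0∞) < s₀ := lt_of_le_of_lt zero_le hs₀A
    exact_mod_cast this
  have hHA := hausdorffMeasure_of_dimH_lt hs₀A
  set s : ℝ := (s₀ : ℝ) with hs
  obtain ⟨K, hK, hKφ⟩ := hφ.exists_rpow_le hs₀β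
  have hmeas : MeasurableSet (hoCube d) := by rw [hoCube_eq_box 1]; exact measurableSet_box _ _ _
  set m' := m.restrict (hoCube d) with hm'
  have hm'c : m' (hoCube d)ᶜ = 0 := by
    rw [hm', Measure.restrict_apply hmeas.compl]; simp
  set G : ℕ → Set (Fin d → ℝ) := fun j₀ => {y | y ∈ hoCube d ∧ ∀ j : ℕ, j₀ ≤ j →
    ∀ k ∈ nbrs c j y, DBound m β φ (box c j k)} with hG
  have hgrow : ∀ j₀, ∀ y ∈ G j₀, ∀ r, 0 < r → r ≤ ((c : ℝ) ^ j₀)⁻¹ →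
      m'.real (Metric.closedBall y r) ≤ 3 ^ d * (K * (c * r) ^ s) := by
    intro j₀ y hy r hr hr'
    have hc01 : ((c : ℝ) ^ j₀)⁻¹ ≤ 1 := inv_le_one_of_one_le₀ (one_le_pow₀ hc1)
    obtain ⟨j, hj1, hj2⟩ := exists_generation_ge hc (r := r / ((c : ℝ) ^ j₀)⁻¹) (by positivity)
      ((div_le_one (by positivity)).2 hr')
    have e : ((c : ℝ) ^ (j₀ + j))⁻¹ = ((c : ℝ) ^ j)⁻¹ * ((c : ℝ) ^ j₀)⁻¹ := by
      rw [pow_add, mul_inv, mul_comm]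
    have h1 : r ≤ ((c : ℝ) ^ (j₀ + j))⁻¹ := by
      rw [e, ← div_le_iff₀ (by positivity)]; exact hj1
    have h2 : ((c : ℝ) ^ (j₀ + j))⁻¹ ≤ c * r := by
      rw [e, ← le_div_iff₀ (by positivity), mul_div_assoc]; exact hj2
    refine measureReal_closedBall_le_of_nbrs hc0 m' hm'c hy.1 h1 (by positivity) fun k hk => ?_
    have h3 := hy.2 (j₀ + j) (by omega) k hk
    unfold DBound at h3
    rw [diam_box hd hc0] at h3
    have h4 : m'.real (box c (j₀ + j) k) ≤ m.real (box c (j₀ + j) k) :=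
      ENNReal.toReal_mono (measure_ne_top _ _) (Measure.restrict_le_self _)
    refine h4.trans (h3.trans ((hKφ _ (by positivity)
      (inv_le_one_of_one_le₀ (one_le_pow₀ hc1))).trans ?_))
    gcongr
  have hAG : ∀ j₀, m' (A ∩ G j₀) = 0 := by
    intro j₀
    set r₀ : ℝ := ((c : ℝ) ^ j₀)⁻¹ with hr₀
    have hr₀0 : 0 < r₀ := by positivity
    set C : ℝ := 3 ^ d * (K * c ^ s) with hC
    have hC0 : 0 < C := by positivity
    have hkey : ∀ η : ℝ, 0 < η → η ≤ r₀ ^ s → m' (A ∩ G j₀) ≤ ENNReal.ofReal (C * η) := by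
      intro η hη hηr
      obtain ⟨V, v, hVA, hv0, hVv, hsum⟩ := exists_cover_of_hausdorffMeasure_zero hs₀pos hHA
        (ENNReal.ofReal_pos.2 hη)
      have hvr : ∀ n, v n ≤ r₀ := by
        intro n
        have h1 := (ENNReal.le_tsum (f := fun n => ENNReal.ofReal (v n ^ s)) n).trans_lt hsum
        have h2 := ((ENNReal.ofReal_lt_ofReal_iff hη).1 h1).trans_le hηr
        by_contra hcon
        exact absurd (Real.rpow_le_rpow hr₀0.le (not_le.1 hcon).le hs₀pos.le) (not_le.2 h2)
      calc m' (A ∩ G j₀) ≤ m' (⋃ n, V n ∩ G j₀) := measure_mono fun z hz => by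
            obtain ⟨n, hn⟩ := mem_iUnion.1 (hVA hz.1)
            exact mem_iUnion.2 ⟨n, hn, hz.2⟩
        _ ≤ ∑' n, m' (V n ∩ G j₀) := measure_iUnion_le _
        _ ≤ ∑' n, ENNReal.ofReal C * ENNReal.ofReal (v n ^ s) := by
            refine ENNReal.tsum_le_tsum fun n => ?_
            rcases (V n ∩ G j₀).eq_empty_or_nonempty with h | ⟨y, hyV, hyG⟩
            · rw [h, measure_empty]; exact zero_le
            · have hsub : V n ∩ G j₀ ⊆ Metric.closedBall y (v n) := fun z hz =>
                Metric.mem_closedBall.2 (hVv n z hz.1 y hyV)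
              refine (measure_mono hsub).trans ?_
              rw [← ofReal_measureReal, ← ENNReal.ofReal_mul hC0.le]
              apply ENNReal.ofReal_le_ofReal
              refine (hgrow j₀ y hyG (v n) (hv0 n) (hvr n)).trans (le_of_eq ?_)
              rw [Real.mul_rpow hcR.le (hv0 n).le, hC]; ring
        _ = ENNReal.ofReal C * ∑' n, ENNReal.ofReal (v n ^ s) := ENNReal.tsum_mul_left
        _ ≤ ENNReal.ofReal C * ENNReal.ofReal η := by gcongr
        _ = _ := (ENNReal.ofReal_mul hC0.le).symm
    have hlim : Tendsto (fun η : ℝ => ENNReal.ofReal (C * η)) (𝓝[>] 0) (𝓝 0) := by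
      have h1 : Tendsto (fun η : ℝ => C * η) (𝓝 0) (𝓝 (C * 0)) :=
        (continuous_const.mul continuous_id).tendsto 0
      rw [mul_zero] at h1
      have h2 := (ENNReal.continuous_ofReal.tendsto 0).comp h1
      rw [ENNReal.ofReal_zero] at h2
      exact h2.mono_left nhdsWithin_le_nhds
    refine nonpos_iff_eq_zero.1 (ge_of_tendsto hlim ?_)
    filter_upwards [Ioo_mem_nhdsGT (show 0 < r₀ ^ s by positivity)] with η hη
    exact hkey η hη.1 hη.2.le
  have hcov : A ∩ hoCube d ⊆ ((⋃ j₀, A ∩ G j₀) ∩ hoCube d) ∪ {y | ¬ (y ∈ hoCube d →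
      ∃ j₀ : ℕ, ∀ j : ℕ, j₀ ≤ j → ∀ k ∈ nbrs c j y, DBound m β φ (box c j k))} := by
    rintro y ⟨hyA, hyc⟩
    by_cases hy : ∃ j₀ : ℕ, ∀ j : ℕ, j₀ ≤ j → ∀ k ∈ nbrs c j y, DBound m β φ (box c j k)
    · obtain ⟨j₀, hj₀⟩ := hy
      exact Or.inl ⟨mem_iUnion.2 ⟨j₀, hyA, hyc, hj₀⟩, hyc⟩
    · exact Or.inr fun h => hy (h hyc)
  refine measure_mono_null hcov (measure_union_null ?_ (ae_iff.1 hup))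
  have h1 : m' (⋃ j₀, A ∩ G j₀) = 0 := measure_iUnion_null hAG
  rwa [hm', Measure.restrict_apply' hmeas] at h1

/-! ### Dimension of the difference set -/

/-- Once `lam n < 1`, a larger exponent gives a smaller ball, so the uncountable union reduces to
the exponents `δ + 1 / (j + 1)`. -/
lemma iUnion_condLimsup_subset (μ : Measure (Fin d → ℝ)) (x : ℕ → Fin d → ℝ) {lam : ℕ → ℝ}
    (hlam : ∀ n, 0 < lam n) (hlam_lim : Tendsto lam atTop (𝓝 0)) (ρ α : ℝ) (ε : ℕ → ℝ) (δ : ℝ) :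
    (⋃ δ' : ℝ, ⋃ _ : δ < δ', condLimsup μ x lam ρ (fun _ => δ') α ε) ⊆
      ⋃ j : ℕ, condLimsup μ x lam ρ (fun _ => δ + 1 / ((j : ℝ) + 1)) α ε := by
  refine iUnion₂_subset fun δ' hδ' y hy => ?_
  obtain ⟨j, hj⟩ := exists_nat_one_div_lt (sub_pos.2 hδ')
  obtain ⟨n₀, hn₀⟩ := eventually_atTop.1 (hlam_lim.eventually_lt_const one_pos)
  refine mem_iUnion.2 ⟨j, mem_condLimsup.2 fun N => ?_⟩
  obtain ⟨n, hn, hn1, hn2⟩ := mem_condLimsup.1 hy (max N n₀)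
  refine ⟨n, (le_max_left _ _).trans hn, hn1, Metric.closedBall_subset_closedBall ?_ hn2⟩
  exact Real.rpow_le_rpow_of_exponent_ge (hlam n) (hn₀ n ((le_max_right _ _).trans hn)).le
    (by linarith)

/-- A set that is not covered by countably many sets of dimension less than `D` has dimension at
least `D`, even after removal of countably many such sets. -/
lemma le_dimH_diff {X : Type*} [EMetricSpace X] {S U : Set X} {D : ℝ≥0∞} {W : ℕ → Set X}
    (hU : U ⊆ ⋃ j, W j) (hW : ∀ j, dimH (W j) < D)
    (h : ∀ A : ℕ → Set X, (∀ j, dimH (A j) < D) → ∃ y ∈ S, ∀ j, y ∉ A j) :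
    D ≤ dimH (S \ U) := by
  by_contra hcon
  rw [not_le] at hcon
  -- If the difference set had smaller dimension, it could itself be added to the list of sets to be
  -- avoided.
  obtain ⟨y, hyS, hy⟩ := h (fun j => Nat.casesOn j (S \ U) W) fun j => by
    cases j with
    | zero => exact hcon
    | succ j => exact hW j
  refine hy 0 ⟨hyS, fun hyU => ?_⟩
  obtain ⟨j, hj⟩ := mem_iUnion.1 (hU hyU)
  exact hy (j + 1) hj

/-! ### Points of the conditioned limsup set outside sets of small dimension -/

/-- Infinitely many scales `j` give infinitely many `n`, because `lam n ≤ c⁻ʲ` forces `n` to be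
large. -/
lemma frequently_of_growthControl {c : ℕ} (hc : 2 ≤ c) {m : Measure (Fin d → ℝ)}
    {mL : ℕ → (Fin d → ℕ) → Measure (Fin d → ℝ)} {β : ℝ} {φ : ℝ → ℝ} {x : ℕ → Fin d → ℝ}
    {lam : ℕ → ℝ} (hlam : ∀ n, 0 < lam n) (hlam_anti : Antitone lam) {D : Set ℝ}
    (hhalf : ∀ᵐ y ∂m, y ∈ halfLimsup x lam) (hgrow : GrowthControl c m mL β φ x lam D) :
    ∀ e ∈ D, ∀ᵐ y ∂m, ∃ᶠ n in atTop, y ∈ Metric.closedBall (x n) (lam n / 2) ∧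
      ∃ (i : ℕ) (k : Fin d → ℕ), IsMaxBox c (Metric.ball (x n) (lam n ^ e)) i k ∧
        GoodBox c mL β φ i k := by
  intro e he
  filter_upwards [hhalf, hgrow.2 e he] with y hy hinf
  rw [frequently_atTop]
  intro N
  have hev := (tendsto_inv_pow_atTop hc).eventually_lt_const (hlam N)
  obtain ⟨J, hJ⟩ := eventually_atTop.1 hev
  obtain ⟨j, ⟨n, hn1, -, hn2, hn3⟩, hj⟩ := (hinf hy).exists_gt J
  exact ⟨n, (lt_index_of_lt hlam_anti (hn2.trans_lt (hJ j hj.le))).le, hn1, hn3⟩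

/-- The case `ρ = 1`, `δ = 1`. -/
lemma exists_mem_condLimsup_notMem_of_halfLimsup (hd : 1 ≤ d) {c : ℕ} (hc : 2 ≤ c)
    {μ m : Measure (Fin d → ℝ)} [IsFiniteMeasure m] (hm : m.support = cube d) {α β : ℝ}
    {φ ψ : ℝ → ℝ} (hφ : IsGaugeExponent φ) {x : ℕ → Fin d → ℝ}
    {lam : ℕ → ℝ} (hlam : ∀ n, 0 < lam n) (hlam_lim : Tendsto lam atTop (𝓝 0)) {ε : ℕ → ℝ}
    (hQ : MassCondNear c μ α 1 ψ x lam (MassCond μ x lam 1 α ε))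
    (hscal : LocalScaling c m μ α ψ) (hup : LocalUpper c m β φ)
    (hhalf : ∀ᵐ y ∂m, y ∈ halfLimsup x lam)
    (A : ℕ → Set (Fin d → ℝ)) (hA : ∀ j, dimH (A j) < ENNReal.ofReal β) :
    ∃ y ∈ condLimsup μ x lam 1 (fun _ => 1) α ε, ∀ j, y ∉ A j := by
  have h0 : m (hoCube d) ≠ 0 := by
    rw [hoCube_eq_box c]
    exact measure_box_ne_zero hm (by omega) fun i => by simp
  -- No good boxes are available at exponent `1`, but none are needed: `m` ignores all the sets `A
  -- j`, so a typical point for `m` is already a solution.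
  have hnull : m ((⋃ j, A j) ∩ hoCube d) = 0 := by
    rw [iUnion_inter]
    exact measure_iUnion_null fun j => measure_inter_hoCube_eq_zero hd hc hφ hup (hA j)
  obtain ⟨y, hyc, hyA, hys, hyh⟩ : ∃ y ∈ hoCube d, y ∉ (⋃ j, A j) ∩ hoCube d ∧
      (y ∈ hoCube d → ∃ j₀ : ℕ, ∀ j : ℕ, j₀ ≤ j → ∀ k ∈ nbrs c j y, PBound μ α ψ (box c j k)) ∧
      y ∈ halfLimsup x lam := by
    have hfreq : ∃ᵐ y ∂m, y ∈ hoCube d := frequently_ae_mem_iff.2 h0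
    have hnull' : ∀ᵐ y ∂m, y ∉ (⋃ j, A j) ∩ hoCube d := measure_eq_zero_iff_ae_notMem.1 hnull
    exact (hfreq.and_eventually (hnull'.and (hscal.and hhalf))).exists
  obtain ⟨r₀, hr₀, hmass⟩ := hQ y hyc (hys hyc)
  obtain ⟨n₀, hn₀⟩ := eventually_atTop.1 (hlam_lim.eventually_lt_const hr₀)
  refine ⟨y, mem_condLimsup.2 fun N => ?_, fun j hj => hyA ⟨mem_iUnion.2 ⟨j, hj⟩, hyc⟩⟩
  simp only [halfLimsup, mem_iInter, mem_iUnion] at hyh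
  obtain ⟨n, hn, hyn⟩ := hyh (max N n₀)
  refine ⟨n, (le_max_left _ _).trans hn, hmass n (hn₀ n ((le_max_right _ _).trans hn)) ?_, ?_⟩
  · rw [dist_comm, Real.rpow_neg_one, Real.rpow_one, inv_mul_eq_div]
    exact Metric.mem_closedBall.1 hyn
  · rw [Real.rpow_one]
    exact Metric.closedBall_subset_closedBall (half_le_self (hlam n).le) hyn

/-- Existence of exponents for which the conditioned limsup set is not covered by countably many
sets of dimension less than `(d(1-ρ)+ρβ)/δ`. -/
lemma exists_exponents_notMem (hd : 1 ≤ d) {c : ℕ} (hc : 2 ≤ c) {μ m : Measure (Fin d → ℝ)}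
    [IsFiniteMeasure m] (hm : m.support = cube d) {mL : ℕ → (Fin d → ℕ) → Measure (Fin d → ℝ)}
    {ρ α β : ℝ} (hρ : 0 < ρ) (hβ : 0 < β) (hβd : β ≤ d) {φ ψ χ : ℝ → ℝ} (hφ : IsGaugeExponent φ)
    {x : ℕ → Fin d → ℝ} (hx : ∀ n, x n ∈ cube d) {lam : ℕ → ℝ} (hlam : ∀ n, 0 < lam n)
    (hlam_anti : Antitone lam) (hlam_lim : Tendsto lam atTop (𝓝 0)) {ε : ℕ → ℝ}
    (hQ : MassCondNear c μ α ρ ψ x lam (MassCond μ x lam ρ α ε))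
    (hscal : LocalScaling c m μ α ψ) (hup : LocalUpper c m β φ) (hself : SelfSimilar c m mL β φ)
    {D : Set ℝ} (hD : D ⊆ Ioi 1)
    (hcov : (ρ = 1 ∧ (∀ᵐ y ∂m, y ∈ halfLimsup x lam) ∧ GrowthControl c m mL β φ x lam D) ∨
      (ρ < 1 ∧ IsGaugeExponent χ ∧ ManyPoints c ρ m χ x lam ∧ UniformGrowthControl c mL β φ))
    {δ : ℝ} (hδ : δ ∈ exponentLimits D) (hδβ : ((d : ℝ) * (1 - ρ) + ρ * β) / β ≤ δ) :
    ∃ δhat : ℕ → ℝ, Monotone δhat ∧ (∀ n, 1 ≤ δhat n) ∧ Tendsto δhat atTop (𝓝 δ) ∧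
      (δ ∈ {1} ∪ D → ∀ n, δhat n = δ) ∧
      ∀ A : ℕ → Set (Fin d → ℝ),
        (∀ j, dimH (A j) < ENNReal.ofReal (((d : ℝ) * (1 - ρ) + ρ * β) / δ)) →
        ∃ y ∈ condLimsup μ x lam ρ δhat α ε, ∀ j, y ∉ A j := by
  have h1δ := one_le_of_mem_exponentLimits hD hδ
  have hc0 : (0 : ℝ) < c := by exact_mod_cast (by omega : 0 < c)
  have hell : ∀ (δhat : ℕ → ℝ) n, 0 < lam n ^ δhat n / (2 * c) := fun δhat n => by
    have := hlam n
    positivity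
  have hbox : ∀ i, ∀ k ∈ grid d c i, m (box c i k) ≠ 0 := fun i k hk =>
    measure_box_ne_zero hm (by omega) hk
  rcases hcov with ⟨rfl, hhalf, hgrow⟩ | ⟨hρ1, hχ, hmany, hunif⟩
  · have hE : ((d : ℝ) * (1 - 1) + 1 * β) = β := by ring
    rw [hE]
    by_cases hδ1 : δ = 1
    · subst hδ1
      refine ⟨fun _ => 1, monotone_const, fun _ => le_rfl, tendsto_const_nhds, fun _ _ => rfl, ?_⟩
      rw [div_one]
      exact exists_mem_condLimsup_notMem_of_halfLimsup hd hc hm hφ hlam hlam_lim hQ hscal hup hhalf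
    · obtain ⟨δhat, hmono, h1, hle, hlim, hconst, hfreq⟩ := exists_exponent_sequence
        (fun n => Metric.isClosed_closedBall.measurableSet) hD
        (frequently_of_growthControl hc hlam hlam_anti hhalf hgrow) hδ hδ1
      refine ⟨δhat, hmono, h1, hlim, hconst, fun A hA => ?_⟩
      obtain ⟨y, hy, hyA⟩ := exists_mem_limsup_notMem hd hc hφ hbox hself x
        (fun n => lam n ^ δhat n) (fun n => lam n ^ δhat n / (2 * c)) (hell δhat)
        (MassCond μ x lam 1 α ε) le_rfl (by positivity)
        (exists_block_of_frequently hd hc hβ hx hlam hlam_lim hQ hscal h1δ h1 hle hfreq) A hA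
      exact ⟨y, mem_condLimsup.2 hy, hyA⟩
  -- For `ρ < 1` all boxes of large generation are good, so a constant exponent works for every `δ`.
  · refine ⟨fun _ => δ, monotone_const, fun _ => h1δ, tendsto_const_nhds, fun _ _ => rfl,
      fun A hA => ?_⟩
    have hE : 0 < ((d : ℝ) * (1 - ρ) + ρ * β) / δ := by
      have : 0 < 1 - ρ := by linarith
      positivity
    obtain ⟨y, hy, hyA⟩ := exists_mem_limsup_notMem hd hc hφ hbox hself x
      (fun n => lam n ^ δ) (fun n => lam n ^ δ / (2 * c)) (hell fun _ => δ)
      (MassCond μ x lam ρ α ε) (one_le_pow₀ (by norm_num)) hE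
      (exists_block_of_manyPoints hd hc hβ hβd hx hlam hlam_anti hρ hρ1 hQ hscal hχ hmany hunif
        h1δ hδβ) A hA
    exact ⟨y, mem_condLimsup.2 hy, hyA⟩

end CondUbiquity

/-! ### Combination of the upper and lower bounds -/

theorem mainTheorem3 {d : ℕ} (hd : 1 ≤ d) (c : ℕ) (hc : 2 ≤ c)
    (μ : Measure (Fin d → ℝ)) [IsFiniteMeasure μ]
    (hμ : μ.support = CondUbiquity.cube d)
    (hμ' : μ (CondUbiquity.cube d \ CondUbiquity.hoCube d) = 0)
    (ρ : ℝ) (hρ : 0 < ρ) (hρ' : ρ ≤ 1)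
    (α β : ℝ) (hα : 0 < α) (hβ : 0 < β)
    (hβτ : CondUbiquity.tauStar c μ α = (β : EReal))
    (x : ℕ → Fin d → ℝ) (hx : ∀ n, x n ∈ CondUbiquity.cube d)
    (lam : ℕ → ℝ) (hlam : ∀ n, 0 < lam n) (hlam_anti : Antitone lam)
    (hlam_lim : Tendsto lam atTop (𝓝 0))
    (hred : CondUbiquity.WeaklyRedundant x lam)
    (φ ψ χ : ℝ → ℝ) (D : Set ℝ)
    (hubi : CondUbiquity.HeterogeneousUbiquitous c ρ μ α β x lam φ ψ χ D)
    (ε : ℕ → ℝ) (hε : Tendsto ε atTop (𝓝 0)) :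
    ∃ M : ℝ, 1 ≤ M ∧
      ∀ δ ∈ CondUbiquity.exponentLimits D, ((d : ℝ) * (1 - ρ) + ρ * β) / β ≤ δ →
        ∃ δhat : ℕ → ℝ,
          Monotone δhat ∧ (∀ n, 1 ≤ δhat n) ∧ Tendsto δhat atTop (𝓝 δ) ∧
          (δ ∈ {1} ∪ D → ∀ n, δhat n = δ) ∧
          dimH (CondUbiquity.condLimsup μ x lam ρ δhat α
              (CondUbiquity.epsSeq lam ρ α ψ χ M)) =
            ENNReal.ofReal (CondUbiquity.dimFormula d β ρ δ) ∧
          dimH (CondUbiquity.condLimsup μ x lam ρ δhat α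
              (CondUbiquity.epsSeq lam ρ α ψ χ M) \
                ⋃ δ' : ℝ, ⋃ _ : δ < δ',
                  CondUbiquity.condLimsup μ x lam ρ (fun _ => δ') α ε) =
            ENNReal.ofReal (CondUbiquity.dimFormula d β ρ δ) := by
  obtain ⟨⟨hφ, hψ, -, -⟩, m, mL, hmfin, hm, hscal, hup, hself, hcase⟩ := hubi
  have hχ0 : (∀ r, 0 ≤ r → 0 ≤ χ r) ∧ Tendsto χ (𝓝[≥] 0) (𝓝 0) := by
    rcases hcase with ⟨-, h, -⟩ | ⟨-, -, h, -⟩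
    · exact ⟨fun r _ => (h r).ge, tendsto_const_nhds.congr fun r => (h r).symm⟩
    · exact ⟨fun r hr => h.chi.nonneg hr, h.chi.tendsto⟩
  have hD : D ⊆ Ioi 1 := by
    rcases hcase with ⟨-, -, -, h⟩ | ⟨-, h, -⟩
    · exact h.1
    · exact h.subset
  obtain ⟨M, hM, hQ⟩ := CondUbiquity.exists_massCondNear hd hc
    (CondUbiquity.measure_compl_hoCube hμ hμ') hα hρ hψ hχ0.1 x hlam
  refine ⟨M, hM, fun δ hδ hδβ => ?_⟩
  obtain ⟨δhat, hmono, h1, hlim, hconst, hnot⟩ := CondUbiquity.exists_exponents_notMem hd hc hm hρ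
    hβ (CondUbiquity.le_dimension_of_tauStar hc hβτ) hφ hx hlam hlam_anti hlam_lim hQ hscal hup
    hself (χ := χ) hD
    (hcase.imp (fun h => ⟨h.1, h.2.2⟩) fun h => ⟨h.1, h.2.2.1.chi, h.2.2.2⟩) hδ hδβ
  refine ⟨δhat, hmono, h1, hlim, hconst, ?_⟩
  have h1δ : 1 ≤ δ := CondUbiquity.one_le_of_mem_exponentLimits hD hδ
  have hE : 0 < (d : ℝ) * (1 - ρ) + ρ * β := by
    have : 0 ≤ 1 - ρ := by linarith
    positivity
  -- The lower bound on `δ` says precisely that the first term realises the minimum.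
  have hdim : CondUbiquity.dimFormula d β ρ δ = ((d : ℝ) * (1 - ρ) + ρ * β) / δ := by
    refine min_eq_left ?_
    rw [div_le_iff₀ hβ] at hδβ
    rw [div_le_iff₀ (by positivity)]
    linarith
  rw [hdim]
  have hupper := CondUbiquity.dimH_condLimsup_le hc hμ hμ' hρ hρ' hα hβ hβτ hx hlam hlam_anti
    hlam_lim hred (CondUbiquity.tendsto_epsSeq hlam hlam_lim hρ (α := α) (by linarith : 0 < M)
      hψ.tendsto hχ0.2) (by linarith : 0 < δ) hlim
  -- The removed sets have exponents `δ + 1 / (j + 1)`. The upper bound, applied with `ε` in place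
  -- of the sequence built from `M`, makes their dimensions strictly smaller because the numerator
  -- is positive.
  have hlower := CondUbiquity.le_dimH_diff
    (CondUbiquity.iUnion_condLimsup_subset μ x hlam hlam_lim ρ α ε δ)
    (fun j => (CondUbiquity.dimH_condLimsup_le hc hμ hμ' hρ hρ' hα hβ hβτ hx hlam hlam_anti
      hlam_lim hred hε (by positivity : 0 < δ + 1 / ((j : ℝ) + 1)) tendsto_const_nhds).trans_lt
        ((ENNReal.ofReal_lt_ofReal_iff (by positivity)).2
          (div_lt_div_of_pos_left hE (by positivity) (lt_add_of_pos_right δ (by positivity)))))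
    hnot
  have hsub := dimH_mono (sdiff_subset (s := CondUbiquity.condLimsup μ x lam ρ δhat α
    (CondUbiquity.epsSeq lam ρ α ψ χ M)) (t := ⋃ δ' : ℝ, ⋃ _ : δ < δ',
      CondUbiquity.condLimsup μ x lam ρ (fun _ => δ') α ε))
  exact ⟨hupper.antisymm (hlower.trans hsub), (hsub.trans hupper).antisymm hlower⟩
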